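/- Let $\mathbb S^2\subset\mathbb R^3$ be the unit sphere with its surface measure $d\sigma$, gradient $\nabla_\sigma$ and Laplace–Beltrami operator $\Delta_\sigma$. For $n\in\mathbb N$ let $P_n$ be the orthogonal projection of $L^2(\mathbb S^2)$ onto the eigenspace of $-\Delta_\sigma$ with eigenvalue $\lambda_n=n(n+1)$ (the spherical harmonics of degree $n$). For $s\in(0,1)$, $\nu>0$, $g\in C^\infty(\mathbb S^2)$ and $u\in L^2(\mathbb S^2)$ put $$(-\Delta_\sigma)^s g=\sum_{n\ge 0}\lambda_n^{s}\,P_n g,\qquad \|u\|_{\dot H^{\nu}(\mathbb S^2)}^2=\sum_{n\ge 0}\lambda_n^{\nu}\,\|P_n u\|_{L^2(\mathbb S^2)}^2\in[0,+\infty];$$ the first sum converges in $L^2(\mathbb S^2)$ and is a smooth function. For a nonnegative smooth function $f$ on $\mathbb S^2$ let $$\mathcal I(f)=\int_{\mathbb S^2}|\nabla_\sigma\log f|^2 f\,d\sigma$$ be its spherical Fisher information (the integrand is $0$ where $f=0$). For $g\ge 0$ and $h$ smooth, $\langle\mathcal I'(g),h\rangle\in[-\infty,+\infty]$ denotes the Gâteaux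 derivative $$\langle\mathcal I'(g),h\rangle=\lim_{\varepsilon\to 0}\frac{\mathcal I(g+\varepsilon h)-\mathcal I(g)}{\varepsilon},$$ where $\varepsilon\ne 0$ runs through the real numbers for which $g+\varepsilon h\ge 0$ (all $\varepsilon$ close to $0$ if $g>0$). **Theorem.** For every $s\in(0,1)$ there is a constant $C_s>0$ such that, for all nonnegative $g\in C^\infty(\mathbb S^2)$, the Gâteaux derivative $\langle \mathcal I'(g),(-\Delta_\sigma)^s g\rangle$ exists in $[-\infty,+\infty]$ (with nonzero admissible $\varepsilon$ arbitrarily close to $0$) and $$\langle \mathcal I'(g),(-\Delta_\sigma)^s g\rangle \;\ge\; C_s\,\|\sqrt g\|^2_{\dot H^{1+s}(\mathbb S^2)} .$$ -/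

import Mathlib

open MeasureTheory Filter Topology
open scoped ContDiff Manifold ENNReal

namespace SphereFisher

noncomputable section

abbrev E3 : Type := EuclideanSpace ℝ (Fin 3)

/-- The unit sphere of `ℝ³`, with Mathlib's smooth structure. -/
abbrev S2 : Type := Metric.sphere (0 : E3) 1

/-- The surface measure of the sphere (total mass `4π`). -/
abbrev surf : Measure S2 := (volume : Measure E3).toSphere

abbrev L2 : Type := Lp ℝ 2 surf

/-- The class in `L²` of a continuous function. -/
def toL2 (f : C(S2, ℝ)) : L2 := ContinuousMap.toLp 2 surf ℝ f

def Smooth (f : S2 → ℝ) : Prop := ContMDiff (𝓡 2) 𝓘(ℝ, ℝ) ∞ f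

/-- The extension of `f` to `ℝ³ \ {0}` that is constant along rays, `x ↦ f (x / |x|)`
(with the irrelevant value `0` at the origin). -/
def radialExt (f : S2 → ℝ) (x : E3) : ℝ :=
  if hx : x = 0 then 0
  else f ⟨‖x‖⁻¹ • x, by simp [norm_smul, hx]⟩

/-- The spherical gradient, a vector of `σ^⊥`: the Euclidean gradient at `σ` of the extension
that is constant along rays. -/
def sphGrad (f : S2 → ℝ) (σ : S2) : E3 := gradient (radialExt f) (σ : E3)

/-- The Laplace-Beltrami operator of the sphere: the Euclidean Laplacian at `σ` of the extension
that is constant along rays. -/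
def sphLaplacian (f : S2 → ℝ) (σ : S2) : ℝ := Laplacian.laplacian (radialExt f) (σ : E3)

/-- The `n`-th eigenvalue (without multiplicity) of minus the spherical Laplacian. -/
def eigenvalue (n : ℕ) : ℝ := (n : ℝ) * ((n : ℝ) + 1)

/-- The eigenspace of minus the spherical Laplacian in `L²` for the eigenvalue `n (n + 1)`, that is,
the spherical harmonics of degree `n`. It is finite dimensional, so that the closure
changes nothing. -/
def eigenspace (n : ℕ) : Submodule ℝ L2 :=
  (Submodule.span ℝ {u : L2 | ∃ Y : C(S2, ℝ), Smooth Y ∧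
    (∀ σ, -sphLaplacian Y σ = eigenvalue n * Y σ) ∧ u = toL2 Y}).topologicalClosure

instance (n : ℕ) : CompleteSpace (eigenspace n) :=
  inferInstanceAs (CompleteSpace (Submodule.topologicalClosure _))

/-- The part of `u` in the `n`-th eigenspace: the sum of `⟨u, Y⟩ Y` over an orthonormal basis of
that eigenspace. -/
def harmonicPart (n : ℕ) (u : L2) : L2 := (eigenspace n).starProjection u

/-- `h` is the function `(-Δ)^s g`, in the spectral sense: `h` is smooth and in `L²` it is the sum
over the eigenspaces of `λ^s` times the component of `g`. There is at most one such `h`. -/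
def IsFracLaplacian (s : ℝ) (g h : C(S2, ℝ)) : Prop :=
  Smooth h ∧ HasSum (fun n : ℕ => eigenvalue n ^ s • harmonicPart n (toL2 g)) (toL2 h)

/-- The squared homogeneous Sobolev seminorm of order `ν`, possibly infinite. -/
def sobolevSq (ν : ℝ) (u : L2) : ℝ≥0∞ :=
  ∑' n : ℕ, ENNReal.ofReal (eigenvalue n ^ ν * ‖harmonicPart n u‖ ^ 2)

/-- The spherical Fisher information `∫ |∇ log f|² f` of a nonnegative smooth function. The
integrand is `0` where `f` vanishes and `|∇ f|² / f` elsewhere; it is bounded if `f` is smooth. -/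
def fisher (f : S2 → ℝ) : ℝ :=
  ∫ σ, ‖sphGrad (fun τ => Real.log (f τ)) σ‖ ^ 2 * f σ ∂surf

/-- `D` is the Gateaux derivative at `g` in the direction `h` of the functional `J`, whose domain
consists of nonnegative functions: the limit in `[-∞, ∞]` of `(J (g + ε h) - J g) / ε` as
`ε → 0` through those `ε ≠ 0` (there must be arbitrarily small ones) for which `g + ε h` is
nonnegative. It is a two-sided limit if `g` is positive. -/
def HasGateauxDeriv (J : (S2 → ℝ) → ℝ) (g h : S2 → ℝ) (D : EReal) : Prop :=
  (𝓝[{ε : ℝ | ε ≠ 0 ∧ ∀ σ, 0 ≤ g σ + ε * h σ}] (0 : ℝ)).NeBot ∧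
  Tendsto (fun ε : ℝ => (((J (fun σ => g σ + ε * h σ) - J g) / ε : ℝ) : EReal))
    (𝓝[{ε : ℝ | ε ≠ 0 ∧ ∀ σ, 0 ≤ g σ + ε * h σ}] (0 : ℝ)) (𝓝 D)

/-- The pointwise square root of a continuous function. -/
def sqrtMap (g : C(S2, ℝ)) : C(S2, ℝ) := ⟨fun σ => √(g σ), by fun_prop⟩

end

end SphereFisher

open MeasureTheory Filter Topology
open scoped ContDiff Manifold ENNReal

namespace SphereFisher

noncomputable section

/-! Write g_t = e^{tΔ} g, w = log g and c_s = ∫_0^∞ (1 - e^{-t}) t^{-1-s} dt (`fracConst`). Since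
c_s x^s = ∫_0^∞ (1 - e^{-tx}) t^{-1-s} dt, the derivative of the Fisher information I at g in the
direction (-Δ)^s g is c_s⁻¹ ∫ ⟨I'(g), g - g_t⟩ t^{-1-s} dt. By convexity ⟨I'(g), g - g_t⟩ ≥ I(g) -
I(g_t) (`fisherSm_sub_le`), so it suffices to bound the loss of information along the heat flow from
below by the modes of √g.

All calculus is done with the three rotation fields L_i. They satisfy Δ = Σ L_i² and |∇f|² = Σ (L_i
f)², commute with Δ, and L_i f always has integral zero. Hence the dissipation is exactly 2 ∫ g Σ
(L_j L_i w)², with no separate curvature term (`dFisher_Lap`). Integration by parts bounds ∫ g |∇w|⁴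
by the same quantity (`integ_grad_fourth_le`), so the dissipation dominates both ‖Δ√g_t‖² and ‖∂_t
√g_t‖² (`sqrt_norms_le`). For the coefficients of √g_t this yields a trace estimate at t = 0: the
modes with λ_n r ≥ 1 satisfy Σ λ_n a_n(0)² ≤ 15 (I(g) - I(g_r)) (`sum_modes_le`). Integrating
against r^{-1-s} turns λ_n into λ_n^{1+s}/s, which gives the constant 1/(15 s c_s)
(`sum_modes_le_dFisher`).

The flow is differentiated only for finite sums of eigenfunctions. For smooth positive g the partial
sums of the harmonic expansion converge uniformly together with their first derivatives, and the
inequality passes to the limit (`sobolev_le_dFn`). The expansion itself rests on Stone-Weierstrass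
for spherical polynomials and a supremum bound on them (`sq_le_of_mem_sphPoly`).

If g ≠ 0 has zeros, h = (-Δ)^s g is negative there (`fracLap_neg_of_zero`). So among small ε exactly
the negative ones are admissible, and they make g + εh positive. Convexity makes the difference
quotients monotone, so their limit exists. The tangent at g + εh bounds the quotient below by ⟨I'(g
+ εh), h⟩ (`dFn_le_slope`), which differs from ⟨I'(g + εh), (-Δ)^s (g + εh)⟩ by ε ⟨I'(g + εh),
(-Δ)^s h⟩, and this tends to zero (`tendsto_mul_dFn`). -/

/-! ### Radial extensions and smoothness -/

/-- The radial projection of a nonzero vector to the sphere. -/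
def sphProj (x : E3) (hx : x ≠ 0) : S2 := ⟨‖x‖⁻¹ • x, by simp [norm_smul, hx]⟩

lemma coe_ne_zero (σ : S2) : (σ : E3) ≠ 0 := ne_zero_of_mem_unit_sphere σ

lemma radialExt_apply (f : S2 → ℝ) {x : E3} (hx : x ≠ 0) :
    radialExt f x = f (sphProj x hx) := by
  simp [radialExt, hx, sphProj]

lemma sphProj_coe (σ : S2) : sphProj σ (coe_ne_zero σ) = σ := by
  ext1; simp [sphProj]

lemma radialExt_coe (f : S2 → ℝ) (σ : S2) : radialExt f σ = f σ := by
  rw [radialExt_apply f (coe_ne_zero σ), sphProj_coe]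

lemma sphProj_smul {r : ℝ} (hr : 0 < r) {x : E3} (hx : x ≠ 0) :
    sphProj (r • x) (smul_ne_zero hr.ne' hx) = sphProj x hx := by
  ext1
  simp only [sphProj, norm_smul, Real.norm_eq_abs, abs_of_pos hr, smul_smul]
  congr 1
  field_simp

lemma radialExt_smul (f : S2 → ℝ) {r : ℝ} (hr : 0 < r) (x : E3) :
    radialExt f (r • x) = radialExt f x := by
  by_cases hx : x = 0
  · simp [hx]
  · rw [radialExt_apply f hx, radialExt_apply f (smul_ne_zero hr.ne' hx), sphProj_smul hr]

instance fact_finrank_E3 : Fact (Module.finrank ℝ E3 = 2 + 1) := ⟨by simp⟩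

/-- Normalisation is singular at the origin, so a bump function replaces the identity by a map φ of
the whole space that agrees with it near x and stays within distance less than |x| of x, hence never
vanishes. -/
lemma Smooth.contDiffAt {f : S2 → ℝ} (hf : Smooth f) {x : E3} (hx : x ≠ 0) :
    ContDiffAt ℝ ∞ (radialExt f) x := by
  obtain ⟨b⟩ : Nonempty {b : ContDiffBump x // b.rOut < ‖x‖} := by
    have hx' : 0 < ‖x‖ := norm_pos_iff.2 hx
    exact ⟨⟨⟨‖x‖ / 4, ‖x‖ / 2, by positivity, by linarith⟩, half_lt_self hx'⟩⟩
  obtain ⟨b, hb⟩ := b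
  let φ : E3 → E3 := fun y => x + b y • (y - x)
  have hφ : ContDiff ℝ ∞ φ := by
    have : ContDiff ℝ ∞ b := b.contDiff
    exact contDiff_const.add (this.smul (contDiff_id.sub contDiff_const))
  have hφ0 : ∀ y, φ y ≠ 0 := by
    intro y h0
    have h1 : ‖b y • (y - x)‖ = ‖x‖ := by
      have : b y • (y - x) = -x := by
        simp only [φ] at h0
        exact (neg_eq_of_add_eq_zero_right h0).symm
      rw [this, norm_neg]
    by_cases hy : y ∈ Metric.ball x b.rOut
    · rw [norm_smul, Real.norm_eq_abs, abs_of_nonneg b.nonneg] at h1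
      have h2 : ‖y - x‖ < b.rOut := by simpa [dist_eq_norm] using hy
      have h3 := b.le_one (x := y)
      nlinarith [norm_nonneg (y - x), b.nonneg (x := y)]
    · have : b y = 0 := b.zero_of_le_dist (by simpa using hy)
      rw [this] at h1
      exact hx (norm_eq_zero.1 (by simpa using h1.symm))
  have hn : ∀ y, ‖φ y‖⁻¹ • φ y ∈ Metric.sphere (0 : E3) 1 := fun y => by
    simp [norm_smul, hφ0 y]
  have hψ : ContDiff ℝ ∞ (fun y => ‖φ y‖⁻¹ • φ y) :=
    ((hφ.norm ℝ hφ0).inv (fun y => by simpa using hφ0 y)).smul hφ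
  have h1 : ContMDiff 𝓘(ℝ, E3) 𝓘(ℝ, ℝ) ∞ (f ∘ Set.codRestrict _ _ hn) :=
    ContMDiff.comp hf (ContMDiff.codRestrict_sphere hψ.contMDiff hn)
  refine (contMDiff_iff_contDiff.1 h1).contDiffAt.congr_of_eventuallyEq ?_
  filter_upwards [b.eventuallyEq_one] with y hy
  have : φ y = y := by simp [φ, hy]
  have hy0 : y ≠ 0 := this ▸ hφ0 y
  rw [radialExt_apply f hy0]
  congr 1
  ext1
  simp [sphProj, this]

lemma smooth_of_contDiffAt {f : S2 → ℝ} {F : E3 → ℝ} (hF : ∀ σ : S2, ContDiffAt ℝ ∞ F σ)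
    (h : ∀ σ : S2, F σ = f σ) : Smooth f := by
  have : f = F ∘ ((↑) : S2 → E3) := funext fun σ => (h σ).symm
  intro σ
  rw [this]
  exact (hF σ).contMDiffAt.comp σ (contMDiff_coe_sphere (m := ∞) (n := 2)).contMDiffAt

/-! ### Rotation fields and the Laplacian as the sum of their squares -/

/-- Infinitesimal rotation about the `i`-th coordinate axis, the cross product `x ↦ eᵢ × x`. -/
def rotGen (i : Fin 3) : E3 →L[ℝ] E3 :=
  LinearMap.toContinuousLinearMap
    { toFun := fun x => WithLp.toLp 2 fun a =>
        if a = i + 1 then -x (i + 2) else if a = i + 2 then x (i + 1) else 0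
      map_add' := fun x y => by
        ext a; simp only [PiLp.add_apply]; split_ifs <;> ring
      map_smul' := fun c x => by
        ext a; simp only [PiLp.smul_apply, smul_eq_mul, RingHom.id_apply]; split_ifs <;> ring }

lemma rotGen_apply (i a : Fin 3) (x : E3) : rotGen i x a =
    if a = i + 1 then -x (i + 2) else if a = i + 2 then x (i + 1) else 0 := rfl

/-- The derivative of a function on the sphere along the rotations about the `i`-th axis. -/
def rotDeriv (i : Fin 3) (f : S2 → ℝ) (σ : S2) : ℝ := fderiv ℝ (radialExt f) σ (rotGen i σ)

lemma fderiv_radialExt_smul (f : S2 → ℝ) {r : ℝ} (hr : 0 < r) (x : E3) :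
    r • fderiv ℝ (radialExt f) (r • x) = fderiv ℝ (radialExt f) x := by
  have h : (fun y => radialExt f (r • y)) = radialExt f := funext fun y => radialExt_smul f hr y
  conv_rhs => rw [← h]
  rw [fderiv_comp_smul]

/-- The differential is homogeneous of degree -1 and the rotation field of degree 1, so their
pairing is constant along rays. This formula off the sphere is what allows rotation derivatives to
be iterated. -/
lemma radialExt_rotDeriv (i : Fin 3) (f : S2 → ℝ) {x : E3} (hx : x ≠ 0) :
    radialExt (rotDeriv i f) x = fderiv ℝ (radialExt f) x (rotGen i x) := by
  rw [radialExt_apply _ hx, ← fderiv_radialExt_smul f (r := ‖x‖⁻¹) (by simpa using hx) x]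
  simp [rotDeriv, sphProj]

lemma Smooth.differentiableAt {f : S2 → ℝ} (hf : Smooth f) {x : E3} (hx : x ≠ 0) :
    DifferentiableAt ℝ (radialExt f) x := (hf.contDiffAt hx).differentiableAt (by simp)

lemma Smooth.rotDeriv {f : S2 → ℝ} (hf : Smooth f) (i : Fin 3) : Smooth (rotDeriv i f) := by
  refine smooth_of_contDiffAt (F := fun x => fderiv ℝ (radialExt f) x (rotGen i x))
    (fun σ => ?_) (fun σ => rfl)
  exact ((hf.contDiffAt (coe_ne_zero σ)).fderiv_right (m := ∞) (by simp)).clm_apply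
    (rotGen i).contDiff.contDiffAt

/-- The algebra of smooth functions on the sphere. -/
def Sm : Subalgebra ℝ (S2 → ℝ) where
  carrier := {f | Smooth f}
  mul_mem' := fun ha hb => ContMDiff.mul ha hb
  add_mem' := fun ha hb => ContMDiff.add ha hb
  algebraMap_mem' := fun _ => contMDiff_const

instance : CommRing Sm := Subalgebra.toCommRing Sm
instance : Algebra ℝ Sm := Subalgebra.algebra Sm
instance : AddCommGroup Sm := Ring.toAddCommGroup
instance : Module ℝ Sm := Algebra.toModule
instance : Neg Sm := Ring.toNeg
instance : Sub Sm := Ring.toSub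

instance : CoeFun Sm fun _ => S2 → ℝ := ⟨fun f => f.1⟩

@[simp] lemma Sm.coe_add (f g : Sm) (σ : S2) : (f + g) σ = f σ + g σ := rfl
@[simp] lemma Sm.coe_mul (f g : Sm) (σ : S2) : (f * g) σ = f σ * g σ := rfl
@[simp] lemma Sm.coe_sub (f g : Sm) (σ : S2) : (f - g) σ = f σ - g σ := rfl
@[simp] lemma Sm.coe_neg (f : Sm) (σ : S2) : (-f) σ = -f σ := rfl
@[simp] lemma Sm.coe_smul (c : ℝ) (f : Sm) (σ : S2) : (c • f) σ = c * f σ := rfl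
@[simp] lemma Sm.coe_zero (σ : S2) : (0 : Sm) σ = 0 := rfl
@[simp] lemma Sm.coe_one (σ : S2) : (1 : Sm) σ = 1 := rfl
@[simp] lemma Sm.coe_pow (f : Sm) (n : ℕ) (σ : S2) : (f ^ n) σ = f σ ^ n := rfl
@[simp] lemma Sm.coe_sum {ι : Type*} (s : Finset ι) (f : ι → Sm) (σ : S2) :
    (∑ i ∈ s, f i) σ = ∑ i ∈ s, f i σ := by
  induction s using Finset.cons_induction with
  | empty => rfl
  | cons a s ha ih => rw [Finset.sum_cons, Finset.sum_cons, Sm.coe_add, ih]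

@[ext] lemma Sm.ext {f g : Sm} (h : ∀ σ, f σ = g σ) : f = g := Subtype.ext (funext h)

lemma Sm.continuous (f : Sm) : Continuous f.1 := ContMDiff.continuous f.2

lemma radialExt_add (f g : S2 → ℝ) : radialExt (f + g) = radialExt f + radialExt g := by
  ext x; by_cases hx : x = 0 <;> simp [radialExt, hx]

lemma radialExt_mul (f g : S2 → ℝ) : radialExt (f * g) = radialExt f * radialExt g := by
  ext x; by_cases hx : x = 0 <;> simp [radialExt, hx]

lemma radialExt_const_smul (c : ℝ) (f : S2 → ℝ) : radialExt (c • f) = c • radialExt f := by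
  ext x; by_cases hx : x = 0 <;> simp [radialExt, hx]

/-- `rotDeriv i` as a derivation of the algebra of smooth functions. -/
def L (i : Fin 3) : Derivation ℝ Sm Sm :=
  Derivation.mk'
    { toFun := fun f => ⟨rotDeriv i f, Smooth.rotDeriv f.2 i⟩
      map_add' := fun f g => by
        ext σ
        have hf := Smooth.differentiableAt f.2 (coe_ne_zero σ)
        have hg := Smooth.differentiableAt g.2 (coe_ne_zero σ)
        change fderiv ℝ (radialExt (f.1 + g.1)) σ _ = fderiv ℝ (radialExt f.1) σ _
          + fderiv ℝ (radialExt g.1) σ _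
        rw [radialExt_add, fderiv_add hf hg]; rfl
      map_smul' := fun c f => by
        ext σ
        have hf := Smooth.differentiableAt f.2 (coe_ne_zero σ)
        change fderiv ℝ (radialExt (c • f.1)) σ _ = c * fderiv ℝ (radialExt f.1) σ _
        rw [radialExt_const_smul, fderiv_const_smul hf]; rfl }
    (fun f g => by
      ext σ
      have hf := Smooth.differentiableAt f.2 (coe_ne_zero σ)
      have hg := Smooth.differentiableAt g.2 (coe_ne_zero σ)
      change fderiv ℝ (radialExt (f.1 * g.1)) σ _ = f σ * fderiv ℝ (radialExt g.1) σ _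
          + g σ * fderiv ℝ (radialExt f.1) σ _
      rw [radialExt_mul, fderiv_mul hf hg]
      simp [radialExt_coe])

lemma L_apply (i : Fin 3) (f : Sm) (σ : S2) :
    L i f σ = fderiv ℝ (radialExt f.1) σ (rotGen i σ) := rfl

lemma radialExt_L (i : Fin 3) (f : Sm) {x : E3} (hx : x ≠ 0) :
    radialExt (L i f).1 x = fderiv ℝ (radialExt f.1) x (rotGen i x) := radialExt_rotDeriv i f.1 hx

/-- The second derivative along rotations in terms of Euclidean derivatives. -/
lemma L_L_apply (i j : Fin 3) (f : Sm) (σ : S2) :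
    L i (L j f) σ = fderiv ℝ (fderiv ℝ (radialExt f.1)) σ (rotGen i σ) (rotGen j σ)
      + fderiv ℝ (radialExt f.1) σ (rotGen j (rotGen i σ)) := by
  have hσ := coe_ne_zero σ
  have h : radialExt (L j f).1 =ᶠ[𝓝 (σ : E3)]
      fun x => fderiv ℝ (radialExt f.1) x (rotGen j x) := by
    filter_upwards [isOpen_ne.mem_nhds hσ] with x hx using radialExt_L j f hx
  have hd : DifferentiableAt ℝ (fderiv ℝ (radialExt f.1)) σ :=
    ((Smooth.contDiffAt f.2 hσ).fderiv_right (m := ∞) (by simp)).differentiableAt (by simp)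
  rw [L_apply, h.fderiv_eq, fderiv_clm_apply hd (rotGen j).differentiableAt]
  simp [add_comm]

lemma fderiv_radialExt_self (f : Sm) {x : E3} (hx : x ≠ 0) :
    fderiv ℝ (radialExt f.1) x x = 0 := by
  have h1 := (Smooth.differentiableAt f.2 hx).hasFDerivAt
  have h2 : HasDerivAt (fun r : ℝ => (1 + r) • x) x 0 := by
    simpa using ((hasDerivAt_id (0 : ℝ)).const_add 1).smul_const x
  have h3 : HasDerivAt (fun r : ℝ => radialExt f.1 ((1 + r) • x))
      (fderiv ℝ (radialExt f.1) x x) 0 := by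
    have h1' : HasFDerivAt (radialExt f.1) (fderiv ℝ (radialExt f.1) x) ((1 + (0 : ℝ)) • x) := by
      simpa using h1
    exact h1'.comp_hasDerivAt (0 : ℝ) h2
  have h4 : (fun r : ℝ => radialExt f.1 ((1 + r) • x)) =ᶠ[𝓝 0] fun _ => radialExt f.1 x := by
    filter_upwards [lt_mem_nhds (show (-1 : ℝ) < 0 by norm_num)] with r hr
    exact radialExt_smul _ (by linarith) _
  exact h3.unique ((hasDerivAt_const (0 : ℝ) _).congr_of_eventuallyEq h4)

/-- Euler's identity `fderiv_radialExt_self`, differentiated once more in the radial direction. -/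
lemma fderiv_fderiv_radialExt_self (f : Sm) (σ : S2) :
    fderiv ℝ (fderiv ℝ (radialExt f.1)) σ σ σ = 0 := by
  have hσ := coe_ne_zero σ
  have h : (fun x => fderiv ℝ (radialExt f.1) x x) =ᶠ[𝓝 (σ : E3)] fun _ => 0 := by
    filter_upwards [isOpen_ne.mem_nhds hσ] with x hx using fderiv_radialExt_self f hx
  have hd : DifferentiableAt ℝ (fderiv ℝ (radialExt f.1)) σ :=
    ((Smooth.contDiffAt f.2 hσ).fderiv_right (m := ∞) (by simp)).differentiableAt (by simp)
  have h2 := h.fderiv_eq (𝕜 := ℝ)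
  rw [fderiv_clm_apply hd (differentiableAt_fun_id (𝕜 := ℝ))] at h2
  have h3 := congrArg (fun l : E3 →L[ℝ] ℝ => l σ) h2
  simpa [fderiv_radialExt_self f hσ] using h3

/-- The Laplace-Beltrami operator as the sum of the squares of the rotation fields. -/
def Lap : Sm →ₗ[ℝ] Sm := ∑ i, (L i : Sm →ₗ[ℝ] Sm) ∘ₗ (L i : Sm →ₗ[ℝ] Sm)

lemma Lap_apply (f : Sm) : Lap f = ∑ i, L i (L i f) := by
  simp [Lap]

lemma sum_sq_coe (σ : S2) : (σ : E3) 0 ^ 2 + (σ : E3) 1 ^ 2 + (σ : E3) 2 ^ 2 = 1 := by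
  have h : ‖(σ : E3)‖ ^ 2 = 1 := by simp
  rw [EuclideanSpace.real_norm_sq_eq] at h
  simpa [Fin.sum_univ_three] using h

/-- The standard unit vectors. -/
abbrev unitVec (a : Fin 3) : E3 := EuclideanSpace.single a 1

lemma eq_sum_unitVec (x : E3) : x = x 0 • unitVec 0 + x 1 • unitVec 1 + x 2 • unitVec 2 := by
  ext a; fin_cases a <;> simp

lemma rotGen_zero_eq (x : E3) : rotGen 0 x = (-x 2) • unitVec 1 + x 1 • unitVec 2 := by
  ext a; fin_cases a <;> simp [rotGen_apply]
lemma rotGen_one_eq (x : E3) : rotGen 1 x = x 2 • unitVec 0 + (-x 0) • unitVec 2 := by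
  ext a; fin_cases a <;> simp [rotGen_apply]
lemma rotGen_two_eq (x : E3) : rotGen 2 x = (-x 1) • unitVec 0 + x 0 • unitVec 1 := by
  ext a; fin_cases a <;> simp [rotGen_apply]

/-- Lagrange's identity for the cross product: Σ (eᵢ × x) ⊗ (eᵢ × x) = |x|² Id - x ⊗ x. -/
lemma sum_rotGen_quadratic (B : E3 →L[ℝ] E3 →L[ℝ] ℝ) (x : E3) :
    ∑ i, B (rotGen i x) (rotGen i x) =
      (x 0 ^ 2 + x 1 ^ 2 + x 2 ^ 2) * ∑ a, B (unitVec a) (unitVec a) - B x x := by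
  simp only [Fin.sum_univ_three, rotGen_zero_eq, rotGen_one_eq, rotGen_two_eq]
  conv_rhs => rw [eq_sum_unitVec x]
  simp only [map_add, map_smul, _root_.add_apply, _root_.smul_apply,
    smul_eq_mul, PiLp.add_apply, PiLp.smul_apply]
  simp
  ring

lemma sum_rotGen_rotGen (x : E3) : ∑ i, rotGen i (rotGen i x) = (-2 : ℝ) • x := by
  ext a
  fin_cases a <;> simp [Fin.sum_univ_three, rotGen_apply] <;> ring

/-- By Lagrange's identity the two sides differ by the second radial derivative and by -2 times the
first, both zero for a function constant along rays. -/
lemma sphLaplacian_eq (f : Sm) (σ : S2) : sphLaplacian f.1 σ = Lap f σ := by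
  have h := sum_rotGen_quadratic (fderiv ℝ (fderiv ℝ (radialExt f.1)) σ) σ
  rw [Lap_apply, Sm.coe_sum]
  simp only [L_L_apply, Finset.sum_add_distrib]
  rw [h, sum_sq_coe, ← map_sum, sum_rotGen_rotGen, map_smul,
    fderiv_radialExt_self f (coe_ne_zero σ), fderiv_fderiv_radialExt_self, sphLaplacian,
    InnerProductSpace.laplacian_eq_iteratedFDeriv_orthonormalBasis _
      (EuclideanSpace.basisFun (Fin 3) ℝ)]
  simp [iteratedFDeriv_two_apply]

lemma norm_gradient_sq (F : E3 → ℝ) (σ : S2) (h : fderiv ℝ F σ σ = 0) :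
    ‖gradient F (σ : E3)‖ ^ 2 = ∑ i, (fderiv ℝ F σ (rotGen i σ)) ^ 2 := by
  have hc : ∀ a, gradient F (σ : E3) a = fderiv ℝ F σ (unitVec a) := by
    intro a
    have := InnerProductSpace.toDual_symm_apply (𝕜 := ℝ) (x := unitVec a) (y := fderiv ℝ F σ)
    rw [← this, gradient, EuclideanSpace.inner_single_right]
    simp
  rw [EuclideanSpace.real_norm_sq_eq]
  have h' := h
  nth_rw 2 [eq_sum_unitVec (σ : E3)] at h'
  have hs := sum_sq_coe σ
  simp only [Fin.sum_univ_three, hc, rotGen_zero_eq, rotGen_one_eq, rotGen_two_eq]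
  simp only [map_add, map_smul, smul_eq_mul] at h' ⊢
  generalize fderiv ℝ F σ (unitVec 0) = p at *
  generalize fderiv ℝ F σ (unitVec 1) = q at *
  generalize fderiv ℝ F σ (unitVec 2) = r at *
  generalize (σ : E3) 0 = x at *
  generalize (σ : E3) 1 = y at *
  generalize (σ : E3) 2 = z at *
  linear_combination (x * p + y * q + z * r) * h' - (p ^ 2 + q ^ 2 + r ^ 2) * hs

/-- Rotations about different axes commute up to a rotation about the third axis. -/
lemma L_comm (i j : Fin 3) (f : Sm) (σ : S2) :
    L i (L j f) σ - L j (L i f) σ =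
      fderiv ℝ (radialExt f.1) σ (rotGen j (rotGen i σ) - rotGen i (rotGen j σ)) := by
  have hs : IsSymmSndFDerivAt ℝ (radialExt f.1) (σ : E3) :=
    (Smooth.contDiffAt f.2 (coe_ne_zero σ)).isSymmSndFDerivAt (by simpa using WithTop.coe_le_coe.2 (le_top : (2 : ℕ∞) ≤ ⊤))
  rw [L_L_apply, L_L_apply, map_sub, hs.eq (rotGen i σ) (rotGen j σ)]
  ring

lemma rotGen_comm (i : Fin 3) (x : E3) :
    rotGen (i + 1) (rotGen i x) - rotGen i (rotGen (i + 1) x) = -rotGen (i + 2) x := by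
  ext a
  fin_cases i <;> fin_cases a <;> simp [rotGen_apply]

lemma L_comm_succ (i : Fin 3) (f : Sm) : L i (L (i + 1) f) = L (i + 1) (L i f) - L (i + 2) f := by
  ext σ
  have := L_comm i (i + 1) f σ
  rw [rotGen_comm, map_neg, ← L_apply] at this
  rw [Sm.coe_sub]
  linarith

/-- `Lap` is the Casimir element of so(3): the terms produced by the commutation relations cancel in
pairs. -/
lemma Lap_L (i : Fin 3) (f : Sm) : Lap (L i f) = L i (Lap f) := by
  have h0 := L_comm_succ 0
  have h1 := L_comm_succ 1
  have h2 := L_comm_succ 2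
  simp only [show (0 : Fin 3) + 1 = 1 from rfl, show (0 : Fin 3) + 2 = 2 from rfl,
    show (1 : Fin 3) + 1 = 2 from rfl, show (1 : Fin 3) + 2 = 0 from rfl,
    show (2 : Fin 3) + 1 = 0 from rfl, show (2 : Fin 3) + 2 = 1 from rfl] at h0 h1 h2
  rw [Lap_apply, Lap_apply, map_sum]
  fin_cases i <;> simp [Fin.sum_univ_three, h0, h1, h2] <;> abel

/-! ### Rotations -/

/-- The rotation by the angle `θ` about the `i`-th axis, as a linear map. -/
def rotLin (i : Fin 3) (θ : ℝ) : E3 →L[ℝ] E3 :=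
  ContinuousLinearMap.id ℝ E3 + Real.sin θ • rotGen i
    + (1 - Real.cos θ) • (rotGen i).comp (rotGen i)

lemma rotLin_apply (i : Fin 3) (θ : ℝ) (x : E3) :
    rotLin i θ x = x + Real.sin θ • rotGen i x + (1 - Real.cos θ) • rotGen i (rotGen i x) := by
  simp [rotLin]

lemma norm_rotLin (i : Fin 3) (θ : ℝ) (x : E3) : ‖rotLin i θ x‖ = ‖x‖ := by
  rw [← sq_eq_sq₀ (norm_nonneg _) (norm_nonneg _), EuclideanSpace.real_norm_sq_eq,
    EuclideanSpace.real_norm_sq_eq]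
  have h := Real.sin_sq_add_cos_sq θ
  fin_cases i <;> simp [Fin.sum_univ_three, rotLin_apply, rotGen_apply] <;>
    generalize Real.sin θ = s at * <;> generalize Real.cos θ = c at *
  · linear_combination (x 1 ^ 2 + x 2 ^ 2) * h
  · linear_combination (x 0 ^ 2 + x 2 ^ 2) * h
  · linear_combination (x 0 ^ 2 + x 1 ^ 2) * h

/-- The rotation by the angle `θ` about the `i`-th axis. -/
def rotEquiv (i : Fin 3) (θ : ℝ) : E3 ≃ₗᵢ[ℝ] E3 :=
  LinearIsometry.toLinearIsometryEquiv ⟨(rotLin i θ : E3 →ₗ[ℝ] E3), norm_rotLin i θ⟩ rfl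

lemma rotEquiv_apply (i : Fin 3) (θ : ℝ) (x : E3) : rotEquiv i θ x = rotLin i θ x := rfl

lemma rotEquiv_zero (i : Fin 3) (x : E3) : rotEquiv i 0 x = x := by
  simp [rotEquiv_apply, rotLin_apply]

lemma hasDerivAt_rotEquiv (i : Fin 3) (θ : ℝ) (x : E3) :
    HasDerivAt (fun t => rotEquiv i t x) (rotGen i (rotEquiv i θ x)) θ := by
  simp only [rotEquiv_apply, rotLin_apply]
  have h := (((Real.hasDerivAt_sin θ).smul_const (rotGen i x)).const_add x).add
    (((Real.hasDerivAt_cos θ).const_sub 1).smul_const (rotGen i (rotGen i x)))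
  refine h.congr_deriv ?_
  -- The generator kills the axis and is a quarter turn in the orthogonal plane. This closes
  -- Rodrigues' formula under differentiation.
  have h3 : rotGen i (rotGen i (rotGen i x)) = -rotGen i x := by
    ext a; fin_cases i <;> fin_cases a <;> simp [rotGen_apply]
  simp only [map_add, map_smul, h3, neg_neg]
  module

/-- The action of a linear isometry on the sphere. -/
def sphMap (R : E3 ≃ₗᵢ[ℝ] E3) (σ : S2) : S2 := ⟨R σ, by simp⟩

@[simp] lemma coe_sphMap (R : E3 ≃ₗᵢ[ℝ] E3) (σ : S2) : (sphMap R σ : E3) = R σ := rfl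

lemma continuous_sphMap (R : E3 ≃ₗᵢ[ℝ] E3) : Continuous (sphMap R) := by
  unfold sphMap; fun_prop

open scoped Pointwise in
/-- The surface measure is invariant under linear isometries. -/
lemma measurePreserving_sphMap (R : E3 ≃ₗᵢ[ℝ] E3) : MeasurePreserving (sphMap R) surf surf := by
  refine ⟨(continuous_sphMap R).measurable, ?_⟩
  ext s hs
  have hs' : MeasurableSet (sphMap R ⁻¹' s) := (continuous_sphMap R).measurable hs
  rw [Measure.map_apply (continuous_sphMap R).measurable hs, Measure.toSphere_apply' _ hs,
    Measure.toSphere_apply' _ hs']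
  congr 1
  -- Surface measure is a multiple of the Lebesgue measure of the cone over the set, so invariance
  -- reduces to that of Lebesgue measure.
  have : Set.Ioo (0 : ℝ) 1 • (((↑) : S2 → E3) '' (sphMap R ⁻¹' s))
      = R ⁻¹' (Set.Ioo (0 : ℝ) 1 • (((↑) : S2 → E3) '' s)) := by
    ext x
    simp only [Set.mem_smul, Set.mem_preimage, Set.mem_image]
    constructor
    · rintro ⟨r, hr, _, ⟨σ, hσ, rfl⟩, rfl⟩
      exact ⟨r, hr, _, ⟨_, hσ, rfl⟩, by simp⟩
    · rintro ⟨r, hr, _, ⟨σ, hσ, rfl⟩, h⟩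
      refine ⟨r, hr, _, ⟨sphMap R.symm σ, ?_, rfl⟩, ?_⟩
      · have : sphMap R (sphMap R.symm σ) = σ := by ext1; simp
        simpa [this] using hσ
      · apply R.injective
        simpa using h
  rw [this]
  exact R.measurePreserving.measure_preimage_emb R.toHomeomorph.measurableEmbedding _

lemma hasDerivAt_comp_rot (f : Sm) (i : Fin 3) (σ : S2) (θ : ℝ) :
    HasDerivAt (fun t => f (sphMap (rotEquiv i t) σ)) (L i f (sphMap (rotEquiv i θ) σ)) θ := by
  have h1 := (Smooth.differentiableAt f.2 (coe_ne_zero (sphMap (rotEquiv i θ) σ))).hasFDerivAt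
  have h2 := h1.comp_hasDerivAt θ (hasDerivAt_rotEquiv i θ σ)
  have : (radialExt f.1 ∘ fun t => rotEquiv i t (σ : E3))
      = fun t => f (sphMap (rotEquiv i t) σ) := by
    ext t
    exact radialExt_coe f.1 (sphMap (rotEquiv i t) σ)
  rw [this] at h2
  exact h2

lemma integrable_continuous {f : S2 → ℝ} (hf : Continuous f) : Integrable f surf :=
  hf.integrable_of_hasCompactSupport (HasCompactSupport.of_compactSpace f)

/-- Integration over the sphere. -/
def integ : Sm →ₗ[ℝ] ℝ where
  toFun f := ∫ σ, f σ ∂surf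
  map_add' f g := integral_add (integrable_continuous (Sm.continuous f))
    (integrable_continuous (Sm.continuous g))
  map_smul' c _ := integral_const_mul c _

lemma integ_apply (f : Sm) : integ f = ∫ σ, f σ ∂surf := rfl

/-- Differentiation of integrals over the sphere that depend on a parameter. -/
lemma hasDerivAt_integral_sphere {U : Set ℝ} (hU : IsOpen U) {Φ Φ' : ℝ → S2 → ℝ}
    (hΦ : ∀ t ∈ U, Continuous (Φ t))
    (hd : ∀ t ∈ U, ∀ σ, HasDerivAt (fun r => Φ r σ) (Φ' t σ) t)
    (hc : ContinuousOn (Function.uncurry Φ') (U ×ˢ Set.univ)) {t : ℝ} (ht : t ∈ U) :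
    HasDerivAt (fun r => ∫ σ, Φ r σ ∂surf) (∫ σ, Φ' t σ ∂surf) t := by
  obtain ⟨ε, hε, hb⟩ := Metric.nhds_basis_closedBall.mem_iff.1 (hU.mem_nhds ht)
  have hK : IsCompact (Metric.closedBall t ε ×ˢ (Set.univ : Set S2)) :=
    (isCompact_closedBall t ε).prod isCompact_univ
  obtain ⟨C, hC⟩ := hK.exists_bound_of_continuousOn
    (hc.mono (Set.prod_mono hb (Set.subset_univ _)))
  have hΦ't : Continuous (Φ' t) := by
    have := hc.comp_continuous (f := fun σ : S2 => (t, σ)) (by fun_prop) (fun σ => ⟨ht, trivial⟩)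
    exact this
  refine (hasDerivAt_integral_of_dominated_loc_of_deriv_le (bound := fun _ => C)
    (Metric.ball_mem_nhds t hε) ?_ (integrable_continuous (hΦ t ht))
    hΦ't.aestronglyMeasurable ?_ (integrable_const C) ?_).2
  · filter_upwards [hU.mem_nhds ht] with r hr using (hΦ r hr).aestronglyMeasurable
  · exact .of_forall fun σ r hr => hC (r, σ) ⟨Metric.ball_subset_closedBall hr, trivial⟩
  · exact .of_forall fun σ r hr => hd r (hb (Metric.ball_subset_closedBall hr)) σ

lemma continuous_sphMap_rotEquiv (i : Fin 3) :
    Continuous fun p : ℝ × S2 => sphMap (rotEquiv i p.1) p.2 := by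
  refine Continuous.subtype_mk ?_ _
  simp only [rotEquiv_apply, rotLin_apply]
  fun_prop

/-- Integration by parts for the rotation fields. -/
lemma integ_L (i : Fin 3) (f : Sm) : integ (L i f) = 0 := by
  -- The integral of f composed with a rotation does not depend on the angle; its derivative at
  -- angle 0 is the integral of `L i f`.
  have h := hasDerivAt_integral_sphere (U := Set.univ) isOpen_univ
    (Φ := fun t σ => f (sphMap (rotEquiv i t) σ))
    (Φ' := fun t σ => L i f (sphMap (rotEquiv i t) σ))
    (fun t _ => (Sm.continuous f).comp (continuous_sphMap _))
    (fun t _ σ => hasDerivAt_comp_rot f i σ t)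
    (((Sm.continuous (L i f)).comp (continuous_sphMap_rotEquiv i)).continuousOn) (Set.mem_univ 0)
  have hinv : ∀ (k : Sm) (t : ℝ), ∫ σ, k (sphMap (rotEquiv i t) σ) ∂surf = ∫ σ, k σ ∂surf := by
    intro k t
    have hm := measurePreserving_sphMap (rotEquiv i t)
    have := integral_map hm.measurable.aemeasurable (f := k.1) (μ := surf)
      (Sm.continuous k).aestronglyMeasurable
    rw [hm.map_eq] at this
    exact this.symm
  simp only [hinv] at h
  exact h.unique (hasDerivAt_const _ _)

/-! ### Spherical polynomials -/

/-- The coordinate functions on the sphere. -/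
def coord (a : Fin 3) : Sm :=
  ⟨fun σ => (σ : E3) a, smooth_of_contDiffAt (F := fun x : E3 => x a)
    (fun _ => (EuclideanSpace.proj (𝕜 := ℝ) a).contDiff.contDiffAt) fun _ => rfl⟩

@[simp] lemma coord_apply (a : Fin 3) (σ : S2) : coord a σ = (σ : E3) a := rfl

lemma sphMap_rotEquiv_zero (i : Fin 3) (σ : S2) : sphMap (rotEquiv i 0) σ = σ := by
  ext1; simp [rotEquiv_zero]

lemma L_coord_apply (i a : Fin 3) (σ : S2) : L i (coord a) σ = rotGen i σ a := by
  have h := hasDerivAt_comp_rot (coord a) i σ 0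
  rw [sphMap_rotEquiv_zero] at h
  have h2 := hasDerivAt_rotEquiv i 0 (σ : E3)
  rw [rotEquiv_zero] at h2
  have h3 := (EuclideanSpace.proj (𝕜 := ℝ) a : E3 →L[ℝ] ℝ).hasFDerivAt.comp_hasDerivAt (0 : ℝ) h2
  exact h.unique h3

/-- The inner product of the gradients. -/
def gradMul (f g : Sm) : Sm := ∑ i, L i f * L i g

lemma gradMul_coord (a b : Fin 3) :
    gradMul (coord a) (coord b) = (if a = b then 1 else 0) - coord a * coord b := by
  ext σ
  have hs := sum_sq_coe σ
  simp only [gradMul, Sm.coe_add, Sm.coe_mul, L_coord_apply, Fin.sum_univ_three, Sm.coe_sub,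
    coord_apply]
  fin_cases a <;> fin_cases b <;> simp [rotGen_apply] <;> linarith

lemma Lap_mul (f g : Sm) : Lap (f * g) = f * Lap g + g * Lap f + 2 * gradMul f g := by
  simp only [Lap_apply, gradMul, Derivation.leibniz, map_add, smul_eq_mul, Fin.sum_univ_three]
  ring

lemma gradMul_mul (f g h : Sm) : gradMul f (g * h) = g * gradMul f h + h * gradMul f g := by
  simp only [gradMul, Derivation.leibniz, smul_eq_mul, Fin.sum_univ_three]
  ring

lemma gradMul_comm (f g : Sm) : gradMul f g = gradMul g f := by
  simp only [gradMul, mul_comm]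

lemma gradMul_add (f g h : Sm) : gradMul f (g + h) = gradMul f g + gradMul f h := by
  simp only [gradMul, map_add, mul_add, Finset.sum_add_distrib]

lemma Lap_one : Lap 1 = 0 := by simp [Lap_apply]

lemma Lap_coord (a : Fin 3) : Lap (coord a) = (-2 : ℝ) • coord a := by
  have hL : ∀ i b, L i (coord b) = if b = i + 1 then -coord (i + 2) else
      if b = i + 2 then coord (i + 1) else 0 := by
    intro i b
    ext σ
    rw [L_coord_apply, rotGen_apply]
    split_ifs <;> rfl
  have h2 : ∀ f : Sm, (-2 : ℝ) • f = -f - f := fun f => by module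
  rw [Lap_apply, Fin.sum_univ_three, h2]
  fin_cases a <;> simp [hL] <;> abel

/-- The restrictions to the sphere of the polynomials of degree at most one. -/
def affineFns : Submodule ℝ Sm := Submodule.span ℝ (insert 1 (Set.range coord))

lemma one_mem_affineFns : (1 : Sm) ∈ affineFns := Submodule.subset_span (Set.mem_insert _ _)

lemma coord_mem_affineFns (a : Fin 3) : coord a ∈ affineFns :=
  Submodule.subset_span (Set.mem_insert_of_mem _ ⟨a, rfl⟩)

/-- The restrictions to the sphere of the polynomials of degree at most `N`. -/
def sphPoly (N : ℕ) : Submodule ℝ Sm := affineFns ^ N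

lemma sphPoly_le_succ (N : ℕ) : sphPoly N ≤ sphPoly (N + 1) := fun p hp => by
  have := Submodule.mul_mem_mul hp one_mem_affineFns
  rwa [mul_one, sphPoly, ← Submodule.pow_succ] at this

lemma sphPoly_mono : Monotone sphPoly := monotone_nat_of_le_succ sphPoly_le_succ

lemma mul_coord_mem {N : ℕ} {p : Sm} (hp : p ∈ sphPoly N) (a : Fin 3) :
    p * coord a ∈ sphPoly (N + 1) := by
  rw [sphPoly, Submodule.pow_succ]
  exact Submodule.mul_mem_mul hp (coord_mem_affineFns a)

/-- Induction on spherical polynomials. -/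
lemma sphPoly_succ_induction {N : ℕ} {Q : Sm → Prop}
    (h1 : ∀ p ∈ sphPoly N, Q p) (hx : ∀ p ∈ sphPoly N, ∀ a, Q (p * coord a))
    (hadd : ∀ p q, Q p → Q q → Q (p + q)) {p : Sm} (hp : p ∈ sphPoly (N + 1)) : Q p := by
  rw [sphPoly, Submodule.pow_succ] at hp
  refine Submodule.mul_induction_on hp (fun q hq w hw => ?_) hadd
  have : ∀ q ∈ sphPoly N, Q (q * w) := by
    refine Submodule.span_induction (p := fun w _ => ∀ q ∈ sphPoly N, Q (q * w))
      ?_ ?_ ?_ ?_ hw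
    · rintro w (rfl | ⟨a, rfl⟩) q hq
      · simpa using h1 q hq
      · exact hx q hq a
    · intro q hq; simpa using h1 0 (zero_mem _)
    · intro x y _ _ ihx ihy q hq; rw [mul_add]; exact hadd _ _ (ihx q hq) (ihy q hq)
    · intro c x _ ih q hq
      rw [mul_smul_comm, ← smul_mul_assoc]
      exact ih _ (Submodule.smul_mem _ c hq)
  exact this q hq

lemma sphPoly_zero_eq {p : Sm} (hp : p ∈ sphPoly 0) : ∃ c : ℝ, p = c • 1 := by
  rw [sphPoly, Submodule.pow_zero, Submodule.mem_one] at hp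
  obtain ⟨c, rfl⟩ := hp
  exact ⟨c, Algebra.algebraMap_eq_smul_one c⟩

/-- For p homogeneous of degree N, ∇x_a · ∇p is the Euclidean ∂_a p minus N x_a p. Hence -N x_a p is
its only part of degree N + 1. -/
lemma gradMul_coord_mem (a : Fin 3) {N : ℕ} {p : Sm} (hp : p ∈ sphPoly N) :
    gradMul (coord a) p + (N : ℝ) • (p * coord a) ∈ sphPoly N := by
  induction N generalizing p with
  | zero =>
    obtain ⟨c, rfl⟩ := sphPoly_zero_eq hp
    simp [gradMul]
  | succ N ih =>
    refine sphPoly_succ_induction (Q := fun p => gradMul (coord a) p +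
      ((N + 1 : ℕ) : ℝ) • (p * coord a) ∈ sphPoly (N + 1))
      (fun p hp => ?_) (fun p hp b => ?_) (fun p q h1 h2 => ?_) hp
    · have h1 := sphPoly_le_succ N (ih hp)
      have h2 := mul_coord_mem hp a
      convert add_mem h1 h2 using 1
      push_cast; module
    · have h1 := mul_coord_mem (ih hp) b
      have h2 : p * (if a = b then 1 else 0) ∈ sphPoly (N + 1) := by
        split_ifs
        · simpa using sphPoly_le_succ N hp
        · simp
      convert add_mem h1 h2 using 1
      rw [gradMul_mul, gradMul_coord, add_mul, smul_mul_assoc]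
      have : ((N + 1 : ℕ) : ℝ) • (p * coord b * coord a)
        = (N : ℝ) • (p * coord a * coord b) + p * coord a * coord b := by
        rw [show p * coord b * coord a = p * coord a * coord b by ring]; push_cast; module
      rw [this]; ring
    · convert add_mem h1 h2 using 1
      rw [gradMul_add, add_mul, smul_add]; abel

/-- `-Δ` acts on polynomials of degree `N` as `N (N + 1)` up to lower order. -/
lemma Lap_add_mem {N : ℕ} {p : Sm} (hp : p ∈ sphPoly N) :
    Lap p + eigenvalue N • p ∈ (Nat.casesOn N ⊥ sphPoly : Submodule ℝ Sm) := by
  induction N generalizing p with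
  | zero =>
    obtain ⟨c, rfl⟩ := sphPoly_zero_eq hp
    simp [Lap_one, eigenvalue]
  | succ N ih =>
    have key : ∀ p ∈ sphPoly N, Lap p + eigenvalue N • p ∈ sphPoly N := by
      intro p hp
      have := ih hp
      cases N with
      | zero => rw [(Submodule.mem_bot ℝ).1 this]; exact zero_mem _
      | succ N => exact sphPoly_le_succ N this
    refine sphPoly_succ_induction (Q := fun p => Lap p + eigenvalue (N + 1) • p ∈ sphPoly N)
      (fun p hp => ?_) (fun p hp a => ?_) (fun p q h1 h2 => ?_) hp
    · convert add_mem (key p hp) (Submodule.smul_mem _ (eigenvalue (N + 1) - eigenvalue N) hp)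
        using 1
      module
    · have h1 : (Lap p + eigenvalue N • p) * coord a ∈ sphPoly N := by
        have := ih hp
        cases N with
        | zero => rw [(Submodule.mem_bot ℝ).1 this]; simp
        | succ N => exact mul_coord_mem this a
      have h2 := Submodule.smul_mem _ (2 : ℝ) (gradMul_coord_mem a hp)
      change _ ∈ sphPoly N
      convert add_mem h1 h2 using 1
      rw [Lap_mul, Lap_coord, gradMul_comm, add_mul, smul_mul_assoc, mul_smul_comm]
      -- The increment 2N + 2 cancels the -2N of the gradient cross term and the -2 of `Lap_coord`.
      have : eigenvalue (N + 1) = eigenvalue N + 2 * N + 2 := by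
        simp only [eigenvalue]; push_cast; ring
      rw [this, two_mul, mul_comm (coord a)]
      module
    · convert add_mem h1 h2 using 1
      rw [map_add, smul_add]; abel

/-- The smooth eigenfunctions for the eigenvalue `n (n + 1)`. -/
def eigenFns (n : ℕ) : Submodule ℝ Sm := LinearMap.ker (Lap + eigenvalue n • LinearMap.id)

lemma mem_eigenFns {n : ℕ} {f : Sm} : f ∈ eigenFns n ↔ Lap f = -(eigenvalue n • f) := by
  rw [eigenFns, LinearMap.mem_ker]
  simp [eq_neg_iff_add_eq_zero]

lemma eigenvalue_strictMono : StrictMono eigenvalue := by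
  intro m n h
  have : (m : ℝ) < n := by exact_mod_cast h
  have h0 : (0 : ℝ) ≤ m := by positivity
  simp only [eigenvalue]
  nlinarith

/-- Induction on the degree: (Δ + λ_{N+1}) p has lower degree, hence is already decomposed. Dividing
its components by the gaps λ_{N+1} - λ_n gives R with the same image as p, so p - R is an
eigenfunction. -/
lemma exists_eigen_decomp {N : ℕ} {p : Sm} (hp : p ∈ sphPoly N) :
    ∃ P : ℕ → Sm, (∀ n, P n ∈ sphPoly n ∧ P n ∈ eigenFns n) ∧
      p = ∑ n ∈ Finset.range (N + 1), P n := by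
  classical
  induction N generalizing p with
  | zero =>
    refine ⟨fun n => if n = 0 then p else 0, fun n => ?_, by simp⟩
    by_cases hn : n = 0
    · subst hn
      refine ⟨by simpa using hp, ?_⟩
      have := (Submodule.mem_bot ℝ).1 (Lap_add_mem hp)
      simpa [mem_eigenFns, eq_neg_iff_add_eq_zero] using this
    · simp [hn]
  | succ N ih =>
    obtain ⟨Q, hQ, hq⟩ := ih (Lap_add_mem hp)
    let c : ℕ → ℝ := fun n => (eigenvalue (N + 1) - eigenvalue n)⁻¹
    let R : Sm := ∑ n ∈ Finset.range (N + 1), c n • Q n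
    have hR : R ∈ sphPoly (N + 1) := by
      refine sum_mem fun n hn => Submodule.smul_mem _ _ (sphPoly_mono ?_ (hQ n).1)
      have := Finset.mem_range.1 hn; omega
    have hLR : Lap R + eigenvalue (N + 1) • R = Lap p + eigenvalue (N + 1) • p := by
      rw [hq, map_sum, Finset.smul_sum, ← Finset.sum_add_distrib]
      refine Finset.sum_congr rfl fun n hn => ?_
      have h1 : eigenvalue (N + 1) - eigenvalue n ≠ 0 :=
        (sub_pos.2 (eigenvalue_strictMono (Finset.mem_range.1 hn))).ne'
      rw [map_smul, mem_eigenFns.1 (hQ n).2]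
      have : c n • -(eigenvalue n • Q n) + eigenvalue (N + 1) • c n • Q n
          = ((eigenvalue (N + 1) - eigenvalue n) * c n) • Q n := by module
      rw [this, mul_inv_cancel₀ h1, one_smul]
    refine ⟨fun n => if n = N + 1 then p - R else if n < N + 1 then c n • Q n else 0,
      fun n => ?_, ?_⟩
    · by_cases hn : n = N + 1
      · subst hn
        simp only [if_true]
        refine ⟨sub_mem hp hR, ?_⟩
        rw [mem_eigenFns, map_sub, eq_neg_iff_add_eq_zero, smul_sub]
        rw [← sub_eq_zero] at hLR
        rw [← neg_eq_zero, ← hLR]; abel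
      · simp only [hn, if_false]
        split_ifs
        · exact ⟨Submodule.smul_mem _ _ (hQ n).1, Submodule.smul_mem _ _ (hQ n).2⟩
        · exact ⟨zero_mem _, zero_mem _⟩
    · rw [Finset.sum_range_succ, Finset.sum_congr rfl (g := fun n => c n • Q n)]
      · simp only [if_true, R]; abel
      · intro n hn
        have := Finset.mem_range.1 hn
        simp [this, this.ne]

/-! ### The embedding into `L²` -/

/-- A smooth function as a continuous function. -/
def toC : Sm →ₐ[ℝ] C(S2, ℝ) where
  toFun f := ⟨f.1, Sm.continuous f⟩
  map_one' := rfl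
  map_mul' _ _ := rfl
  map_zero' := rfl
  map_add' _ _ := rfl
  commutes' _ := rfl

@[simp] lemma toC_apply (f : Sm) (σ : S2) : toC f σ = f σ := rfl

/-- The class in `L²` of a smooth function. -/
def sL2 : Sm →ₗ[ℝ] L2 :=
  (ContinuousMap.toLp 2 surf ℝ : C(S2, ℝ) →L[ℝ] L2).toLinearMap ∘ₗ toC.toLinearMap

lemma sL2_eq (f : Sm) : sL2 f = toL2 (toC f) := rfl

lemma inner_toL2 (f g : C(S2, ℝ)) : inner ℝ (toL2 f) (toL2 g) = ∫ σ, f σ * g σ ∂surf := by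
  rw [toL2, toL2, ContinuousMap.inner_toLp]
  simp [mul_comm]

lemma inner_sL2 (f g : Sm) : inner ℝ (sL2 f) (sL2 g) = integ (f * g) := by
  rw [sL2_eq, sL2_eq, inner_toL2]; rfl

lemma sL2_injective : Function.Injective sL2 := by
  intro f g h
  have := ContinuousMap.toLp_injective (p := 2) (E := ℝ) (𝕜 := ℝ) surf h
  ext σ
  exact congrArg (fun k : C(S2, ℝ) => k σ) this

lemma norm_sL2_sq (f : Sm) : ‖sL2 f‖ ^ 2 = integ (f * f) := by
  rw [← inner_sL2, real_inner_self_eq_norm_sq]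

/-! ### Integration by parts -/

lemma integ_mul_L (i : Fin 3) (f g : Sm) : integ (f * L i g) = -integ (L i f * g) := by
  have h := integ_L i (f * g)
  rw [Derivation.leibniz, map_add, smul_eq_mul, smul_eq_mul, mul_comm g] at h
  linarith

lemma integ_mul_Lap (f g : Sm) : integ (f * Lap g) = -integ (gradMul f g) := by
  rw [Lap_apply, gradMul, Finset.mul_sum, map_sum, map_sum, ← Finset.sum_neg_distrib]
  exact Finset.sum_congr rfl fun i _ => integ_mul_L i f (L i g)

lemma integ_Lap_mul (f g : Sm) : integ (Lap f * g) = integ (f * Lap g) := by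
  rw [mul_comm, integ_mul_Lap, integ_mul_Lap, gradMul_comm]

lemma integ_eigenFns_mul {m n : ℕ} (hmn : m ≠ n) {f g : Sm} (hf : f ∈ eigenFns m)
    (hg : g ∈ eigenFns n) : integ (f * g) = 0 := by
  have h := integ_Lap_mul f g
  rw [mem_eigenFns.1 hf, mem_eigenFns.1 hg, neg_mul, mul_neg, map_neg, map_neg, smul_mul_assoc,
    mul_smul_comm, map_smul, map_smul, smul_eq_mul, smul_eq_mul] at h
  have h1 : eigenvalue m - eigenvalue n ≠ 0 :=
    sub_ne_zero.2 fun h => hmn (eigenvalue_strictMono.injective h)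
  have h2 : (eigenvalue m - eigenvalue n) * integ (f * g) = 0 := by linarith
  exact (mul_eq_zero.1 h2).resolve_left h1

/-! ### Completeness of the spherical polynomials -/

lemma exists_mem_sphPoly {p : Sm} (hp : p ∈ Algebra.adjoin ℝ (Set.range coord)) :
    ∃ N, p ∈ sphPoly N := by
  refine Algebra.adjoin_induction (p := fun p _ => ∃ N, p ∈ sphPoly N) ?_ ?_ ?_ ?_ hp
  · rintro _ ⟨a, rfl⟩
    exact ⟨1, by rw [sphPoly, Submodule.pow_one]; exact coord_mem_affineFns a⟩
  · intro r
    exact ⟨0, by rw [sphPoly, Submodule.pow_zero]; exact Submodule.algebraMap_mem r⟩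
  · rintro x y _ _ ⟨M, hM⟩ ⟨N, hN⟩
    exact ⟨max M N, add_mem (sphPoly_mono (le_max_left _ _) hM)
      (sphPoly_mono (le_max_right _ _) hN)⟩
  · rintro x y _ _ ⟨M, hM⟩ ⟨N, hN⟩
    refine ⟨M + N, ?_⟩
    rw [sphPoly, pow_add]
    exact Submodule.mul_mem_mul hM hN

lemma closure_adjoin_coord :
    ((Algebra.adjoin ℝ (Set.range coord)).map toC).topologicalClosure = ⊤ := by
  apply ContinuousMap.subalgebra_topologicalClosure_eq_top_of_separatesPoints
  intro σ τ h
  obtain ⟨a, ha⟩ : ∃ a, (σ : E3) a ≠ (τ : E3) a := by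
    by_contra! hc
    exact h (Subtype.ext (PiLp.ext hc))
  exact ⟨_, ⟨toC (coord a), ⟨coord a, Algebra.subset_adjoin ⟨a, rfl⟩, rfl⟩, rfl⟩, ha⟩

/-- A vector orthogonal to all spherical harmonics vanishes. -/
lemma eq_zero_of_inner_eigenFns {v : L2}
    (hv : ∀ n, ∀ p ∈ eigenFns n, p ∈ sphPoly n → inner ℝ (sL2 p) v = 0) : v = 0 := by
  -- The functional ⟨v, ·⟩ vanishes on polynomials by `exists_eigen_decomp`, on continuous functions
  -- by Stone-Weierstrass, and on `L2` by density.
  let φ : C(S2, ℝ) →L[ℝ] ℝ :=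
    (innerSL ℝ v).comp (ContinuousMap.toLp 2 surf ℝ : C(S2, ℝ) →L[ℝ] L2)
  have h0 : ∀ f ∈ (Algebra.adjoin ℝ (Set.range coord)).map toC, φ f = 0 := by
    rintro _ ⟨p, hp, rfl⟩
    obtain ⟨N, hN⟩ := exists_mem_sphPoly hp
    obtain ⟨P, hP, rfl⟩ := exists_eigen_decomp hN
    have : φ (toC (∑ n ∈ Finset.range (N + 1), P n))
        = ∑ n ∈ Finset.range (N + 1), inner ℝ (sL2 (P n)) v := by
      rw [map_sum, map_sum]
      exact Finset.sum_congr rfl fun n _ => real_inner_comm (sL2 (P n)) v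
    exact this.trans (Finset.sum_eq_zero fun n _ => hv n _ (hP n).2 (hP n).1)
  have h1 : ∀ f, φ f = 0 := by
    intro f
    have hf : f ∈ ((Algebra.adjoin ℝ (Set.range coord)).map toC).topologicalClosure := by
      rw [closure_adjoin_coord]; trivial
    have hcl : IsClosed {f | φ f = 0} := isClosed_eq φ.continuous continuous_const
    exact closure_minimal (fun g hg => h0 g hg) hcl hf
  have hd := ContinuousMap.toLp_denseRange (α := S2) (p := 2) ℝ surf ℝ (by simp)
  have h2 : ∀ w : L2, inner ℝ v w = 0 := by
    intro w
    have hcl : IsClosed {w : L2 | inner ℝ v w = 0} :=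
      isClosed_eq (by fun_prop) continuous_const
    exact closure_minimal (by rintro _ ⟨f, rfl⟩; exact h1 f) hcl (hd w)
  exact inner_self_eq_zero.1 (h2 v)

/-! ### Dimension -/

/-- The monomials whose exponents are at most `N`. -/
def monomials (N : ℕ) (p : Fin (N + 1) × Fin (N + 1) × Fin (N + 1)) : Sm :=
  coord 0 ^ (p.1 : ℕ) * coord 1 ^ (p.2.1 : ℕ) * coord 2 ^ (p.2.2 : ℕ)

lemma sphPoly_le_span (N : ℕ) : sphPoly N ≤ Submodule.span ℝ (Set.range (monomials N)) := by
  induction N with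
  | zero =>
    intro p hp
    obtain ⟨c, rfl⟩ := sphPoly_zero_eq hp
    exact Submodule.smul_mem _ _ (Submodule.subset_span ⟨0, by simp [monomials]⟩)
  | succ N ih =>
    intro p hp
    refine sphPoly_succ_induction
      (Q := fun p => p ∈ Submodule.span ℝ (Set.range (monomials (N + 1))))
      (fun p hp => ?_) (fun p hp a => ?_) (fun _ _ => add_mem) hp
    · refine Submodule.span_mono ?_ (ih hp)
      rintro _ ⟨q, rfl⟩
      exact ⟨(q.1.castSucc, q.2.1.castSucc, q.2.2.castSucc), rfl⟩
    · refine Submodule.span_induction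
        (p := fun p _ => p * coord a ∈ Submodule.span ℝ (Set.range (monomials (N + 1))))
        ?_ (by simp) (fun x y _ _ hx hy => by rw [add_mul]; exact add_mem hx hy)
        (fun c x _ hx => by rw [smul_mul_assoc]; exact Submodule.smul_mem _ c hx) (ih hp)
      rintro _ ⟨q, rfl⟩
      apply Submodule.subset_span
      fin_cases a
      · exact ⟨(q.1.succ, q.2.1.castSucc, q.2.2.castSucc), by simp [monomials]; ring⟩
      · exact ⟨(q.1.castSucc, q.2.1.succ, q.2.2.castSucc), by simp [monomials]; ring⟩
      · exact ⟨(q.1.castSucc, q.2.1.castSucc, q.2.2.succ), by simp [monomials]; ring⟩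

instance (N : ℕ) : Module.Finite ℝ (Submodule.span ℝ (Set.range (monomials N))) :=
  FiniteDimensional.span_of_finite ℝ (Set.finite_range _)

instance (N : ℕ) : Module.Finite ℝ (sphPoly N) :=
  Submodule.finiteDimensional_of_le
    (S₂ := Submodule.span ℝ (Set.range (monomials N))) (sphPoly_le_span N)

/-- A crude count of monomials. Any polynomial bound serves, because the components of a smooth
function decay faster than every power. -/
lemma finrank_sphPoly_le (N : ℕ) : Module.finrank ℝ (sphPoly N) ≤ (N + 1) ^ 3 := by
  refine (Submodule.finrank_mono (sphPoly_le_span N)).trans ?_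
  refine (finrank_range_le_card (R := ℝ) (monomials N)).trans ?_
  simp; apply le_of_eq; ring

/-! ### Isometry invariance and the supremum bound -/

/-- Composition with a linear isometry. -/
def compIso (R : E3 ≃ₗᵢ[ℝ] E3) : Sm →ₐ[ℝ] Sm where
  toFun f := ⟨fun σ => f (sphMap R σ), smooth_of_contDiffAt (F := fun x => radialExt f.1 (R x))
    (fun σ => (Smooth.contDiffAt f.2 (coe_ne_zero (sphMap R σ))).comp (σ : E3)
      R.contDiff.contDiffAt) (fun σ => radialExt_coe f.1 (sphMap R σ))⟩
  map_one' := rfl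
  map_mul' _ _ := rfl
  map_zero' := rfl
  map_add' _ _ := rfl
  commutes' _ := rfl

@[simp] lemma compIso_apply (R : E3 ≃ₗᵢ[ℝ] E3) (f : Sm) (σ : S2) :
    compIso R f σ = f (sphMap R σ) := rfl

lemma integ_compIso (R : E3 ≃ₗᵢ[ℝ] E3) (f : Sm) : integ (compIso R f) = integ f := by
  have hm := measurePreserving_sphMap R
  have := integral_map hm.measurable.aemeasurable (f := f.1) (μ := surf)
    (Sm.continuous f).aestronglyMeasurable
  rw [hm.map_eq] at this
  exact this.symm

lemma compIso_mem_sphPoly (R : E3 ≃ₗᵢ[ℝ] E3) {N : ℕ} {p : Sm} (hp : p ∈ sphPoly N) :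
    compIso R p ∈ sphPoly N := by
  have h1 : affineFns.map (compIso R).toLinearMap ≤ affineFns := by
    rw [affineFns, Submodule.map_span_le]
    rintro _ (rfl | ⟨a, rfl⟩)
    · change compIso R 1 ∈ _
      rw [map_one]; exact one_mem_affineFns
    · have : compIso R (coord a) = ∑ b, R (unitVec b) a • coord b := by
        ext σ
        rw [compIso_apply, coord_apply, coe_sphMap]
        conv_lhs => rw [eq_sum_unitVec (σ : E3)]
        simp [Fin.sum_univ_three]
        ring
      change compIso R (coord a) ∈ _
      rw [this]
      exact sum_mem fun b _ => Submodule.smul_mem _ _ (coord_mem_affineFns b)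
  have h2 : (sphPoly N).map (compIso R).toLinearMap ≤ sphPoly N := by
    rw [sphPoly, Submodule.map_pow]
    exact pow_le_pow_left' h1 N
  exact h2 ⟨p, hp, rfl⟩

lemma exists_sphMap_eq (σ τ : S2) : ∃ R : E3 ≃ₗᵢ[ℝ] E3, sphMap R σ = τ := by
  refine ⟨(ℝ ∙ ((σ : E3) - τ))ᗮ.reflection, ?_⟩
  ext1
  exact Submodule.reflection_sub (by simp)

/-- The area of the sphere. -/
def area : ℝ := surf.real Set.univ

lemma area_pos : 0 < area := by
  have : surf ≠ 0 := Measure.toSphere_ne_zero _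
  exact ENNReal.toReal_pos (Measure.measure_univ_ne_zero.2 this)
    (measure_ne_top _ _)

lemma integ_one : integ 1 = area := by
  simp [integ_apply, area]

/-- Z σ is the reproducing kernel of `sphPoly N`, and Cauchy-Schwarz gives f(σ)² ≤ ‖f‖² n(σ) with
n(σ) = Z σ σ. Isometry invariance makes n constant, and its integral is the dimension. -/
lemma sq_le_of_mem_sphPoly {N : ℕ} {f : Sm} (hf : f ∈ sphPoly N) (σ : S2) :
    f σ ^ 2 ≤ ((N : ℝ) + 1) ^ 3 / area * ‖sL2 f‖ ^ 2 := by
  let K : Submodule ℝ L2 := (sphPoly N).map sL2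
  have : FiniteDimensional ℝ K := inferInstanceAs (Module.Finite ℝ ((sphPoly N).map sL2))
  let b := stdOrthonormalBasis ℝ K
  have hY : ∀ j, ∃ Y ∈ sphPoly N, sL2 Y = b j := fun j => (b j).2
  choose Y hYm hYb using hY
  have hexp : ∀ f ∈ sphPoly N, f = ∑ j, inner ℝ (sL2 (Y j)) (sL2 f) • Y j := by
    intro f hf
    apply sL2_injective
    have h := congrArg (Subtype.val : K → L2) (b.sum_repr ⟨sL2 f, f, hf, rfl⟩)
    simp only [Submodule.coe_sum, Submodule.coe_smul, b.repr_apply_apply, Submodule.coe_inner,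
      ← hYb] at h
    rw [map_sum]
    conv_lhs => rw [← h]
    simp only [map_smul]
  have hYY : ∀ j k, integ (Y j * Y k) = if j = k then 1 else 0 := by
    intro j k
    rw [← inner_sL2, hYb, hYb, ← Submodule.coe_inner]
    exact orthonormal_iff_ite.1 b.orthonormal j k
  let Z : S2 → Sm := fun σ => ∑ j, Y j σ • Y j
  let n : S2 → ℝ := fun σ => Z σ σ
  have hn : ∀ σ, n σ = ∑ j, Y j σ ^ 2 := fun σ => by simp [n, Z, sq]
  have hrep : ∀ f ∈ sphPoly N, ∀ σ, f σ ^ 2 ≤ ‖sL2 f‖ ^ 2 * n σ := by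
    intro f hf σ
    have h1 := b.sum_sq_norm_inner_right ⟨sL2 f, f, hf, rfl⟩
    simp only [Submodule.coe_inner, ← hYb, Real.norm_eq_abs, sq_abs, Submodule.coe_norm] at h1
    rw [← h1, hn]
    have h2 : f σ = ∑ j, inner ℝ (sL2 (Y j)) (sL2 f) * Y j σ := by
      conv_lhs => rw [hexp f hf]
      simp
    rw [h2]
    exact Finset.sum_mul_sq_le_sq_mul_sq _ _ _
  have hZ : ∀ σ, Z σ ∈ sphPoly N := fun σ => sum_mem fun j _ => Submodule.smul_mem _ _ (hYm j)
  have hZn : ∀ σ, integ (Z σ * Z σ) = n σ := by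
    intro σ
    simp only [Z, Finset.sum_mul_sum, smul_mul_smul_comm, map_sum, map_smul, hYY, hn]
    simp [sq]
  -- The kernel at σ, moved by an isometry taking τ to σ, gives n(σ)² ≤ n(σ) n(τ).
  have hle : ∀ σ τ, n σ ≤ n τ := by
    intro σ τ
    obtain ⟨R, hR⟩ := exists_sphMap_eq τ σ
    have h1 := hrep _ (compIso_mem_sphPoly R (hZ σ)) τ
    rw [norm_sL2_sq, ← map_mul, integ_compIso, hZn, compIso_apply, hR] at h1
    change n σ ^ 2 ≤ n σ * n τ at h1
    have h0 : 0 ≤ n σ := by rw [hn]; positivity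
    rcases h0.eq_or_lt with h | h
    · rw [← h, hn]; positivity
    · rw [sq] at h1; exact le_of_mul_le_mul_left h1 h
  have hint : n σ * area ≤ ((N : ℝ) + 1) ^ 3 := by
    have h1 : n σ * area ≤ integ (∑ j, Y j * Y j) := by
      rw [← integ_one, ← smul_eq_mul, ← map_smul]
      refine integral_mono (integrable_continuous (Sm.continuous _))
        (integrable_continuous (Sm.continuous _)) fun τ => ?_
      have := hle σ τ
      rw [hn τ] at this
      simpa [sq] using this
    rw [map_sum] at h1
    simp only [hYY, if_true, Finset.sum_const, Finset.card_univ, Fintype.card_fin] at h1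
    have h2 : Module.finrank ℝ K ≤ (N + 1) ^ 3 :=
      (Submodule.finrank_map_le sL2 (sphPoly N)).trans (finrank_sphPoly_le N)
    have h3 : (Module.finrank ℝ K : ℝ) ≤ ((N : ℝ) + 1) ^ 3 := by exact_mod_cast h2
    simpa using h1.trans (by simpa using h3)
  have hnσ : n σ ≤ ((N : ℝ) + 1) ^ 3 / area := (le_div_iff₀ area_pos).2 hint
  calc f σ ^ 2 ≤ ‖sL2 f‖ ^ 2 * n σ := hrep f hf σ
    _ ≤ ‖sL2 f‖ ^ 2 * (((N : ℝ) + 1) ^ 3 / area) := by gcongr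
    _ = _ := mul_comm _ _

/-! ### The eigenspaces -/

/-- Subtracting from Y its projection to the polynomial eigenfunctions of degree n leaves a function
orthogonal to all spherical harmonics: for other degrees the eigenvalues differ. By completeness it
vanishes. -/
lemma eigenFns_le_sphPoly (n : ℕ) : eigenFns n ≤ sphPoly n := by
  intro Y hY
  let K : Submodule ℝ L2 := (sphPoly n ⊓ eigenFns n).map sL2
  have : FiniteDimensional ℝ (sphPoly n ⊓ eigenFns n : Submodule ℝ Sm) :=
    Submodule.finiteDimensional_inf_left _ _
  have : FiniteDimensional ℝ K :=
    inferInstanceAs (Module.Finite ℝ ((sphPoly n ⊓ eigenFns n).map sL2))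
  obtain ⟨Z, hZ, hZ'⟩ : K.starProjection (sL2 Y) ∈ K := Submodule.starProjection_apply_mem _ _
  have hv : sL2 (Y - Z) = 0 := by
    refine eq_zero_of_inner_eigenFns fun m p hp hp' => ?_
    by_cases hmn : m = n
    · subst hmn
      rw [map_sub, hZ']
      exact Submodule.inner_right_of_mem_orthogonal (K := K) ⟨p, ⟨hp', hp⟩, rfl⟩
        (Submodule.sub_starProjection_mem_orthogonal _)
    · rw [inner_sL2]
      exact integ_eigenFns_mul hmn hp (sub_mem hY hZ.2)
  have : Y = Z := sub_eq_zero.1 (sL2_injective (by rw [hv, map_zero]))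
  exact this ▸ hZ.1

instance (n : ℕ) : Module.Finite ℝ (eigenFns n) :=
  Submodule.finiteDimensional_of_le (eigenFns_le_sphPoly n)

/-- The generating set is already a subspace, and finite dimension makes it closed. -/
lemma eigenspace_eq (n : ℕ) : eigenspace n = (eigenFns n).map sL2 := by
  have h : {u : L2 | ∃ Y : C(S2, ℝ), Smooth Y ∧
      (∀ σ, -sphLaplacian Y σ = eigenvalue n * Y σ) ∧ u = toL2 Y} = (eigenFns n).map sL2 := by
    ext u
    constructor
    · rintro ⟨Y, hY, hl, rfl⟩
      refine ⟨⟨Y, hY⟩, mem_eigenFns.2 ?_, rfl⟩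
      ext σ
      have := hl σ
      rw [show sphLaplacian Y σ = Lap ⟨Y, hY⟩ σ from sphLaplacian_eq ⟨Y, hY⟩ σ] at this
      rw [Sm.coe_neg, Sm.coe_smul, ← this, neg_neg]
    · rintro ⟨Y, hY, rfl⟩
      refine ⟨toC Y, Y.2, fun σ => ?_, rfl⟩
      have h1 := sphLaplacian_eq Y σ
      rw [mem_eigenFns.1 hY, Sm.coe_neg, Sm.coe_smul] at h1
      change -sphLaplacian Y.1 σ = eigenvalue n * Y σ
      rw [h1, neg_neg]
  have hfd : FiniteDimensional ℝ ((eigenFns n).map sL2) :=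
    inferInstanceAs (Module.Finite ℝ ((eigenFns n).map sL2))
  rw [eigenspace, h, Submodule.span_eq]
  exact (Submodule.closed_of_finiteDimensional _).submodule_topologicalClosure_eq

lemma exists_harm (n : ℕ) (u : L2) : ∃ Y ∈ eigenFns n, sL2 Y = harmonicPart n u := by
  have : harmonicPart n u ∈ eigenspace n := Submodule.starProjection_apply_mem _ _
  rw [eigenspace_eq] at this
  exact this

/-- The harmonic part of degree `n` as a smooth function. -/
def harm (n : ℕ) (u : L2) : Sm := (exists_harm n u).choose

lemma harm_mem (n : ℕ) (u : L2) : harm n u ∈ eigenFns n := (exists_harm n u).choose_spec.1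

lemma sL2_harm (n : ℕ) (u : L2) : sL2 (harm n u) = harmonicPart n u :=
  (exists_harm n u).choose_spec.2

lemma sL2_mem_eigenspace {n : ℕ} {p : Sm} (hp : p ∈ eigenFns n) : sL2 p ∈ eigenspace n := by
  rw [eigenspace_eq]; exact ⟨p, hp, rfl⟩

lemma inner_sL2_harmonicPart {n : ℕ} {p : Sm} (hp : p ∈ eigenFns n) (u : L2) :
    inner ℝ (sL2 p) (harmonicPart n u) = inner ℝ (sL2 p) u := by
  have h1 : u - harmonicPart n u ∈ (eigenspace n)ᗮ :=
    Submodule.sub_starProjection_mem_orthogonal _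
  have h2 := Submodule.inner_right_of_mem_orthogonal (sL2_mem_eigenspace hp) h1
  rw [inner_sub_right] at h2
  linarith

/-- The difference lies in the eigenspace and is orthogonal to it. Identities for `comp` are then
checked by testing against eigenfunctions. -/
lemma harm_eq_of_inner {n : ℕ} {u : L2} {Z : Sm} (hZ : Z ∈ eigenFns n)
    (h : ∀ p ∈ eigenFns n, integ (p * Z) = inner ℝ (sL2 p) u) : harm n u = Z := by
  have hd : harm n u - Z ∈ eigenFns n := sub_mem (harm_mem n u) hZ
  have h1 : integ ((harm n u - Z) * (harm n u - Z)) = 0 := by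
    rw [mul_sub, map_sub, h _ hd, ← inner_sL2, sL2_harm, inner_sL2_harmonicPart hd, sub_self]
  rw [← norm_sL2_sq] at h1
  have h2 : sL2 (harm n u - Z) = 0 := by simpa using h1
  exact sub_eq_zero.1 (sL2_injective (by rw [h2, map_zero]))

/-- The harmonic part of degree `n` of a smooth function. -/
def comp (n : ℕ) (f : Sm) : Sm := harm n (sL2 f)

lemma comp_mem (n : ℕ) (f : Sm) : comp n f ∈ eigenFns n := harm_mem n _

lemma integ_mul_comp {n : ℕ} {p : Sm} (hp : p ∈ eigenFns n) (f : Sm) :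
    integ (p * comp n f) = integ (p * f) := by
  rw [← inner_sL2, comp, sL2_harm, inner_sL2_harmonicPart hp, inner_sL2]

lemma comp_eq_of_integ {n : ℕ} {f Z : Sm} (hZ : Z ∈ eigenFns n)
    (h : ∀ p ∈ eigenFns n, integ (p * Z) = integ (p * f)) : comp n f = Z :=
  harm_eq_of_inner hZ fun p hp => by rw [h p hp, inner_sL2]

lemma L_mem_eigenFns {n : ℕ} {f : Sm} (hf : f ∈ eigenFns n) (i : Fin 3) : L i f ∈ eigenFns n := by
  rw [mem_eigenFns] at hf ⊢
  rw [Lap_L, hf, map_neg, Derivation.map_smul]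

lemma comp_L (n : ℕ) (i : Fin 3) (f : Sm) : comp n (L i f) = L i (comp n f) :=
  comp_eq_of_integ (L_mem_eigenFns (comp_mem n f) i) fun p hp => by
    rw [integ_mul_L, integ_mul_comp (L_mem_eigenFns hp i), integ_mul_L]

lemma comp_sub_Lap (n : ℕ) (f : Sm) : comp n (f - Lap f) = (1 + eigenvalue n) • comp n f :=
  comp_eq_of_integ (Submodule.smul_mem _ _ (comp_mem n f)) fun p hp => by
    rw [mul_smul_comm, map_smul, integ_mul_comp hp, mul_sub, map_sub, ← integ_Lap_mul,
      mem_eigenFns.1 hp, neg_mul, map_neg, smul_mul_assoc, map_smul]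
    simp only [smul_eq_mul]; ring

lemma norm_comp_le (n : ℕ) (f : Sm) : ‖sL2 (comp n f)‖ ≤ ‖sL2 f‖ := by
  rw [comp, sL2_harm]; exact Submodule.norm_starProjection_apply_le _ _

lemma eigenvalue_nonneg (n : ℕ) : 0 ≤ eigenvalue n := by unfold eigenvalue; positivity

/-- Each application of 1 - Δ multiplies the n-th component by 1 + λ_n ≥ n + 1, and projections are
contractions. -/
lemma exists_comp_norm_bound (k : ℕ) (f : Sm) :
    ∃ C, ∀ n : ℕ, ((n : ℝ) + 1) ^ k * ‖sL2 (comp n f)‖ ≤ C := by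
  induction k generalizing f with
  | zero => exact ⟨‖sL2 f‖, fun n => by simpa using norm_comp_le n f⟩
  | succ k ih =>
    obtain ⟨C, hC⟩ := ih (f - Lap f)
    refine ⟨C, fun n => le_trans ?_ (hC n)⟩
    rw [comp_sub_Lap, map_smul, norm_smul, Real.norm_eq_abs,
      abs_of_nonneg (by linarith [eigenvalue_nonneg n]), pow_succ, mul_assoc]
    have hle : (n : ℝ) + 1 ≤ 1 + eigenvalue n := by
      unfold eigenvalue
      have : (0 : ℝ) ≤ n := by positivity
      nlinarith
    exact mul_le_mul_of_nonneg_left (mul_le_mul_of_nonneg_right hle (norm_nonneg _))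
      (by positivity)

/-- The harmonic parts of a smooth function decay faster than any power of the degree. -/
lemma exists_comp_bound (k : ℕ) (f : Sm) :
    ∃ C, 0 ≤ C ∧ ∀ (n : ℕ) (σ : S2), ((n : ℝ) + 1) ^ k * |comp n f σ| ≤ C := by
  -- Two spare powers pay for the passage to the supremum norm, which costs (n + 1)^{3/2}.
  obtain ⟨C, hC⟩ := exists_comp_norm_bound (k + 2) f
  have hC0 : 0 ≤ C := le_trans (by positivity) (hC 0)
  refine ⟨√(1 / area) * C, by positivity, fun n σ => ?_⟩
  have h1 := sq_le_of_mem_sphPoly (eigenFns_le_sphPoly n (comp_mem n f)) σ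
  have hn : (1 : ℝ) ≤ (n : ℝ) + 1 := by simp
  have h2 : |comp n f σ| ≤ √(1 / area) * ((n : ℝ) + 1) ^ 2 * ‖sL2 (comp n f)‖ := by
    refine abs_le_of_sq_le_sq (h1.trans ?_) (by positivity)
    rw [mul_pow, mul_pow, Real.sq_sqrt (by have := area_pos; positivity), div_eq_mul_one_div,
      mul_comm (((n : ℝ) + 1) ^ 3), ← pow_mul]
    have := area_pos
    gcongr
    norm_num
  calc ((n : ℝ) + 1) ^ k * |comp n f σ|
      ≤ ((n : ℝ) + 1) ^ k * (√(1 / area) * ((n : ℝ) + 1) ^ 2 * ‖sL2 (comp n f)‖) := by gcongr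
    _ = √(1 / area) * (((n : ℝ) + 1) ^ (k + 2) * ‖sL2 (comp n f)‖) := by ring
    _ ≤ _ := by gcongr; exact hC n

/-! ### Spectral multipliers -/

/-- Multipliers of at most polynomial growth. -/
def Tame (m : ℕ → ℝ) : Prop := ∃ A : ℝ, ∃ a : ℕ, ∀ n, |m n| ≤ A * ((n : ℝ) + 1) ^ a

lemma Tame.exists_summable_bound {m : ℕ → ℝ} (hm : Tame m) (f : Sm) :
    ∃ u : ℕ → ℝ, Summable u ∧ ∀ n σ, |m n * comp n f σ| ≤ u n := by
  obtain ⟨A, a, hA⟩ := hm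
  have hA0 : 0 ≤ A := by simpa using (abs_nonneg _).trans (hA 0)
  -- The power a absorbs the growth of the multiplier; two more make the series summable.
  obtain ⟨C, hC0, hC⟩ := exists_comp_bound (a + 2) f
  refine ⟨fun n => A * C * (1 / ((n : ℝ) + 1) ^ 2), ?_, fun n σ => ?_⟩
  · refine Summable.mul_left _ ?_
    exact_mod_cast (summable_nat_add_iff 1).2 (Real.summable_one_div_nat_pow.2 one_lt_two)
  · have h1 := hC n σ
    have hn : 0 < (n : ℝ) + 1 := by positivity
    beta_reduce
    rw [abs_mul, mul_one_div, le_div_iff₀ (by positivity)]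
    calc |m n| * |comp n f σ| * ((n : ℝ) + 1) ^ 2
        ≤ A * ((n : ℝ) + 1) ^ a * |comp n f σ| * ((n : ℝ) + 1) ^ 2 := by gcongr; exact hA n
      _ = A * (((n : ℝ) + 1) ^ (a + 2) * |comp n f σ|) := by ring
      _ ≤ A * C := by gcongr

/-- The function obtained by applying a spectral multiplier. -/
def multFn (m : ℕ → ℝ) (f : Sm) (σ : S2) : ℝ := ∑' n, m n * comp n f σ

lemma Tame.hasSum {m : ℕ → ℝ} (hm : Tame m) (f : Sm) (σ : S2) :
    HasSum (fun n => m n * comp n f σ) (multFn m f σ) := by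
  obtain ⟨u, hu, hb⟩ := hm.exists_summable_bound f
  exact (Summable.of_norm_bounded hu fun n => hb n σ).hasSum

lemma Tame.hasSum_radialExt {m : ℕ → ℝ} (hm : Tame m) (f : Sm) {x : E3} (hx : x ≠ 0) :
    HasSum (fun n => m n * radialExt (comp n f).1 x) (radialExt (multFn m f) x) := by
  simp only [radialExt_apply _ hx]
  exact hm.hasSum f _

/-- The covector by which a derivative along a rotation enters the Euclidean derivative. -/
def rotCovec (i : Fin 3) (x : E3) : E3 →L[ℝ] ℝ := (‖x‖ ^ 2)⁻¹ • innerSL ℝ (rotGen i x)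

/-- Lagrange's identity again: without a radial derivative, the rotation derivatives determine the
full differential. -/
lemma fderiv_radialExt_eq (f : Sm) {x : E3} (hx : x ≠ 0) :
    fderiv ℝ (radialExt f.1) x = ∑ i, radialExt (L i f).1 x • rotCovec i x := by
  have hn : ‖x‖ ^ 2 ≠ 0 := by simpa using hx
  have h0 := fderiv_radialExt_self f hx
  have hs : ‖x‖ ^ 2 = x 0 ^ 2 + x 1 ^ 2 + x 2 ^ 2 := by
    rw [EuclideanSpace.real_norm_sq_eq, Fin.sum_univ_three]
  simp only [radialExt_L _ _ hx]
  generalize fderiv ℝ (radialExt f.1) x = l at *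
  ext v
  have h0' := h0
  rw [eq_sum_unitVec x] at h0'
  simp only [map_add, map_smul, smul_eq_mul] at h0'
  have key : ‖x‖ ^ 2 * l v = ∑ i, l (rotGen i x) * inner ℝ (rotGen i x) v := by
    rw [hs, Fin.sum_univ_three]
    conv_lhs => rw [eq_sum_unitVec v]
    simp only [rotGen_zero_eq, rotGen_one_eq, rotGen_two_eq, map_add, map_smul, smul_eq_mul,
      inner_add_left, inner_smul_left, EuclideanSpace.inner_single_left]
    simp
    linear_combination (x 0 * v 0 + x 1 * v 1 + x 2 * v 2) * h0'
  simp only [rotCovec, FunLike.coe_sum, Finset.sum_apply, FunLike.coe_smul, Pi.smul_apply,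
    smul_eq_mul, innerSL_apply_apply]
  have : l v = (‖x‖ ^ 2)⁻¹ * (‖x‖ ^ 2 * l v) := by field_simp
  rw [this, key, Finset.mul_sum]
  exact Finset.sum_congr rfl fun i _ => by ring

lemma contDiffOn_rotCovec (i : Fin 3) : ContDiffOn ℝ ∞ (rotCovec i) {0}ᶜ := by
  intro x hx
  have h1 : ContDiffAt ℝ ∞ (fun x : E3 => (‖x‖ ^ 2)⁻¹) x :=
    (contDiff_norm_sq ℝ).contDiffAt.inv (by simpa using hx)
  exact (h1.smul (((innerSL ℝ).contDiff.comp (rotGen i).contDiff).contDiffAt)).contDiffWithinAt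

/-- Projections commute with `L i`, so the termwise derivative is the same multiplier applied to `L
i f`. It converges uniformly on a ball avoiding the origin, and having the same form it can be
differentiated again. -/
lemma Tame.hasFDerivAt {m : ℕ → ℝ} (hm : Tame m) (f : Sm) {x : E3} (hx : x ≠ 0) :
    HasFDerivAt (radialExt (multFn m f))
      (∑ i, radialExt (multFn m (L i f)) x • rotCovec i x) x := by
  choose u hu hb using fun i => hm.exists_summable_bound (L i f)
  have hr : 0 < ‖x‖ := norm_pos_iff.2 hx
  obtain ⟨B, hB0, hB⟩ : ∃ B : ℝ, 0 ≤ B ∧ ∀ i, ∀ y ∈ Metric.ball x (‖x‖ / 2),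
      ‖rotCovec i y‖ ≤ B := by
    have hK : ∀ i, ∃ B, ∀ y ∈ Metric.closedBall x (‖x‖ / 2), ‖rotCovec i y‖ ≤ B := fun i => by
      refine (isCompact_closedBall x (‖x‖ / 2)).exists_bound_of_continuousOn
        ((contDiffOn_rotCovec i).continuousOn.mono fun y hy h0 => ?_)
      rw [Set.mem_singleton_iff] at h0
      rw [h0, Metric.mem_closedBall, dist_zero_left] at hy
      linarith
    choose B hB using hK
    refine ⟨∑ i, |B i|, by positivity, fun i y hy => ?_⟩
    exact (hB i y (Metric.ball_subset_closedBall hy)).trans ((le_abs_self _).trans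
      (Finset.single_le_sum (f := fun i => |B i|) (fun _ _ => abs_nonneg _) (Finset.mem_univ i)))
  have hne : ∀ y ∈ Metric.ball x (‖x‖ / 2), y ≠ 0 := by
    rintro y hy rfl
    rw [Metric.mem_ball, dist_zero_left] at hy
    linarith
  have hsum : Summable fun n => ∑ i, u i n * B :=
    summable_sum fun i _ => (hu i).mul_right B
  have hxs : x ∈ Metric.ball x (‖x‖ / 2) := Metric.mem_ball_self (by positivity)
  have h := hasFDerivAt_tsum_of_isPreconnected hsum (Metric.isOpen_ball (x := x) (ε := ‖x‖ / 2))
    (convex_ball x _).isPreconnected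
    (f := fun n y => m n * radialExt (comp n f).1 y)
    (f' := fun n y => m n • ∑ i, radialExt (comp n (L i f)).1 y • rotCovec i y)
    (fun n y hy => ?_) (fun n y hy => ?_) hxs (hm.hasSum_radialExt f hx).summable hxs
  · have h2 : HasSum (fun n => m n • ∑ i, radialExt (comp n (L i f)).1 x • rotCovec i x)
        (∑ i, radialExt (multFn m (L i f)) x • rotCovec i x) := by
      simp only [Finset.smul_sum, smul_smul]
      exact hasSum_sum fun i _ => (hm.hasSum_radialExt (L i f) hx).smul_const _
    rw [h2.tsum_eq] at h
    refine h.congr_of_eventuallyEq ?_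
    filter_upwards [isOpen_ne.mem_nhds hx] with y hy
    exact (hm.hasSum_radialExt f hy).tsum_eq.symm
  · have h1 := (Smooth.differentiableAt (comp n f).2 (hne y hy)).hasFDerivAt
    rw [fderiv_radialExt_eq _ (hne y hy)] at h1
    simp only [← comp_L] at h1
    exact h1.const_mul (m n)
  · rw [Finset.smul_sum]
    refine (norm_sum_le _ _).trans (Finset.sum_le_sum fun i _ => ?_)
    rw [smul_smul, norm_smul, radialExt_apply _ (hne y hy)]
    exact mul_le_mul (hb i n _) (hB i y hy) (norm_nonneg _) ((abs_nonneg _).trans (hb i n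
      (sphProj y (hne y hy))))

lemma Tame.contDiffOn {m : ℕ → ℝ} (hm : Tame m) (k : ℕ) (f : Sm) :
    ContDiffOn ℝ k (radialExt (multFn m f)) {0}ᶜ := by
  induction k generalizing f with
  | zero =>
    exact contDiffOn_zero.2 fun x hx => (hm.hasFDerivAt f hx).continuousAt.continuousWithinAt
  | succ k ih =>
    have ho : IsOpen ({0}ᶜ : Set E3) := isOpen_compl_singleton
    push_cast
    rw [contDiffOn_succ_iff_fderiv_of_isOpen ho]
    refine ⟨fun x hx => (hm.hasFDerivAt f hx).differentiableAt.differentiableWithinAt,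
      by simp, ?_⟩
    refine ContDiffOn.congr (f := fun x => ∑ i, radialExt (multFn m (L i f)) x • rotCovec i x)
      (ContDiffOn.sum fun i _ => (ih (L i f)).smul ((contDiffOn_rotCovec i).of_le ?_))
      fun x hx => (hm.hasFDerivAt f hx).fderiv
    exact_mod_cast le_top

lemma Tame.smooth {m : ℕ → ℝ} (hm : Tame m) (f : Sm) : Smooth (multFn m f) := by
  refine smooth_of_contDiffAt (F := radialExt (multFn m f)) (fun σ => ?_) (radialExt_coe _)
  refine contDiffAt_infty.2 fun k => ?_
  exact (hm.contDiffOn k f).contDiffAt (isOpen_compl_singleton.mem_nhds (coe_ne_zero σ))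

/-- A spectral multiplier of polynomial growth acts on smooth functions. -/
def mult {m : ℕ → ℝ} (hm : Tame m) (f : Sm) : Sm := ⟨multFn m f, hm.smooth f⟩

lemma hasSum_mult {m : ℕ → ℝ} (hm : Tame m) (f : Sm) (σ : S2) :
    HasSum (fun n => m n * comp n f σ) (mult hm f σ) := hm.hasSum f σ

lemma L_mult {m : ℕ → ℝ} (hm : Tame m) (i : Fin 3) (f : Sm) :
    L i (mult hm f) = mult hm (L i f) := by
  ext σ
  have hσ := coe_ne_zero σ
  rw [L_apply]
  change fderiv ℝ (radialExt (multFn m f)) σ _ = _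
  rw [(hm.hasFDerivAt f hσ).fderiv]
  have h1 : HasSum (fun n => m n * L i (comp n f) σ)
      ((∑ j, radialExt (multFn m (L j f)) σ • rotCovec j σ) (rotGen i σ)) := by
    have h2 : ∀ n, m n * L i (comp n f) σ =
        ∑ j, m n * radialExt (comp n (L j f)).1 σ * rotCovec j σ (rotGen i σ) := by
      intro n
      rw [L_apply, fderiv_radialExt_eq _ hσ]
      simp [comp_L, Finset.mul_sum, mul_assoc]
    simp only [h2]
    simp only [FunLike.coe_sum, Finset.sum_apply, FunLike.coe_smul, Pi.smul_apply, smul_eq_mul]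
    exact hasSum_sum fun j _ => (hm.hasSum_radialExt (L j f) hσ).mul_right _
  refine h1.unique ?_
  simpa [comp_L] using hasSum_mult hm (L i f) σ

lemma hasSum_toC_mult {m : ℕ → ℝ} (hm : Tame m) (f : Sm) :
    HasSum (fun n => m n • toC (comp n f)) (toC (mult hm f)) := by
  obtain ⟨u, hu, hb⟩ := hm.exists_summable_bound f
  have hs : Summable fun n => m n • toC (comp n f) := by
    refine Summable.of_norm_bounded hu fun n => ?_
    have h0 : 0 ≤ u n := (abs_nonneg _).trans (hb n (sphProj (unitVec 0) (by simp)))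
    exact (ContinuousMap.norm_le _ h0).2 fun σ => hb n σ
  have h2 : ∑' n, m n • toC (comp n f) = toC (mult hm f) := by
    ext σ
    have h1 := (ContinuousMap.evalCLM ℝ σ).hasSum hs.hasSum
    exact h1.unique (hasSum_mult hm f σ)
  exact h2 ▸ hs.hasSum

lemma hasSum_sL2_mult {m : ℕ → ℝ} (hm : Tame m) (f : Sm) :
    HasSum (fun n => m n • sL2 (comp n f)) (sL2 (mult hm f)) := by
  have := (ContinuousMap.toLp 2 surf ℝ : C(S2, ℝ) →L[ℝ] L2).hasSum (hasSum_toC_mult hm f)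
  simp only [map_smul] at this
  exact this

lemma comp_mult {m : ℕ → ℝ} (hm : Tame m) (n : ℕ) (f : Sm) :
    comp n (mult hm f) = m n • comp n f := by
  refine comp_eq_of_integ (Submodule.smul_mem _ _ (comp_mem n f)) fun p hp => ?_
  have h1 := (innerSL ℝ (sL2 p)).hasSum (hasSum_sL2_mult hm f)
  simp only [innerSL_apply_apply, map_smul] at h1
  rw [inner_sL2] at h1
  have h2 : HasSum (fun k => m k • inner ℝ (sL2 p) (sL2 (comp k f))) (integ (p * m n • comp n f)) := by
    have h3 : (integ (p * m n • comp n f)) = m n • inner ℝ (sL2 p) (sL2 (comp n f)) := by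
      rw [inner_sL2, mul_smul_comm, map_smul]
    rw [h3]
    refine hasSum_single n fun k hk => ?_
    rw [inner_sL2, integ_eigenFns_mul hk.symm hp (comp_mem k f), smul_zero]
  exact h2.unique h1

lemma eq_of_comp_eq {f g : Sm} (h : ∀ n, comp n f = comp n g) : f = g := by
  have : sL2 (f - g) = 0 := by
    refine eq_zero_of_inner_eigenFns fun n p hp _ => ?_
    rw [inner_sL2, mul_sub, map_sub, ← integ_mul_comp hp, h n, integ_mul_comp hp, sub_self]
  exact sub_eq_zero.1 (sL2_injective (by rw [this, map_zero]))

lemma tame_one : Tame fun _ => 1 := ⟨1, 0, by simp⟩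

lemma mult_one (f : Sm) : mult tame_one f = f :=
  eq_of_comp_eq fun n => by rw [comp_mult, one_smul]

lemma tame_eigenvalue_rpow {s : ℝ} (hs₀ : 0 ≤ s) (hs₁ : s ≤ 1) :
    Tame fun n => eigenvalue n ^ s := by
  refine ⟨1, 2, fun n => ?_⟩
  rw [abs_of_nonneg (Real.rpow_nonneg (eigenvalue_nonneg n) s), one_mul]
  have h1 : (1 : ℝ) ≤ ((n : ℝ) + 1) ^ 2 := one_le_pow₀ (by simp)
  calc eigenvalue n ^ s ≤ (((n : ℝ) + 1) ^ 2) ^ s := by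
        gcongr
        · exact eigenvalue_nonneg n
        · unfold eigenvalue; nlinarith [(Nat.cast_nonneg n : (0 : ℝ) ≤ n)]
    _ ≤ (((n : ℝ) + 1) ^ 2) ^ (1 : ℝ) := Real.rpow_le_rpow_of_exponent_le h1 hs₁
    _ = _ := Real.rpow_one _

/-! ### Composition with functions of one variable -/

/-- The composition of a smooth function on the sphere with a function of one variable. -/
def postComp (φ : ℝ → ℝ) (g : Sm) (h : ∀ σ, ContDiffAt ℝ ∞ φ (g σ)) : Sm :=
  ⟨fun σ => φ (g σ), smooth_of_contDiffAt (F := fun x => φ (radialExt g.1 x))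
    (fun σ => by
      have h1 : ContDiffAt ℝ ∞ φ (radialExt g.1 σ) := by rw [radialExt_coe]; exact h σ
      exact h1.comp (σ : E3) (Smooth.contDiffAt g.2 (coe_ne_zero σ)))
    (fun σ => by rw [radialExt_coe])⟩

lemma L_postComp (φ : ℝ → ℝ) (g : Sm) (h : ∀ σ, ContDiffAt ℝ ∞ φ (g σ)) (i : Fin 3) (σ : S2) :
    L i (postComp φ g h) σ = deriv φ (g σ) * L i g σ := by
  have h1 := hasDerivAt_comp_rot (postComp φ g h) i σ 0
  have h2 := hasDerivAt_comp_rot g i σ 0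
  have h3 : HasDerivAt φ (deriv φ (g σ)) (g (sphMap (rotEquiv i 0) σ)) := by
    rw [sphMap_rotEquiv_zero]
    exact ((h σ).differentiableAt (by simp)).hasDerivAt
  have h4 := h3.comp (0 : ℝ) h2
  have h5 := h1.unique h4
  simpa only [sphMap_rotEquiv_zero] using h5

lemma Sm.mul_left_cancel_of_pos {u f g : Sm} (hu : ∀ σ, 0 < u σ) (h : u * f = u * g) : f = g := by
  ext σ
  have := congrArg (fun k : Sm => k σ) h
  exact mul_left_cancel₀ (hu σ).ne' this

/-- The logarithm of a positive smooth function. -/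
def logSm (g : Sm) (hg : ∀ σ, 0 < g σ) : Sm :=
  postComp Real.log g fun σ => Real.contDiffAt_log.2 (hg σ).ne'

/-- The square root of a positive smooth function. -/
def sqrtSm (g : Sm) (hg : ∀ σ, 0 < g σ) : Sm :=
  postComp Real.sqrt g fun σ => Real.contDiffAt_sqrt (hg σ).ne'

lemma L_logSm_apply (g : Sm) (hg : ∀ σ, 0 < g σ) (i : Fin 3) (σ : S2) :
    L i (logSm g hg) σ = L i g σ / g σ := by
  rw [logSm, L_postComp, Real.deriv_log]; field_simp

lemma L_eq_mul_L_log (g : Sm) (hg : ∀ σ, 0 < g σ) (i : Fin 3) :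
    L i g = g * L i (logSm g hg) := by
  ext σ
  rw [Sm.coe_mul, L_logSm_apply]
  have := (hg σ).ne'
  field_simp

lemma sqrtSm_apply (g : Sm) (hg : ∀ σ, 0 < g σ) (σ : S2) : sqrtSm g hg σ = √(g σ) := rfl

lemma sqrtSm_pos (g : Sm) (hg : ∀ σ, 0 < g σ) (σ : S2) : 0 < sqrtSm g hg σ :=
  Real.sqrt_pos.2 (hg σ)

lemma sqrtSm_mul_self (g : Sm) (hg : ∀ σ, 0 < g σ) : sqrtSm g hg * sqrtSm g hg = g := by
  ext σ
  exact Real.mul_self_sqrt (hg σ).le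

lemma L_sqrtSm (g : Sm) (hg : ∀ σ, 0 < g σ) (i : Fin 3) :
    L i (sqrtSm g hg) = (1 / 2 : ℝ) • (sqrtSm g hg * L i (logSm g hg)) := by
  refine Sm.mul_left_cancel_of_pos (sqrtSm_pos g hg) ?_
  have h1 := congrArg (L i) (sqrtSm_mul_self g hg)
  rw [Derivation.leibniz, L_eq_mul_L_log g hg i, smul_eq_mul] at h1
  ext σ
  have h2 := congrArg (fun k : Sm => k σ) h1
  have h3 : sqrtSm g hg σ * sqrtSm g hg σ = g σ :=
    congrArg (fun k : Sm => k σ) (sqrtSm_mul_self g hg)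
  simp only [Sm.coe_add, Sm.coe_mul, Sm.coe_smul] at h2 ⊢
  linear_combination h2 / 2 - L i (logSm g hg) σ / 2 * h3

lemma Lap_sqrtSm (g : Sm) (hg : ∀ σ, 0 < g σ) :
    Lap (sqrtSm g hg) = (1 / 2 : ℝ) • (sqrtSm g hg * Lap (logSm g hg))
      + (1 / 4 : ℝ) • (sqrtSm g hg * gradMul (logSm g hg) (logSm g hg)) := by
  simp only [Lap_apply, gradMul, L_sqrtSm, Derivation.map_smul, Derivation.leibniz, smul_eq_mul]
  ext σ
  simp only [Sm.coe_add, Sm.coe_mul, Sm.coe_smul, Fin.sum_univ_three]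
  ring

lemma Lap_eq_mul_log (g : Sm) (hg : ∀ σ, 0 < g σ) :
    Lap g = g * (Lap (logSm g hg) + gradMul (logSm g hg) (logSm g hg)) := by
  simp only [Lap_apply, gradMul, L_eq_mul_L_log g hg, Derivation.leibniz, smul_eq_mul,
    Fin.sum_univ_three]
  ring

/-! ### The Fisher information of a positive function -/

/-- The derivative of the Fisher information at a function with logarithm `w` in direction `h`. -/
def dFisher (w : Sm) : Sm →ₗ[ℝ] ℝ where
  toFun h := integ (∑ i, (2 * (L i w * L i h) - L i w * L i w * h))
  map_add' f g := by
    rw [← map_add]; congr 1; rw [← Finset.sum_add_distrib]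
    refine Finset.sum_congr rfl fun i _ => ?_
    rw [map_add]; ring
  map_smul' c f := by
    rw [RingHom.id_apply, ← map_smul]; congr 1; rw [Finset.smul_sum]
    refine Finset.sum_congr rfl fun i _ => ?_
    rw [Derivation.map_smul, smul_sub]
    simp only [mul_smul_comm]

lemma dFisher_apply (w h : Sm) :
    dFisher w h = integ (∑ i, (2 * (L i w * L i h) - L i w * L i w * h)) := rfl

/-- The Fisher information of a function `g` with logarithm `w`. -/
def fisherSm (g w : Sm) : ℝ := integ (g * gradMul w w)

lemma integ_nonneg {f : Sm} (hf : ∀ σ, 0 ≤ f σ) : 0 ≤ integ f := integral_nonneg hf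

lemma integ_mono {f g : Sm} (h : ∀ σ, f σ ≤ g σ) : integ f ≤ integ g :=
  integral_mono (integrable_continuous (Sm.continuous f)) (integrable_continuous (Sm.continuous g)) h

/-- The Fisher information lies above its tangents. -/
lemma fisherSm_sub_le {g w g' w' : Sm} (hg' : ∀ σ, 0 ≤ g' σ) (hw : ∀ i, L i g = g * L i w)
    (hw' : ∀ i, L i g' = g' * L i w') :
    fisherSm g w - fisherSm g' w' ≤ dFisher w (g - g') := by
  -- The information is homogeneous of degree one.
  have h1 : dFisher w g = fisherSm g w := by
    rw [dFisher_apply, fisherSm]; congr 1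
    simp only [hw, gradMul, Fin.sum_univ_three]; ring
  have h2 : dFisher w g' ≤ fisherSm g' w' := by
    refine integ_mono fun σ => ?_
    simp only [hw', gradMul]
    -- The gap in the tangent inequality is the relative Fisher information g' |∇w' - ∇w|².
    have h3 : (g' * ∑ i, L i w' * L i w') σ
        - (∑ i, (2 * (L i w * (g' * L i w')) - L i w * L i w * g') : Sm) σ
        = ∑ i, g' σ * (L i w' σ - L i w σ) ^ 2 := by
      rw [← Sm.coe_sub]
      have : (g' * ∑ i, L i w' * L i w')
        - (∑ i, (2 * (L i w * (g' * L i w')) - L i w * L i w * g') : Sm)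
        = ∑ i, g' * (L i w' - L i w) ^ 2 := by
        simp only [Fin.sum_univ_three]; ring
      rw [this]; simp
    have h4 : 0 ≤ ∑ i, g' σ * (L i w' σ - L i w σ) ^ 2 :=
      Finset.sum_nonneg fun i _ => mul_nonneg (hg' σ) (sq_nonneg _)
    linarith
  rw [map_sub, h1]
  linarith

/-- The square of the second derivatives along rotations. -/
def hessSq (w : Sm) : Sm := ∑ i, gradMul (L i w) (L i w)

/-- The dissipation of the Fisher information along the heat flow. -/
lemma dFisher_Lap {g w : Sm} (hw : ∀ i, L i g = g * L i w) :
    dFisher w (Lap g) = -2 * integ (g * hessSq w) := by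
  have h : ∀ i, integ (2 * (L i w * L i (Lap g)) - L i w * L i w * Lap g)
      = -2 * integ (g * gradMul (L i w) (L i w)) := by
    intro i
    have e1 : integ (2 * (L i w * L i (Lap g))) = 2 * integ (Lap (L i w) * (g * L i w)) := by
      rw [integ_Lap_mul, ← hw, Lap_L, two_mul, map_add]; ring
    have e2 : integ (L i w * L i w * Lap g) = integ (Lap (L i w * L i w) * g) := by
      rw [integ_Lap_mul]
    rw [map_sub, e1, e2, Lap_mul]
    -- The terms with `Lap (L i w)` cancel those of `e1`; only the square of the gradient survives.
    have e3 : (L i w * Lap (L i w) + L i w * Lap (L i w) + 2 * gradMul (L i w) (L i w)) * g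
        = (2 : ℝ) • (Lap (L i w) * (g * L i w)) + (2 : ℝ) • (g * gradMul (L i w) (L i w)) := by
      rw [two_smul, two_smul]; ring
    rw [e3, map_add, map_smul, map_smul]
    simp only [smul_eq_mul]; ring
  rw [dFisher_apply, map_sum, hessSq, Finset.mul_sum, map_sum, Finset.mul_sum]
  exact Finset.sum_congr rfl fun i _ => h i

lemma hessSq_apply (w : Sm) (σ : S2) : hessSq w σ = ∑ i, ∑ j, (L j (L i w) σ) ^ 2 := by
  simp [hessSq, gradMul, sq]

lemma Lap_sq_le (w : Sm) (σ : S2) : (Lap w σ) ^ 2 ≤ 3 * hessSq w σ := by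
  rw [hessSq_apply, Lap_apply]
  simp only [Fin.sum_univ_three, Sm.coe_add]
  generalize L 0 (L 0 w) σ = a
  generalize L 1 (L 1 w) σ = b
  generalize L 2 (L 2 w) σ = c
  nlinarith [sq_nonneg (a - b), sq_nonneg (b - c), sq_nonneg (a - c), sq_nonneg (L 1 (L 0 w) σ),
    sq_nonneg (L 2 (L 0 w) σ), sq_nonneg (L 0 (L 1 w) σ), sq_nonneg (L 2 (L 1 w) σ),
    sq_nonneg (L 0 (L 2 w) σ), sq_nonneg (L 1 (L 2 w) σ)]

/-- Control of the fourth power of the gradient by the second derivatives. -/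
lemma integ_grad_fourth_le {g w : Sm} (hg : ∀ σ, 0 ≤ g σ) (hw : ∀ i, L i g = g * L i w) :
    integ (g * gradMul w w ^ 2) ≤ 14 * integ (g * hessSq w) := by
  set X := gradMul w w with hX
  have hL : ∀ i, L i X = 2 * ∑ j, L j w * L i (L j w) := by
    intro i
    simp only [hX, gradMul, map_add, Derivation.leibniz, smul_eq_mul, Fin.sum_univ_three]
    ring
  -- One factor g ∇w is ∇g; it is integrated by parts.
  have h1 : integ (g * X ^ 2) = -integ (g * (X * Lap w + ∑ i, L i w * L i X)) := by
    have e1 : g * X ^ 2 = ∑ i, (L i w * X) * L i g := by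
      simp only [hw, sq]
      nth_rw 1 [hX]
      simp only [gradMul, Fin.sum_univ_three]
      ring
    have e2 : g * (X * Lap w + ∑ i, L i w * L i X) = ∑ i, L i (L i w * X) * g := by
      simp only [Lap_apply, Derivation.leibniz, smul_eq_mul, Fin.sum_univ_three]
      ring
    rw [e1, e2, map_sum, map_sum, ← Finset.sum_neg_distrib]
    exact Finset.sum_congr rfl fun i _ => integ_mul_L i _ _
  -- Young's inequality with weight 1/4 on X² in each term leaves 3 + 4 = 7 Hessian squares.
  -- Absorbing X²/2 on the left doubles this to 14.
  have h2 : -integ (g * (X * Lap w + ∑ i, L i w * L i X))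
      ≤ integ (g * ((1 / 2 : ℝ) • X ^ 2 + (7 : ℝ) • hessSq w)) := by
    rw [← map_neg]
    refine integ_mono fun σ => ?_
    have hX2 : X σ ^ 2 = ∑ i, ∑ j, (L i w σ * L j w σ) ^ 2 := by
      simp only [hX, gradMul, Sm.coe_add, Sm.coe_mul, Fin.sum_univ_three]; ring
    have hs : (∑ i, L i w * L i X) σ = 2 * ∑ i, ∑ j, L i w σ * L j w σ * L i (L j w) σ := by
      simp only [hL, two_mul, Sm.coe_mul, Sm.coe_add, Fin.sum_univ_three]; ring
    have hle : -(2 * ∑ i, ∑ j, L i w σ * L j w σ * L i (L j w) σ)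
        ≤ 1 / 4 * X σ ^ 2 + 4 * hessSq w σ := by
      rw [hX2, hessSq_apply, Finset.sum_comm (f := fun i j => (L j (L i w) σ) ^ 2)]
      simp only [Finset.mul_sum, ← Finset.sum_add_distrib, ← Finset.sum_neg_distrib]
      refine Finset.sum_le_sum fun i _ => Finset.sum_le_sum fun j _ => ?_
      nlinarith [sq_nonneg (L i w σ * L j w σ / 2 + 2 * L i (L j w) σ)]
    have hle2 : -(X σ * Lap w σ) ≤ 1 / 4 * X σ ^ 2 + 3 * hessSq w σ := by
      nlinarith [Lap_sq_le w σ, sq_nonneg (X σ / 2 + Lap w σ)]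
    have : -(g σ * (X σ * Lap w σ + (∑ i, L i w * L i X) σ))
        ≤ g σ * (1 / 2 * X σ ^ 2 + 7 * hessSq w σ) := by
      rw [hs, ← mul_neg]
      refine mul_le_mul_of_nonneg_left ?_ (hg σ)
      linarith
    exact this
  have h3 : integ (g * ((1 / 2 : ℝ) • X ^ 2 + (7 : ℝ) • hessSq w))
      = 1 / 2 * integ (g * X ^ 2) + 7 * integ (g * hessSq w) := by
    rw [mul_add, mul_smul_comm, mul_smul_comm, map_add, map_smul, map_smul]; rfl
  linarith

/-- The time derivative of the square root of a solution of the heat equation. -/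
def heatRoot (u w : Sm) : Sm := (1 / 2 : ℝ) • (u * (Lap w + gradMul w w))

/-- The dissipation controls the second derivatives and the time derivative of the square root. -/
lemma sqrt_norms_le (g : Sm) (hg : ∀ σ, 0 < g σ) :
    3 * integ (Lap (sqrtSm g hg) ^ 2) + integ (heatRoot (sqrtSm g hg) (logSm g hg) ^ 2)
      ≤ 30 * integ (g * hessSq (logSm g hg)) := by
  set w := logSm g hg
  set u := sqrtSm g hg
  have hw : ∀ i, L i g = g * L i w := L_eq_mul_L_log g hg
  have h1 := integ_grad_fourth_le (fun σ => (hg σ).le) hw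
  -- With `integ_grad_fourth_le` the right side is at most 6 + 14 · 7/8 = 18.25 dissipation
  -- integrals, which leaves slack below 30.
  have h2 : integ ((3 : ℝ) • Lap u ^ 2 + heatRoot u w ^ 2)
      ≤ integ ((6 : ℝ) • (g * hessSq w) + (7 / 8 : ℝ) • (g * gradMul w w ^ 2)) := by
    refine integ_mono fun σ => ?_
    have hu : u σ * u σ = g σ := congrArg (fun k : Sm => k σ) (sqrtSm_mul_self g hg)
    have e1 : Lap u σ = u σ * (1 / 2 * Lap w σ + 1 / 4 * gradMul w w σ) := by
      simp only [u, w, Lap_sqrtSm, Sm.coe_add, Sm.coe_smul, Sm.coe_mul]; ring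
    have hl := Lap_sq_le w σ
    have e2 : 3 * (Lap u σ) ^ 2 + (heatRoot u w σ) ^ 2
        = g σ * (3 * (1 / 2 * Lap w σ + 1 / 4 * gradMul w w σ) ^ 2
          + 1 / 4 * (Lap w σ + gradMul w w σ) ^ 2) := by
      rw [e1, ← hu]
      simp only [heatRoot, Sm.coe_smul, Sm.coe_mul, Sm.coe_add]
      ring
    have e3 : 3 * (1 / 2 * Lap w σ + 1 / 4 * gradMul w w σ) ^ 2
          + 1 / 4 * (Lap w σ + gradMul w w σ) ^ 2
        ≤ 6 * hessSq w σ + 7 / 8 * gradMul w w σ ^ 2 := by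
      nlinarith [sq_nonneg (Lap w σ - gradMul w w σ), sq_nonneg (Lap w σ - gradMul w w σ / 2)]
    have := mul_le_mul_of_nonneg_left e3 (hg σ).le
    rw [← e2] at this
    simp only [Sm.coe_add, Sm.coe_smul, Sm.coe_mul, Sm.coe_pow]
    linarith
  simp only [map_add, map_smul, smul_eq_mul] at h2
  have h0 : 0 ≤ integ (g * hessSq w) := integ_nonneg fun σ => mul_nonneg (hg σ).le (by
    rw [hessSq_apply]; positivity)
  linarith

/-! ### The minimum principle -/

/-- If c < 0, the second derivative test makes the minimum a local maximum as well, so φ is locally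
constant and c = 0. -/
lemma second_deriv_nonneg_of_min {φ ψ : ℝ → ℝ} {c : ℝ} (h1 : ∀ t, HasDerivAt φ (ψ t) t)
    (h2 : HasDerivAt ψ c 0) (hmin : ∀ t, φ 0 ≤ φ t) : 0 ≤ c := by
  by_contra! hc
  have hd : deriv φ = ψ := funext fun t => (h1 t).deriv
  have hlm : IsLocalMin φ 0 := .of_forall hmin
  have h0 : deriv φ 0 = 0 := hlm.deriv_eq_zero
  have hmax : IsLocalMax φ 0 :=
    isLocalMax_of_deriv_deriv_neg (by rw [hd, h2.deriv]; exact hc) h0 (h1 0).continuousAt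
  have hconst : φ =ᶠ[𝓝 0] fun _ => φ 0 := by
    filter_upwards [hmax] with t ht using le_antisymm ht (hmin t)
  have h3 : ψ =ᶠ[𝓝 0] fun _ => 0 := by
    have := hconst.deriv
    rw [hd] at this
    simpa using this
  have := h2.unique ((hasDerivAt_const (0 : ℝ) (0 : ℝ)).congr_of_eventuallyEq h3)
  exact hc.ne this

lemma Lap_nonneg_of_min {f : Sm} {σ : S2} (hmin : ∀ τ, f σ ≤ f τ) : 0 ≤ Lap f σ := by
  rw [Lap_apply, Sm.coe_sum]
  refine Finset.sum_nonneg fun i _ => ?_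
  have h2 := hasDerivAt_comp_rot (L i f) i σ 0
  rw [sphMap_rotEquiv_zero] at h2
  refine second_deriv_nonneg_of_min (hasDerivAt_comp_rot f i σ) h2 fun t => ?_
  rw [sphMap_rotEquiv_zero]; exact hmin _

instance : Nonempty S2 := ⟨sphProj (unitVec 0) (by simp)⟩

/-- Minimum principle for one implicit Euler step: at a minimum of f the Laplacian is nonnegative,
so f ≥ q there. -/
lemma le_of_sub_Lap {f q : Sm} {c τ : ℝ} (hτ : 0 ≤ τ) (h : f - τ • Lap f = q)
    (hq : ∀ σ, c ≤ q σ) (σ : S2) : c ≤ f σ := by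
  obtain ⟨σ₀, -, h0⟩ := isCompact_univ.exists_isMinOn Set.univ_nonempty
    (Sm.continuous f).continuousOn
  have hmin : ∀ τ, f σ₀ ≤ f τ := fun τ => h0 (Set.mem_univ τ)
  have h1 := congrArg (fun k : Sm => k σ₀) h
  simp only [Sm.coe_sub, Sm.coe_smul] at h1
  have h2 := mul_nonneg hτ (Lap_nonneg_of_min hmin)
  linarith [hq σ₀, hmin σ]

/-! ### The heat flow of finite sums of eigenfunctions -/

/-- The solution of the heat equation with initial value `∑ p n`. -/
def heat (p : ℕ → Sm) (N : ℕ) (t : ℝ) : Sm :=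
  ∑ n ∈ Finset.range N, Real.exp (-(t * eigenvalue n)) • p n

lemma heat_zero (p : ℕ → Sm) (N : ℕ) : heat p N 0 = ∑ n ∈ Finset.range N, p n := by
  simp [heat]

lemma heat_apply (p : ℕ → Sm) (N : ℕ) (t : ℝ) (σ : S2) :
    heat p N t σ = ∑ n ∈ Finset.range N, Real.exp (-(t * eigenvalue n)) * p n σ := by
  simp [heat]

/-- The heat flow preserves lower bounds. -/
lemma le_heat {p : ℕ → Sm} (hp : ∀ n, p n ∈ eigenFns n) {N : ℕ} {c : ℝ}
    (hc : ∀ σ, c ≤ (∑ n ∈ Finset.range N, p n) σ) {t : ℝ} (ht : 0 ≤ t) (σ : S2) :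
    c ≤ heat p N t σ := by
  -- The flow is the limit of k implicit Euler steps of length t/k, each of which preserves lower
  -- bounds.
  have hres : ∀ τ : ℝ, 0 ≤ τ → ∀ k : ℕ, ∀ σ,
      c ≤ (∑ n ∈ Finset.range N, ((1 + τ * eigenvalue n) ^ k)⁻¹ • p n) σ := by
    intro τ hτ k
    induction k with
    | zero => simpa using hc
    | succ k ih =>
      refine le_of_sub_Lap hτ ?_ ih
      rw [map_sum, Finset.smul_sum, ← Finset.sum_sub_distrib]
      refine Finset.sum_congr rfl fun n _ => ?_
      have h1 : 1 + τ * eigenvalue n ≠ 0 := by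
        have := mul_nonneg hτ (eigenvalue_nonneg n); positivity
      rw [map_smul, mem_eigenFns.1 (hp n)]
      have : ((1 + τ * eigenvalue n) ^ (k + 1))⁻¹ • p n
          - τ • ((1 + τ * eigenvalue n) ^ (k + 1))⁻¹ • -(eigenvalue n • p n)
          = (((1 + τ * eigenvalue n) ^ (k + 1))⁻¹ * (1 + τ * eigenvalue n)) • p n := by module
      rw [this]
      congr 1
      rw [pow_succ]
      field_simp
  have hlim : Tendsto (fun k : ℕ => (∑ n ∈ Finset.range N,
      ((1 + t / k * eigenvalue n) ^ k)⁻¹ • p n) σ) atTop (𝓝 (heat p N t σ)) := by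
    simp only [Sm.coe_sum, Sm.coe_smul, heat]
    refine tendsto_finsetSum _ fun n _ => Tendsto.mul_const _ ?_
    rw [Real.exp_neg]
    refine Tendsto.inv₀ ?_ (Real.exp_pos _).ne'
    refine (Real.tendsto_one_add_div_pow_exp (t * eigenvalue n)).congr fun k => ?_
    ring_nf
  exact ge_of_tendsto' hlim fun k => hres (t / k) (by positivity) k σ

lemma L_heat (p : ℕ → Sm) (N : ℕ) (t : ℝ) (i : Fin 3) :
    L i (heat p N t) = heat (fun n => L i (p n)) N t := by
  simp only [heat, map_sum, Derivation.map_smul]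

lemma Lap_heat (p : ℕ → Sm) (N : ℕ) (t : ℝ) :
    Lap (heat p N t) = heat (fun n => Lap (p n)) N t := by
  simp only [heat, map_sum, map_smul]

lemma continuous_heat (p : ℕ → Sm) (N : ℕ) : Continuous fun x : ℝ × S2 => heat p N x.1 x.2 := by
  simp only [heat_apply]
  refine continuous_finsetSum _ fun n _ => ?_
  have := Sm.continuous (p n)
  fun_prop

lemma hasDerivAt_heat {p : ℕ → Sm} (hp : ∀ n, p n ∈ eigenFns n) (N : ℕ) (t : ℝ) (σ : S2) :
    HasDerivAt (fun r => heat p N r σ) (Lap (heat p N t) σ) t := by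
  rw [Lap_heat]
  simp only [heat_apply]
  refine HasDerivAt.fun_sum fun n _ => ?_
  have h := ((((hasDerivAt_id t).mul_const (eigenvalue n)).neg).exp).mul_const (p n σ)
  refine h.congr_deriv ?_
  rw [mem_eigenFns.1 (hp n)]
  simp [mul_assoc]

/-- The times at which the solution is positive. -/
def posTimes (p : ℕ → Sm) (N : ℕ) : Set ℝ := {t | ∀ σ, 0 < heat p N t σ}

lemma isOpen_posTimes (p : ℕ → Sm) (N : ℕ) : IsOpen (posTimes p N) := by
  rw [← isClosed_compl_iff]
  have h : (posTimes p N)ᶜ = Prod.fst '' {x : ℝ × S2 | heat p N x.1 x.2 ≤ 0} := by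
    ext t; simp [posTimes]
  rw [h]
  exact isClosedMap_fst_of_compactSpace _ (isClosed_le (continuous_heat p N) continuous_const)

lemma nonneg_mem_posTimes {p : ℕ → Sm} (hp : ∀ n, p n ∈ eigenFns n) {N : ℕ}
    (hpos : ∀ σ, 0 < (∑ n ∈ Finset.range N, p n) σ) {t : ℝ} (ht : 0 ≤ t) : t ∈ posTimes p N := by
  obtain ⟨σ₀, -, h0⟩ := isCompact_univ.exists_isMinOn Set.univ_nonempty
    (Sm.continuous (∑ n ∈ Finset.range N, p n)).continuousOn
  exact fun σ => (hpos σ₀).trans_le (le_heat hp (fun τ => h0 (Set.mem_univ τ)) ht σ)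

/-! ### Fisher information and square root along the heat flow -/

/-- The Fisher information along the heat flow. -/
def fisherHeat (p : ℕ → Sm) (N : ℕ) (t : ℝ) : ℝ :=
  ∫ σ, (∑ i, L i (heat p N t) σ ^ 2 / heat p N t σ) ∂surf

lemma fisherHeat_eq {p : ℕ → Sm} {N : ℕ} {t : ℝ} (ht : t ∈ posTimes p N) :
    fisherHeat p N t = fisherSm (heat p N t) (logSm _ ht) := by
  rw [fisherHeat, fisherSm, integ_apply]
  congr 1
  ext σ
  have := (ht σ).ne'
  simp only [gradMul, Sm.coe_mul, Sm.coe_sum, L_logSm_apply _ ht, Finset.mul_sum]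
  refine Finset.sum_congr rfl fun i _ => ?_
  field_simp

lemma hasDerivAt_fisherHeat {p : ℕ → Sm} (hp : ∀ n, p n ∈ eigenFns n) {N : ℕ} {t : ℝ}
    (ht : t ∈ posTimes p N) :
    HasDerivAt (fisherHeat p N) (-2 * integ (heat p N t * hessSq (logSm _ ht))) t := by
  rw [← dFisher_Lap (L_eq_mul_L_log _ ht)]
  have hc := continuous_heat p N
  have hcL : ∀ i, Continuous fun x : ℝ × S2 => L i (heat p N x.1) x.2 := fun i => by
    simp only [L_heat]; exact continuous_heat _ N
  have hcLap : Continuous fun x : ℝ × S2 => Lap (heat p N x.1) x.2 := by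
    simp only [Lap_heat]; exact continuous_heat _ N
  have hcLLap : ∀ i, Continuous fun x : ℝ × S2 => L i (Lap (heat p N x.1)) x.2 := fun i => by
    simp only [Lap_heat, L_heat]; exact continuous_heat _ N
  have key := hasDerivAt_integral_sphere (isOpen_posTimes p N)
    (Φ := fun t σ => ∑ i, L i (heat p N t) σ ^ 2 / heat p N t σ)
    (Φ' := fun t σ => ∑ i, ((2 * L i (heat p N t) σ * L i (Lap (heat p N t)) σ) * heat p N t σ
      - L i (heat p N t) σ ^ 2 * Lap (heat p N t) σ) / heat p N t σ ^ 2) ?_ ?_ ?_ ht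
  · refine key.congr_deriv ?_
    rw [dFisher_apply, integ_apply]
    congr 1
    ext σ
    rw [Sm.coe_sum]
    refine Finset.sum_congr rfl fun i _ => ?_
    have := (ht σ).ne'
    simp only [Sm.coe_sub, Sm.coe_mul, L_logSm_apply _ ht, two_mul, Sm.coe_add]
    field_simp
  · intro r hr
    refine continuous_finsetSum _ fun i _ => ?_
    exact ((Sm.continuous _).pow 2).div (Sm.continuous _) fun σ => (hr σ).ne'
  · intro r hr σ
    refine HasDerivAt.fun_sum fun i _ => ?_
    have h1 : HasDerivAt (fun r => L i (heat p N r) σ) (L i (Lap (heat p N r)) σ) r := by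
      have := hasDerivAt_heat (fun n => L_mem_eigenFns (hp n) i) N r σ
      rw [← L_heat, Lap_L] at this
      simpa only [L_heat] using this
    have h2 := hasDerivAt_heat hp N r σ
    refine ((h1.pow 2).fun_div h2 (hr σ).ne').congr_deriv ?_
    simp
  · refine continuousOn_finsetSum _ fun i _ => ?_
    refine ContinuousOn.div ?_ ?_ ?_
    · exact Continuous.continuousOn ((((continuous_const.mul (hcL i)).mul (hcLLap i)).mul hc).sub
        (((hcL i).pow 2).mul hcLap))
    · exact (hc.pow 2).continuousOn
    · rintro ⟨r, σ⟩ hr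
      exact pow_ne_zero 2 (hr.1 σ).ne'

lemma hasDerivAt_integral_sqrt_heat {p : ℕ → Sm} (hp : ∀ n, p n ∈ eigenFns n) {N : ℕ} {t : ℝ}
    (ht : t ∈ posTimes p N) (Y : Sm) :
    HasDerivAt (fun r => ∫ σ, √(heat p N r σ) * Y σ ∂surf)
      (integ (heatRoot (sqrtSm _ ht) (logSm _ ht) * Y)) t := by
  have hc := continuous_heat p N
  have hcLap : Continuous fun x : ℝ × S2 => Lap (heat p N x.1) x.2 := by
    simp only [Lap_heat]; exact continuous_heat _ N
  have key := hasDerivAt_integral_sphere (isOpen_posTimes p N)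
    (Φ := fun t σ => √(heat p N t σ) * Y σ)
    (Φ' := fun t σ => Lap (heat p N t) σ / (2 * √(heat p N t σ)) * Y σ) ?_ ?_ ?_ ht
  · refine key.congr_deriv ?_
    rw [integ_apply]
    congr 1
    ext σ
    rw [Sm.coe_mul]
    congr 1
    rw [Lap_eq_mul_log _ ht]
    have h1 : 0 < √(heat p N t σ) := Real.sqrt_pos.2 (ht σ)
    have h2 := Real.mul_self_sqrt (ht σ).le
    simp only [heatRoot, Sm.coe_smul, Sm.coe_mul, Sm.coe_add, sqrtSm_apply _ ht]
    rw [div_eq_iff (by positivity)]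
    linear_combination (-(Lap (logSm _ ht) σ + gradMul (logSm _ ht) (logSm _ ht) σ)) * h2
  · intro r _
    exact (Real.continuous_sqrt.comp (Sm.continuous _)).mul (Sm.continuous Y)
  · intro r hr σ
    exact ((hasDerivAt_heat hp N r σ).sqrt (hr σ).ne').mul_const _
  · refine ContinuousOn.mul (ContinuousOn.div hcLap.continuousOn
      (continuous_const.mul (Real.continuous_sqrt.comp hc)).continuousOn ?_)
      ((Sm.continuous Y).comp continuous_snd).continuousOn
    rintro ⟨r, σ⟩ hr
    have := Real.sqrt_pos.2 (hr.1 σ)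
    positivity

/-! ### Comparison of the dissipation with the modes of the square root -/

/-- The cutoff in `sum_modes_le` is squared so that it stays differentiable at its kink. -/
lemma hasDerivAt_max_sq (x : ℝ) : HasDerivAt (fun x : ℝ => max x 0 ^ 2) (2 * max x 0) x := by
  rcases lt_trichotomy x 0 with h | h | h
  · refine ((hasDerivAt_const x (0 : ℝ)).congr_of_eventuallyEq ?_).congr_deriv ?_
    · filter_upwards [gt_mem_nhds h] with y hy
      simp [max_eq_right hy.le]
    · simp [max_eq_right h.le]
  · subst h
    rw [hasDerivAt_iff_isLittleO_nhds_zero]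
    simp only [zero_add, max_self, mul_zero, smul_zero, sub_zero]
    rw [Asymptotics.isLittleO_iff]
    intro c hc
    filter_upwards [Metric.ball_mem_nhds (0 : ℝ) hc] with y hy
    have hy' : |y| < c := by simpa using hy
    have : max y 0 ≤ |y| := max_le (le_abs_self y) (abs_nonneg y)
    have h0 : 0 ≤ max y 0 := le_max_right _ _
    simp only [Real.norm_eq_abs, ne_eq, OfNat.ofNat_ne_zero, not_false_eq_true, zero_pow, sub_zero]
    rw [abs_of_nonneg (by positivity)]
    nlinarith [abs_nonneg y]
  · refine ((hasDerivAt_pow 2 x).congr_of_eventuallyEq ?_).congr_deriv ?_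
    · filter_upwards [lt_mem_nhds h] with y hy
      simp [max_eq_left hy.le]
    · simp [max_eq_left h.le]

/-- The loss of Fisher information up to the time `r` dominates the modes of the square root whose
frequency is at least `1 / r`. -/
lemma sum_modes_le {p : ℕ → Sm} (hp : ∀ n, p n ∈ eigenFns n) {N : ℕ}
    (hpos : ∀ σ, 0 < (∑ n ∈ Finset.range N, p n) σ) {Y : ℕ → Sm} (hY : ∀ n, Y n ∈ eigenFns n)
    (S : Finset ℕ) (hbessel : ∀ f : Sm, ∑ n ∈ S, integ (f * Y n) ^ 2 ≤ integ (f ^ 2))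
    {r : ℝ} (hr : 0 ≤ r) (hS : ∀ n ∈ S, 1 ≤ eigenvalue n * r) :
    ∑ n ∈ S, eigenvalue n * (∫ σ, √((∑ n ∈ Finset.range N, p n) σ) * Y n σ ∂surf) ^ 2
      ≤ 15 * (fisherHeat p N 0 - fisherHeat p N r) := by
  let a : ℕ → ℝ → ℝ := fun n t => ∫ σ, √(heat p N t σ) * Y n σ ∂surf
  -- The weight (1 - λ_n t)_+² is 1 at time 0 and, since λ_n r ≥ 1, vanishes at time r. Thus the
  -- claim is Ψ(r) ≤ Ψ(0), and it suffices that Ψ is nonincreasing.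
  let Ψ : ℝ → ℝ := fun t => 15 * fisherHeat p N t
    - ∑ n ∈ S, eigenvalue n * (max (1 - eigenvalue n * t) 0 ^ 2 * a n t ^ 2)
  have hmem : ∀ t, 0 ≤ t → t ∈ posTimes p N := fun t ht => nonneg_mem_posTimes hp hpos ht
  have hder : ∀ t, 0 ≤ t → ∃ D, HasDerivAt Ψ D t ∧ D ≤ 0 := by
    intro t ht
    have htm := hmem t ht
    set u := sqrtSm _ htm with hu
    set w := logSm _ htm with hw
    have hda : ∀ n, HasDerivAt (a n) (integ (heatRoot u w * Y n)) t :=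
      fun n => hasDerivAt_integral_sqrt_heat hp htm (Y n)
    have hdc : ∀ n, HasDerivAt (fun t => max (1 - eigenvalue n * t) 0 ^ 2)
        (2 * max (1 - eigenvalue n * t) 0 * -eigenvalue n) t := fun n => by
      have h1 : HasDerivAt (fun t => 1 - eigenvalue n * t) (-eigenvalue n) t := by
        simpa using ((hasDerivAt_id t).const_mul (eigenvalue n)).const_sub 1
      exact (hasDerivAt_max_sq _).comp t h1
    have hd := ((hasDerivAt_fisherHeat hp htm).const_mul 15).sub
      (HasDerivAt.fun_sum (u := S) fun n _ =>
        ((hdc n).mul ((hda n).pow 2)).const_mul (eigenvalue n))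
    refine ⟨_, hd, ?_⟩
    have hn : ∀ n, eigenvalue n * a n t = -integ (Lap u * Y n) := by
      intro n
      rw [integ_Lap_mul, mem_eigenFns.1 (hY n), mul_neg, map_neg, mul_smul_comm, map_smul, neg_neg]
      rfl
    -- With x = λ_n a_n, b = a_n' and 0 ≤ c ≤ 1, this is 2c x² - 2c² x b ≤ 2x² + (x² + b²). Bessel
    -- then matches the sum with the left side of `sqrt_norms_le`, whose bound 30 is 15 times the
    -- dissipation factor 2.
    have hterm : ∀ n ∈ S, -(eigenvalue n * (2 * max (1 - eigenvalue n * t) 0 * -eigenvalue n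
        * a n t ^ 2 + max (1 - eigenvalue n * t) 0 ^ 2
          * (2 * a n t * integ (heatRoot u w * Y n))))
        ≤ 3 * integ (Lap u * Y n) ^ 2 + integ (heatRoot u w * Y n) ^ 2 := by
      intro n _
      have h1 : integ (Lap u * Y n) ^ 2 = (eigenvalue n * a n t) ^ 2 := by rw [hn]; ring
      rw [h1]
      have hc0 : 0 ≤ max (1 - eigenvalue n * t) 0 := le_max_right _ _
      have hc1 : max (1 - eigenvalue n * t) 0 ≤ 1 :=
        max_le (by linarith [mul_nonneg (eigenvalue_nonneg n) ht]) zero_le_one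
      generalize max (1 - eigenvalue n * t) 0 = c at *
      generalize integ (heatRoot u w * Y n) = b
      have e1 : -(eigenvalue n * (2 * c * -eigenvalue n * a n t ^ 2 + c ^ 2 * (2 * a n t * b)))
          = 2 * c * (eigenvalue n * a n t) ^ 2 - c ^ 2 * (2 * (eigenvalue n * a n t) * b) := by
        ring
      rw [e1]
      generalize eigenvalue n * a n t = x
      have hc2 : c ^ 2 ≤ 1 := by nlinarith
      have e2 : -(c ^ 2 * (2 * x * b)) ≤ c ^ 2 * (x ^ 2 + b ^ 2) := by
        nlinarith [mul_nonneg (sq_nonneg c) (sq_nonneg (x + b))]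
      have e3 : c ^ 2 * (x ^ 2 + b ^ 2) ≤ x ^ 2 + b ^ 2 := by
        nlinarith [mul_nonneg (sub_nonneg.2 hc2) (add_nonneg (sq_nonneg x) (sq_nonneg b))]
      nlinarith [mul_nonneg (sub_nonneg.2 hc1) (sq_nonneg x)]
    have hsum := Finset.sum_le_sum hterm
    rw [Finset.sum_neg_distrib, Finset.sum_add_distrib, ← Finset.mul_sum] at hsum
    have hb1 := hbessel (Lap u)
    have hb2 := hbessel (heatRoot u w)
    have hF := sqrt_norms_le _ htm
    rw [← hu, ← hw] at hF
    simp only [pow_one, Nat.cast_ofNat, Nat.add_one_sub_one, Pi.pow_apply] at hsum ⊢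
    linarith
  have hanti : AntitoneOn Ψ (Set.Icc 0 r) := by
    refine antitoneOn_of_deriv_nonpos (convex_Icc 0 r) (fun t ht => ?_) (fun t ht => ?_)
      fun t ht => ?_
    · obtain ⟨D, hD, -⟩ := hder t ht.1
      exact hD.continuousAt.continuousWithinAt
    · rw [interior_Icc] at ht
      obtain ⟨D, hD, -⟩ := hder t ht.1.le
      exact hD.differentiableAt.differentiableWithinAt
    · rw [interior_Icc] at ht
      obtain ⟨D, hD, h0⟩ := hder t ht.1.le
      rwa [hD.deriv]
  have h := hanti (Set.left_mem_Icc.2 hr) (Set.right_mem_Icc.2 hr) hr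
  have hΨr : Ψ r = 15 * fisherHeat p N r := by
    simp only [Ψ]
    rw [Finset.sum_eq_zero, sub_zero]
    intro n hn
    rw [max_eq_right (by linarith [hS n hn])]; simp
  have hΨ0 : Ψ 0 = 15 * fisherHeat p N 0 - ∑ n ∈ S, eigenvalue n * a n 0 ^ 2 := by
    simp [Ψ]
  rw [hΨr, hΨ0] at h
  simp only [a, heat_zero] at h
  linarith

/-! ### Powers as superpositions of exponentials -/

/-- The normalizing constant of the integral representation of `x ^ s`. -/
def fracConst (s : ℝ) : ℝ := ∫ t in Set.Ioi (0 : ℝ), (1 - Real.exp (-t)) * t ^ (-1 - s)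

/-- Near 0 the integrand is at most x t^{-s}, integrable as s < 1; at infinity it is at most
t^{-1-s}, integrable as s > 0. -/
lemma integrableOn_frac {s : ℝ} (hs₀ : 0 < s) (hs₁ : s < 1) {x : ℝ} (hx : 0 ≤ x) :
    IntegrableOn (fun t : ℝ => (1 - Real.exp (-(t * x))) * t ^ (-1 - s)) (Set.Ioi 0) := by
  have hm : Measurable fun t : ℝ => (1 - Real.exp (-(t * x))) * t ^ (-1 - s) := by fun_prop
  rw [← Set.Ioc_union_Ioi_eq_Ioi zero_le_one]
  refine IntegrableOn.union ?_ ?_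
  · have h1 : IntegrableOn (fun t : ℝ => x * t ^ (-s)) (Set.Ioc 0 1) :=
      ((intervalIntegrable_iff_integrableOn_Ioc_of_le zero_le_one).1
        (intervalIntegral.intervalIntegrable_rpow' (by linarith))).const_mul x
    refine h1.mono' hm.aestronglyMeasurable ?_
    filter_upwards [ae_restrict_mem measurableSet_Ioc] with t ht
    have h2 : 0 ≤ 1 - Real.exp (-(t * x)) := by
      have := Real.exp_le_one_iff.2 (neg_nonpos.2 (mul_nonneg ht.1.le hx)); linarith
    have h3 : 1 - Real.exp (-(t * x)) ≤ t * x := by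
      have := Real.add_one_le_exp (-(t * x)); linarith
    rw [Real.norm_eq_abs, abs_of_nonneg (mul_nonneg h2 (Real.rpow_nonneg ht.1.le _))]
    calc (1 - Real.exp (-(t * x))) * t ^ (-1 - s) ≤ t * x * t ^ (-1 - s) := by
          gcongr; exact Real.rpow_nonneg ht.1.le _
      _ = x * (t ^ (1 : ℝ) * t ^ (-1 - s)) := by rw [Real.rpow_one]; ring
      _ = x * t ^ (-s) := by rw [← Real.rpow_add ht.1]; ring_nf
  · have h1 : IntegrableOn (fun t : ℝ => t ^ (-1 - s)) (Set.Ioi 1) :=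
      integrableOn_Ioi_rpow_of_lt (by linarith) one_pos
    refine h1.mono' hm.aestronglyMeasurable ?_
    filter_upwards [ae_restrict_mem measurableSet_Ioi] with t ht
    have ht0 : 0 < t := lt_trans one_pos ht
    have h2 : 0 ≤ 1 - Real.exp (-(t * x)) := by
      have := Real.exp_le_one_iff.2 (neg_nonpos.2 (mul_nonneg ht0.le hx)); linarith
    have h3 := Real.exp_pos (-(t * x))
    have h4 := Real.rpow_nonneg ht0.le (-1 - s)
    rw [Real.norm_eq_abs, abs_of_nonneg (mul_nonneg h2 h4)]
    nlinarith

/-- Scaling t by x pulls out x^s; for x = 0 both sides vanish. -/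
lemma integral_frac {s : ℝ} (hs₀ : 0 < s) {x : ℝ} (hx : 0 ≤ x) :
    ∫ t in Set.Ioi (0 : ℝ), (1 - Real.exp (-(t * x))) * t ^ (-1 - s) = x ^ s * fracConst s := by
  rcases hx.eq_or_lt with rfl | hx
  · simp [Real.zero_rpow hs₀.ne']
  · have h := integral_comp_mul_left_Ioi (fun t : ℝ => (1 - Real.exp (-t)) * t ^ (-1 - s)) 0 hx
    rw [mul_zero] at h
    change _ = x⁻¹ • fracConst s at h
    have h2 : ∫ t in Set.Ioi (0 : ℝ), (1 - Real.exp (-(x * t))) * (x * t) ^ (-1 - s)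
        = x ^ (-1 - s) * ∫ t in Set.Ioi (0 : ℝ), (1 - Real.exp (-(t * x))) * t ^ (-1 - s) := by
      rw [← integral_const_mul]
      refine setIntegral_congr_fun measurableSet_Ioi fun t ht => ?_
      rw [Set.mem_Ioi] at ht
      rw [Real.mul_rpow hx.le ht.le, mul_comm x t]; ring
    rw [h2, smul_eq_mul] at h
    have h3 : x ^ s * x ^ (-1 - s) = x⁻¹ := by
      rw [← Real.rpow_add hx, ← Real.rpow_neg_one]; ring_nf
    have h4 : x ^ (-1 - s) * x ^ s * x = 1 := by
      rw [mul_comm (x ^ (-1 - s)), h3, inv_mul_cancel₀ hx.ne']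
    calc _ = x ^ s * x * (x ^ (-1 - s)
          * ∫ t in Set.Ioi (0 : ℝ), (1 - Real.exp (-(t * x))) * t ^ (-1 - s)) := by
          rw [show x ^ s * x * (x ^ (-1 - s)
            * ∫ t in Set.Ioi (0 : ℝ), (1 - Real.exp (-(t * x))) * t ^ (-1 - s))
            = (x ^ (-1 - s) * x ^ s * x)
              * ∫ t in Set.Ioi (0 : ℝ), (1 - Real.exp (-(t * x))) * t ^ (-1 - s) by ring,
            h4, one_mul]
      _ = _ := by rw [h]; field_simp

lemma fracConst_pos {s : ℝ} (hs₀ : 0 < s) (hs₁ : s < 1) : 0 < fracConst s := by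
  have hi := integrableOn_frac hs₀ hs₁ zero_le_one
  simp only [mul_one] at hi
  have h0 : ∀ t ∈ Set.Ioi (0 : ℝ), 0 < (1 - Real.exp (-t)) * t ^ (-1 - s) := fun t ht => by
    rw [Set.mem_Ioi] at ht
    have h1 : Real.exp (-t) < 1 := by
      simpa using Real.exp_lt_exp.2 (show -t < 0 by linarith)
    exact mul_pos (by linarith) (Real.rpow_pos_of_pos ht _)
  rw [fracConst, setIntegral_pos_iff_support_of_nonneg_ae ?_ hi]
  · have : Set.Ioi (0 : ℝ) ⊆ (Function.support fun t : ℝ => (1 - Real.exp (-t)) * t ^ (-1 - s))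
        ∩ Set.Ioi 0 := fun t ht => ⟨(h0 t ht).ne', ht⟩
    refine lt_of_lt_of_le ?_ (measure_mono this)
    simp
  · filter_upwards [ae_restrict_mem measurableSet_Ioi] with t ht using (h0 t ht).le

/-! ### The inequality for finite sums of eigenfunctions -/

/-- The part of the mode of frequency `x` in the lower bound for the loss of information. -/
lemma integral_tail {s : ℝ} (hs₀ : 0 < s) {x c : ℝ} (hx : 0 ≤ x) :
    IntegrableOn (fun t : ℝ => x * c * (Set.Ioi (1 / x)).indicator (fun t => t ^ (-1 - s)) t)
      (Set.Ioi 0) ∧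
    ∫ t in Set.Ioi (0 : ℝ), x * c * (Set.Ioi (1 / x)).indicator (fun t => t ^ (-1 - s)) t
      = x ^ (1 + s) * c / s := by
  rcases hx.eq_or_lt with rfl | hx
  -- Here 1 / 0 = 0, so the indicator covers the whole half-line, but the factor x = 0 removes it.
  · simp [Real.zero_rpow (show 1 + s ≠ 0 by linarith)]
  · have hx' : 0 < 1 / x := by positivity
    have hsub : Set.Ioi (1 / x) ⊆ Set.Ioi 0 := Set.Ioi_subset_Ioi hx'.le
    have h1 : IntegrableOn (fun t : ℝ => t ^ (-1 - s)) (Set.Ioi (1 / x)) :=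
      integrableOn_Ioi_rpow_of_lt (by linarith) hx'
    refine ⟨((integrable_indicator_iff measurableSet_Ioi).2 h1).integrableOn.const_mul (x * c), ?_⟩
    rw [integral_const_mul, setIntegral_indicator measurableSet_Ioi, Set.inter_eq_right.2 hsub,
      integral_Ioi_rpow_of_lt (by linarith) hx', Real.rpow_add hx, Real.rpow_one, one_div,
      Real.inv_rpow hx.le, show -1 - s + 1 = -s by ring, Real.rpow_neg hx.le, inv_inv]
    field_simp

/-- The derivative is an integral of `dFisher w (g - heat p N t)` against t^{-1-s}. At each t
convexity and `sum_modes_le` bound it below by the modes with λ_n > 1/t, and ∫_{1/λ}^∞ t^{-1-s} dt =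
λ^s / s. -/
lemma sum_modes_le_dFisher {s : ℝ} (hs₀ : 0 < s) (hs₁ : s < 1) {p : ℕ → Sm}
    (hp : ∀ n, p n ∈ eigenFns n) {N : ℕ}
    (hpos : ∀ σ, 0 < (∑ n ∈ Finset.range N, p n) σ) {Y : ℕ → Sm} (hY : ∀ n, Y n ∈ eigenFns n)
    (M : ℕ)
    (hbessel : ∀ f : Sm, ∑ n ∈ Finset.range M, integ (f * Y n) ^ 2 ≤ integ (f ^ 2)) :
    ∑ n ∈ Finset.range M, eigenvalue n ^ (1 + s)
        * (∫ σ, √((∑ n ∈ Finset.range N, p n) σ) * Y n σ ∂surf) ^ 2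
      ≤ 15 * s * fracConst s
        * dFisher (logSm _ hpos) (∑ n ∈ Finset.range N, eigenvalue n ^ s • p n) := by
  classical
  set g := ∑ n ∈ Finset.range N, p n with hg
  set a : ℕ → ℝ := fun n => ∫ σ, √(g σ) * Y n σ ∂surf with ha
  set w := logSm _ hpos with hw
  have h1 : ∀ t : ℝ, ∀ n, (1 - Real.exp (-(t * eigenvalue n))) * t ^ (-1 - s) * dFisher w (p n)
      = dFisher w ((1 - Real.exp (-(t * eigenvalue n))) • p n) * t ^ (-1 - s) := fun t n => by
    rw [map_smul, smul_eq_mul]; ring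
  have hsumt : ∀ t : ℝ, ∑ n ∈ Finset.range N,
      (1 - Real.exp (-(t * eigenvalue n))) * t ^ (-1 - s) * dFisher w (p n)
      = dFisher w (g - heat p N t) * t ^ (-1 - s) := fun t => by
    simp only [h1]
    rw [← Finset.sum_mul, ← map_sum]
    congr 2
    simp only [sub_smul, one_smul, Finset.sum_sub_distrib, heat, hg]
  have hint : ∀ n, IntegrableOn (fun t : ℝ => (1 - Real.exp (-(t * eigenvalue n)))
      * t ^ (-1 - s) * dFisher w (p n)) (Set.Ioi 0) := fun n =>
    (integrableOn_frac hs₀ hs₁ (eigenvalue_nonneg n)).mul_const _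
  have hL : fracConst s * dFisher w (∑ n ∈ Finset.range N, eigenvalue n ^ s • p n)
      = ∫ t in Set.Ioi (0 : ℝ), ∑ n ∈ Finset.range N,
      (1 - Real.exp (-(t * eigenvalue n))) * t ^ (-1 - s) * dFisher w (p n) := by
    rw [integral_finsetSum _ fun n _ => hint n, map_sum, Finset.mul_sum]
    refine Finset.sum_congr rfl fun n _ => ?_
    rw [integral_mul_const, integral_frac hs₀ (eigenvalue_nonneg n), map_smul, smul_eq_mul]
    ring
  have hR : ∫ t in Set.Ioi (0 : ℝ), ∑ n ∈ Finset.range M, eigenvalue n * a n ^ 2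
        * (Set.Ioi (1 / eigenvalue n)).indicator (fun t => t ^ (-1 - s)) t
      = ∑ n ∈ Finset.range M, eigenvalue n ^ (1 + s) * a n ^ 2 / s := by
    rw [integral_finsetSum _ fun n _ => (integral_tail hs₀ (eigenvalue_nonneg n)).1]
    exact Finset.sum_congr rfl fun n _ => (integral_tail hs₀ (eigenvalue_nonneg n)).2
  have hmono : ∫ t in Set.Ioi (0 : ℝ), ∑ n ∈ Finset.range M, eigenvalue n * a n ^ 2
        * (Set.Ioi (1 / eigenvalue n)).indicator (fun t => t ^ (-1 - s)) t
      ≤ ∫ t in Set.Ioi (0 : ℝ), 15 * ∑ n ∈ Finset.range N,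
      (1 - Real.exp (-(t * eigenvalue n))) * t ^ (-1 - s) * dFisher w (p n) := by
    refine setIntegral_mono_on
      (integrable_finsetSum _ fun n _ => (integral_tail hs₀ (eigenvalue_nonneg n)).1)
      ((integrable_finsetSum _ fun n _ => hint n).const_mul 15) measurableSet_Ioi fun t ht => ?_
    rw [Set.mem_Ioi] at ht
    rw [hsumt t]
    have htm := nonneg_mem_posTimes hp hpos ht.le
    have hb2 : ∀ f : Sm, ∑ n ∈ (Finset.range M).filter (fun n => 1 / eigenvalue n < t ∧
        0 < eigenvalue n), integ (f * Y n) ^ 2 ≤ integ (f ^ 2) := fun f =>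
      (Finset.sum_le_sum_of_subset_of_nonneg (Finset.filter_subset _ _)
        fun _ _ _ => sq_nonneg _).trans (hbessel f)
    have hS := sum_modes_le hp hpos hY _ hb2 ht.le fun n hn => by
      obtain ⟨h1, h2⟩ := (Finset.mem_filter.1 hn).2
      rw [div_lt_iff₀ h2] at h1
      linarith
    have hconv : fisherHeat p N 0 - fisherHeat p N t ≤ dFisher w (g - heat p N t) := by
      rw [fisherHeat_eq htm]
      have : fisherHeat p N 0 = fisherSm g w := by
        rw [fisherHeat, heat_zero, ← hg, fisherSm, integ_apply]
        congr 1
        ext σ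
        have := (hpos σ).ne'
        simp only [hw, gradMul, Sm.coe_mul, Sm.coe_sum, L_logSm_apply, Finset.mul_sum]
        refine Finset.sum_congr rfl fun i _ => ?_
        field_simp
      rw [this]
      exact fisherSm_sub_le (fun σ => (htm σ).le) (L_eq_mul_L_log g hpos) (L_eq_mul_L_log _ htm)
    have e1 : ∑ n ∈ Finset.range M, eigenvalue n * a n ^ 2
        * (Set.Ioi (1 / eigenvalue n)).indicator (fun t => t ^ (-1 - s)) t
        = (∑ n ∈ (Finset.range M).filter (fun n => 1 / eigenvalue n < t ∧
        0 < eigenvalue n), eigenvalue n * a n ^ 2) * t ^ (-1 - s) := by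
      rw [Finset.sum_filter, Finset.sum_mul]
      refine Finset.sum_congr rfl fun n _ => ?_
      by_cases h1 : 1 / eigenvalue n < t
      · rcases (eigenvalue_nonneg n).eq_or_lt with h2 | h2
        · simp [← h2]
        · simp only [Set.indicator, Set.mem_Ioi, h1, h2, and_self, if_true]
      · simp only [Set.indicator, Set.mem_Ioi, h1, if_false, false_and]; ring
    rw [e1, ← mul_assoc]
    refine mul_le_mul_of_nonneg_right ?_ (Real.rpow_nonneg ht.le _)
    exact hS.trans (by linarith)
  rw [hR, integral_const_mul, ← hL, ← Finset.sum_div, div_le_iff₀ hs₀] at hmono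
  linarith

/-! ### Passage to general positive smooth functions -/

/-- The derivative at `g` of the Fisher information in the direction `h`. -/
def dFn (g h : Sm) : ℝ :=
  ∫ σ, (∑ i, (2 * L i g σ * L i h σ / g σ - L i g σ ^ 2 * h σ / g σ ^ 2)) ∂surf

lemma dFisher_logSm (g : Sm) (hg : ∀ σ, 0 < g σ) (h : Sm) : dFisher (logSm g hg) h = dFn g h := by
  rw [dFisher_apply, integ_apply, dFn]
  congr 1
  ext σ
  rw [Sm.coe_sum]
  refine Finset.sum_congr rfl fun i _ => ?_
  have := (hg σ).ne'
  simp only [Sm.coe_sub, Sm.coe_mul, L_logSm_apply, two_mul, Sm.coe_add]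
  field_simp

lemma abs_le_norm_toC (f : Sm) (σ : S2) : |f σ| ≤ ‖toC f‖ := (toC f).norm_coe_le_norm σ

lemma exists_pos_lower_bound {f : S2 → ℝ} (hc : Continuous f) (hf : ∀ σ, 0 < f σ) :
    ∃ m, 0 < m ∧ ∀ σ, m ≤ f σ := by
  obtain ⟨σ₀, -, h0⟩ := isCompact_univ.exists_isMinOn Set.univ_nonempty hc.continuousOn
  exact ⟨f σ₀, hf σ₀, fun σ => h0 (Set.mem_univ σ)⟩

lemma eventually_abs_le {F : ℕ → Sm} {f : Sm}
    (h : Tendsto (fun N => toC (F N)) atTop (𝓝 (toC f))) {B : ℝ} (hB : ‖toC f‖ < B) :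
    ∀ᶠ N in atTop, ∀ σ, |F N σ| ≤ B := by
  filter_upwards [h.norm.eventually_lt_const hB] with N hN σ
  exact (abs_le_norm_toC _ σ).trans hN.le

lemma tendsto_apply {F : ℕ → Sm} {f : Sm}
    (h : Tendsto (fun N => toC (F N)) atTop (𝓝 (toC f))) (σ : S2) :
    Tendsto (fun N => F N σ) atTop (𝓝 (f σ)) :=
  ((ContinuousMap.evalCLM ℝ σ).continuous.tendsto _).comp h

lemma eventually_sub_lt {F : ℕ → Sm} {f : Sm}
    (h : Tendsto (fun N => toC (F N)) atTop (𝓝 (toC f))) {δ : ℝ} (hδ : 0 < δ) :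
    ∀ᶠ N in atTop, ∀ σ, f σ - δ < F N σ := by
  filter_upwards [Metric.tendsto_nhds.1 h δ hδ] with N hN σ
  have h1 : |F N σ - f σ| < δ := by
    refine lt_of_le_of_lt ?_ hN
    rw [dist_eq_norm, ← map_sub]
    exact abs_le_norm_toC (F N - f) σ
  linarith [(abs_lt.1 h1).1]

/-- Dominated convergence: eventually the denominators are at least half the minimum of g. -/
lemma tendsto_dFn {G H : ℕ → Sm} {g h : Sm} (hg : ∀ σ, 0 < g σ)
    (hG : Tendsto (fun N => toC (G N)) atTop (𝓝 (toC g)))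
    (hLG : ∀ i, Tendsto (fun N => toC (L i (G N))) atTop (𝓝 (toC (L i g))))
    (hH : Tendsto (fun N => toC (H N)) atTop (𝓝 (toC h)))
    (hLH : ∀ i, Tendsto (fun N => toC (L i (H N))) atTop (𝓝 (toC (L i h)))) :
    Tendsto (fun N => dFn (G N) (H N)) atTop (𝓝 (dFn g h)) := by
  obtain ⟨m, hm, hmg⟩ := exists_pos_lower_bound (Sm.continuous g) hg
  have e0 : ∀ᶠ N in atTop, ∀ σ, m / 2 ≤ G N σ := by
    filter_upwards [eventually_sub_lt hG (half_pos hm)] with N hN σ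
    linarith [hN σ, hmg σ]
  have e1 := fun i => eventually_abs_le (hLG i) (lt_add_one _)
  have e2 := eventually_abs_le hH (lt_add_one _)
  have e3 := fun i => eventually_abs_le (hLH i) (lt_add_one _)
  refine tendsto_integral_filter_of_dominated_convergence
    (fun _ => ∑ i, (2 * (‖toC (L i g)‖ + 1) * (‖toC (L i h)‖ + 1) / (m / 2)
      + (‖toC (L i g)‖ + 1) ^ 2 * (‖toC h‖ + 1) / (m / 2) ^ 2)) ?_ ?_
    (integrable_const _) ?_
  · refine .of_forall fun N => Measurable.aestronglyMeasurable ?_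
    have h1 := (Sm.continuous (G N)).measurable
    have h2 := fun i => (Sm.continuous (L i (G N))).measurable
    have h3 := (Sm.continuous (H N)).measurable
    have h4 := fun i => (Sm.continuous (L i (H N))).measurable
    fun_prop
  · filter_upwards [e0, eventually_all.2 e1, e2, eventually_all.2 e3] with N h0 h1 h2 h3
    refine .of_forall fun σ => ?_
    refine (norm_sum_le _ _).trans (Finset.sum_le_sum fun i _ => (norm_sub_le _ _).trans ?_)
    have hpos : 0 < G N σ := by linarith [h0 σ]
    simp only [Real.norm_eq_abs, abs_div, abs_mul, abs_pow, abs_of_pos hpos, Nat.abs_ofNat]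
    gcongr
    · exact h1 i σ
    · exact h3 i σ
    · exact h0 σ
    · exact h1 i σ
    · exact h2 σ
    · exact h0 σ
  · refine .of_forall fun σ => ?_
    refine tendsto_finsetSum _ fun i _ => ?_
    have h0 := tendsto_apply hG σ
    have h1 := tendsto_apply (hLG i) σ
    have h2 := tendsto_apply hH σ
    have h3 := tendsto_apply (hLH i) σ
    exact (((h1.const_mul 2).mul h3).div h0 (hg σ).ne').sub
      (((h1.pow 2).mul h2).div (h0.pow 2) (pow_ne_zero 2 (hg σ).ne'))

/-- The partial sums of a spectral multiplier. -/
def partSum (m : ℕ → ℝ) (f : Sm) (N : ℕ) : Sm := ∑ n ∈ Finset.range N, m n • comp n f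

lemma L_partSum (m : ℕ → ℝ) (f : Sm) (N : ℕ) (i : Fin 3) :
    L i (partSum m f N) = partSum m (L i f) N := by
  simp only [partSum, map_sum, Derivation.map_smul, comp_L]

lemma tendsto_partSum {m : ℕ → ℝ} (hm : Tame m) (f : Sm) :
    Tendsto (fun N => toC (partSum m f N)) atTop (𝓝 (toC (mult hm f))) := by
  have := (hasSum_toC_mult hm f).tendsto_sum_nat
  simpa only [partSum, map_sum, map_smul] using this

lemma tendsto_L_partSum {m : ℕ → ℝ} (hm : Tame m) (f : Sm) (i : Fin 3) :
    Tendsto (fun N => toC (L i (partSum m f N))) atTop (𝓝 (toC (L i (mult hm f)))) := by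
  simp only [L_partSum, L_mult]
  exact tendsto_partSum hm _

/-- Bessel's inequality with norms at most 1 instead of equal to 1, because `unitHarm` is zero where
the harmonic part vanishes. -/
lemma sum_inner_sq_le {E : Type*} [NormedAddCommGroup E] [InnerProductSpace ℝ E] (v : ℕ → E)
    (hv : ∀ m n, m ≠ n → inner ℝ (v m) (v n) = 0) (hv1 : ∀ n, ‖v n‖ ≤ 1) (x : E) (S : Finset ℕ) :
    ∑ n ∈ S, inner ℝ x (v n) ^ 2 ≤ ‖x‖ ^ 2 := by
  set y := ∑ n ∈ S, inner ℝ x (v n) • v n with hy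
  set T := ∑ n ∈ S, inner ℝ x (v n) ^ 2 with hT
  have h1 : inner ℝ x y = T := by
    rw [hy, inner_sum]
    exact Finset.sum_congr rfl fun n _ => by rw [inner_smul_right]; ring
  have h2 : ‖y‖ ^ 2 ≤ T := by
    rw [← real_inner_self_eq_norm_sq]
    conv_lhs => rw [hy]
    rw [sum_inner]
    refine Finset.sum_le_sum fun n hn => ?_
    rw [inner_smul_left, inner_sum, Finset.sum_eq_single n]
    · rw [inner_smul_right, real_inner_self_eq_norm_sq]
      have h3 : ‖v n‖ ^ 2 ≤ 1 := pow_le_one₀ (norm_nonneg _) (hv1 n)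
      simp only [conj_trivial]
      nlinarith [sq_nonneg (inner ℝ x (v n))]
    · intro k _ hk
      rw [inner_smul_right, hv n k hk.symm, mul_zero]
    · exact fun h => absurd hn h
  have h3 : T ≤ ‖x‖ * ‖y‖ := h1 ▸ real_inner_le_norm x y
  nlinarith [sq_nonneg (‖x‖ - ‖y‖)]

/-- The normalized harmonic part of degree `n`. -/
def unitHarm (n : ℕ) (u : L2) : Sm := ‖harmonicPart n u‖⁻¹ • harm n u

lemma unitHarm_mem (n : ℕ) (u : L2) : unitHarm n u ∈ eigenFns n :=
  Submodule.smul_mem _ _ (harm_mem n u)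

lemma norm_unitHarm_le (n : ℕ) (u : L2) : ‖sL2 (unitHarm n u)‖ ≤ 1 := by
  rw [unitHarm, map_smul, sL2_harm, norm_smul, norm_inv, norm_norm]
  exact inv_mul_le_one

lemma inner_unitHarm (n : ℕ) (u : L2) : inner ℝ (sL2 (unitHarm n u)) u = ‖harmonicPart n u‖ := by
  rw [← inner_sL2_harmonicPart (unitHarm_mem n u), unitHarm, map_smul, sL2_harm,
    inner_smul_left, real_inner_self_eq_norm_sq, conj_trivial]
  rcases eq_or_ne ‖harmonicPart n u‖ 0 with h | h
  · simp [h]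
  · field_simp

lemma bessel_unitHarm (u : L2) (S : Finset ℕ) (f : Sm) :
    ∑ n ∈ S, integ (f * unitHarm n u) ^ 2 ≤ integ (f ^ 2) := by
  have := sum_inner_sq_le (fun n => sL2 (unitHarm n u)) (fun m n hmn => by
    rw [inner_sL2, integ_eigenFns_mul hmn (unitHarm_mem m u) (unitHarm_mem n u)])
    (fun n => norm_unitHarm_le n u) (sL2 f) S
  simpa only [inner_sL2, norm_sL2_sq, sq f] using this

/-- The fractional Laplacian. -/
def fracLap {s : ℝ} (hs₀ : 0 ≤ s) (hs₁ : s ≤ 1) : Sm → Sm := mult (tame_eigenvalue_rpow hs₀ hs₁)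

lemma continuous_sqrtMap : Continuous sqrtMap :=
  ContinuousMap.continuous_postcomp (⟨Real.sqrt, Real.continuous_sqrt⟩ : C(ℝ, ℝ))

lemma continuous_toL2 : Continuous toL2 :=
  (ContinuousMap.toLp 2 surf ℝ : C(S2, ℝ) →L[ℝ] L2).continuous

/-- The main inequality at positive functions. -/
theorem sobolev_le_dFn {s : ℝ} (hs₀ : 0 < s) (hs₁ : s < 1) {g : Sm} (hg : ∀ σ, 0 < g σ) (M : ℕ) :
    ∑ n ∈ Finset.range M, eigenvalue n ^ (1 + s)
        * ‖harmonicPart n (toL2 (sqrtMap (toC g)))‖ ^ 2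
      ≤ 15 * s * fracConst s * dFn g (fracLap hs₀.le hs₁.le g) := by
  -- The test functions are the normalised harmonic parts of √g itself and stay fixed as N grows;
  -- pairing them with √g gives exactly the norms of those parts.
  set u := toL2 (sqrtMap (toC g)) with hu
  set G := partSum (fun _ => 1) g with hGdef
  have hG : Tendsto (fun N => toC (G N)) atTop (𝓝 (toC g)) := by
    have := tendsto_partSum tame_one g
    rwa [mult_one] at this
  have hLG : ∀ i, Tendsto (fun N => toC (L i (G N))) atTop (𝓝 (toC (L i g))) := fun i => by
    have := tendsto_L_partSum tame_one g i
    rwa [mult_one] at this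
  have hR := (tendsto_dFn hg hG hLG (tendsto_partSum (tame_eigenvalue_rpow hs₀.le hs₁.le) g)
    (tendsto_L_partSum (tame_eigenvalue_rpow hs₀.le hs₁.le) g)).const_mul
      (15 * s * fracConst s)
  have hinner : ∀ (f : C(S2, ℝ)) (n : ℕ), ∫ σ, f σ * unitHarm n u σ ∂surf
      = inner ℝ (sL2 (unitHarm n u)) (toL2 f) := fun f n => by
    rw [real_inner_comm, sL2_eq, inner_toL2]; rfl
  have hLt : Tendsto (fun N => ∑ n ∈ Finset.range M, eigenvalue n ^ (1 + s)
      * (∫ σ, √(G N σ) * unitHarm n u σ ∂surf) ^ 2) atTop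
      (𝓝 (∑ n ∈ Finset.range M, eigenvalue n ^ (1 + s) * ‖harmonicPart n u‖ ^ 2)) := by
    refine tendsto_finsetSum _ fun n _ => ((Tendsto.pow ?_ 2).const_mul _)
    rw [← inner_unitHarm]
    have h1 : Tendsto (fun N => toL2 (sqrtMap (toC (G N)))) atTop (𝓝 u) :=
      ((continuous_toL2.comp continuous_sqrtMap).tendsto _).comp hG
    refine (tendsto_const_nhds.inner h1).congr fun N => ?_
    exact (hinner (sqrtMap (toC (G N))) n).symm
  obtain ⟨m, hm, hmg⟩ := exists_pos_lower_bound (Sm.continuous g) hg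
  refine le_of_tendsto_of_tendsto hLt hR ?_
  filter_upwards [eventually_sub_lt hG hm] with N hN
  have hG1 : G N = ∑ n ∈ Finset.range N, comp n g := by simp [hGdef, partSum]
  have hpos : ∀ σ, 0 < (∑ n ∈ Finset.range N, comp n g) σ := fun σ => by
    rw [← hG1]; linarith [hN σ, hmg σ]
  have key := sum_modes_le_dFisher hs₀ hs₁ (fun n => comp_mem n g) hpos
    (fun n => unitHarm_mem n u) M (bessel_unitHarm u _)
  rw [dFisher_logSm] at key
  rw [hG1]
  exact key

/-! ### The Fisher information of a nonnegative function -/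

/-- The Fisher information of a smooth function in terms of the rotation fields. -/
def fisherFn (g : Sm) : ℝ := ∫ σ, (∑ i, L i g σ ^ 2 / g σ) ∂surf

lemma fisher_eq_fisherFn (g : Sm) : fisher g.1 = fisherFn g := by
  rw [fisher, fisherFn]
  congr 1
  ext σ
  -- At a zero the left integrand has the factor g σ = 0, the right one is a quotient by zero; both
  -- are 0.
  by_cases h0 : g σ = 0
  · simp [h0]
  have hσ := coe_ne_zero σ
  have he : radialExt (fun τ => Real.log (g τ)) =ᶠ[𝓝 (σ : E3)]
      fun x => Real.log (radialExt g.1 x) := by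
    filter_upwards [isOpen_ne.mem_nhds hσ] with x hx
    rw [radialExt_apply _ hx, radialExt_apply _ hx]
  have hd := (Smooth.differentiableAt g.2 hσ).hasFDerivAt
  have h0' : radialExt g.1 σ ≠ 0 := by rwa [radialExt_coe]
  have hF : fderiv ℝ (radialExt fun τ => Real.log (g τ)) σ
      = (g σ)⁻¹ • fderiv ℝ (radialExt g.1) σ := by
    rw [he.fderiv_eq, (hd.log h0').fderiv, radialExt_coe]
  rw [sphGrad, norm_gradient_sq, hF, Finset.sum_mul]
  · refine Finset.sum_congr rfl fun i _ => ?_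
    change ((g σ)⁻¹ * L i g σ) ^ 2 * g σ = _
    field_simp
  · rw [hF]
    change (g σ)⁻¹ * fderiv ℝ (radialExt g.1) σ σ = 0
    rw [fderiv_radialExt_self g hσ, mul_zero]

/-- The bound on χ gives 0 ≤ φ(t) ≤ φ(0) + ψ(0) t + B t²; the minimiser t = -ψ(0) / (2B) of the
right side yields the claim. -/
lemma sq_deriv_le_of_nonneg {φ ψ χ : ℝ → ℝ} {B : ℝ} (hB : 0 < B)
    (h1 : ∀ t, HasDerivAt φ (ψ t) t) (h2 : ∀ t, HasDerivAt ψ (χ t) t) (hχ : ∀ t, |χ t| ≤ B)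
    (h0 : ∀ t, 0 ≤ φ t) : ψ 0 ^ 2 ≤ 4 * B * φ 0 := by
  have hψ : ∀ t, |ψ t - ψ 0| ≤ B * |t| := fun t => by
    have := Convex.norm_image_sub_le_of_norm_hasDerivWithin_le (f := ψ) (f' := χ) (s := Set.univ)
      (C := B) (x := 0) (y := t) (fun x _ => (h2 x).hasDerivWithinAt) (fun x _ => hχ x)
      convex_univ trivial trivial
    simpa using this
  have hφ : ∀ t, |φ t - ψ 0 * t - φ 0| ≤ B * |t| * |t| := fun t => by
    have := Convex.norm_image_sub_le_of_norm_hasDerivWithin_le (f := fun x => φ x - ψ 0 * x)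
      (f' := fun x => ψ x - ψ 0) (s := Metric.closedBall 0 |t|)
      (C := B * |t|) (x := 0) (y := t)
      (fun x _ => by
        have := (h1 x).sub ((hasDerivAt_id x).const_mul (ψ 0))
        rw [mul_one] at this
        exact this.hasDerivWithinAt)
      (fun x hx => (hψ x).trans (by
        have : |x| ≤ |t| := by simpa using hx
        gcongr))
      (convex_closedBall _ _) (by simp) (by simp)
    simpa using this
  have h3 := (abs_le.1 (hφ (-ψ 0 / (2 * B)))).2
  have h4 := h0 (-ψ 0 / (2 * B))
  rw [mul_assoc, abs_mul_abs_self] at h3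
  have h5 : 0 ≤ φ 0 + ψ 0 * (-ψ 0 / (2 * B)) + B * ((-ψ 0 / (2 * B)) * (-ψ 0 / (2 * B))) := by
    linarith
  have h6 : φ 0 + ψ 0 * (-ψ 0 / (2 * B)) + B * ((-ψ 0 / (2 * B)) * (-ψ 0 / (2 * B)))
      = (4 * B * φ 0 - ψ 0 ^ 2) / (4 * B) := by field_simp; ring
  rw [h6] at h5
  have := (div_nonneg_iff.1 h5).resolve_right (fun h => by linarith [h.2])
  linarith [this.1]

/-- The gradient of a nonnegative function is controlled by its square root. -/
lemma exists_L_sq_le {g : Sm} (hg : ∀ σ, 0 ≤ g σ) :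
    ∃ C, 0 ≤ C ∧ ∀ i σ, L i g σ ^ 2 ≤ C * g σ := by
  -- The summand 1 keeps the bound on the second derivatives strictly positive.
  refine ⟨4 * (∑ i, ‖toC (L i (L i g))‖ + 1), by positivity, fun i σ => ?_⟩
  have h := sq_deriv_le_of_nonneg (B := ∑ i, ‖toC (L i (L i g))‖ + 1) (by positivity)
    (hasDerivAt_comp_rot g i σ) (hasDerivAt_comp_rot (L i g) i σ)
    (fun t => (abs_le_norm_toC _ _).trans ((Finset.single_le_sum
      (f := fun i => ‖toC (L i (L i g))‖) (fun _ _ => norm_nonneg _) (Finset.mem_univ i)).trans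
      (le_add_of_nonneg_right zero_le_one))) (fun t => hg _)
  simpa only [sphMap_rotEquiv_zero] using h

lemma L_eq_zero_of_eq_zero {g : Sm} (hg : ∀ σ, 0 ≤ g σ) {σ : S2} (h : g σ = 0) (i : Fin 3) :
    L i g σ = 0 := by
  obtain ⟨C, -, hC⟩ := exists_L_sq_le hg
  have := hC i σ
  rw [h, mul_zero] at this
  exact pow_eq_zero_iff two_ne_zero |>.1 (le_antisymm this (sq_nonneg _))

lemma integrable_fisher {g : Sm} (hg : ∀ σ, 0 ≤ g σ) :
    Integrable (fun σ => ∑ i, L i g σ ^ 2 / g σ) surf := by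
  obtain ⟨C, hC0, hC⟩ := exists_L_sq_le hg
  refine integrable_finsetSum _ fun i _ => ?_
  refine Integrable.mono' (integrable_const C) (Measurable.aestronglyMeasurable ?_)
    (.of_forall fun σ => ?_)
  · exact ((Sm.continuous (L i g)).measurable.pow_const 2).div (Sm.continuous g).measurable
  · rw [Real.norm_eq_abs, abs_of_nonneg (div_nonneg (sq_nonneg _) (hg σ))]
    rcases (hg σ).eq_or_lt with h | h
    · simpa [← h] using hC0
    · rw [div_le_iff₀ h]; exact hC i σ

/-- Joint convexity of a² / x. It survives at x = 0 because a = 0 there, consistent with 0 / 0 = 0.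
-/
lemma sq_div_convex {a b x y θ : ℝ} (hx : 0 ≤ x) (hax : x = 0 → a = 0) (hy : 0 < y) (h0 : 0 < θ)
    (h1 : θ < 1) :
    ((1 - θ) * a + θ * b) ^ 2 / ((1 - θ) * x + θ * y)
      ≤ (1 - θ) * (a ^ 2 / x) + θ * (b ^ 2 / y) := by
  have h1' : 0 < 1 - θ := by linarith
  rcases hx.eq_or_lt with h | h
  · rw [← h, hax h.symm]
    simp only [mul_zero, zero_add, div_zero]
    apply le_of_eq; field_simp
  · have hd : 0 < (1 - θ) * x + θ * y := by positivity
    rw [div_le_iff₀ hd]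
    have e : ((1 - θ) * (a ^ 2 / x) + θ * (b ^ 2 / y)) * ((1 - θ) * x + θ * y)
        - ((1 - θ) * a + θ * b) ^ 2 = (1 - θ) * θ * (x * y) * (a / x - b / y) ^ 2 := by
      field_simp; ring
    have : 0 ≤ (1 - θ) * θ * (x * y) * (a / x - b / y) ^ 2 := by positivity
    linarith

/-- Convexity of the Fisher information. -/
lemma fisherFn_convex {g k : Sm} (hg : ∀ σ, 0 ≤ g σ) (hk : ∀ σ, 0 < k σ) {θ : ℝ} (h0 : 0 < θ)
    (h1 : θ < 1) :
    fisherFn ((1 - θ) • g + θ • k) ≤ (1 - θ) * fisherFn g + θ * fisherFn k := by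
  have hi1 := integrable_fisher hg
  have hi2 := integrable_fisher fun σ => (hk σ).le
  have hi3 : Integrable (fun σ => ∑ i, L i ((1 - θ) • g + θ • k) σ ^ 2
      / ((1 - θ) • g + θ • k) σ) surf := integrable_fisher fun σ => by
    have h1' : 0 ≤ 1 - θ := by linarith
    have := mul_nonneg h1' (hg σ)
    have := mul_nonneg h0.le (hk σ).le
    simp only [Sm.coe_add, Sm.coe_smul]; linarith
  rw [fisherFn, fisherFn, fisherFn, ← integral_const_mul, ← integral_const_mul,
    ← integral_add (hi1.const_mul _) (hi2.const_mul _)]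
  refine integral_mono hi3 ((hi1.const_mul _).add (hi2.const_mul _)) fun σ => ?_
  simp only [Finset.mul_sum, ← Finset.sum_add_distrib]
  refine Finset.sum_le_sum fun i _ => ?_
  simp only [map_add, Derivation.map_smul, Sm.coe_add, Sm.coe_smul]
  exact sq_div_convex (hg σ) (fun h => L_eq_zero_of_eq_zero hg h i) (hk σ) h0 h1

lemma dFn_add (g : Sm) (hg : ∀ σ, 0 < g σ) (h k : Sm) : dFn g (h + k) = dFn g h + dFn g k := by
  simp only [← dFisher_logSm g hg, map_add]

lemma dFn_smul (g : Sm) (hg : ∀ σ, 0 < g σ) (c : ℝ) (h : Sm) : dFn g (c • h) = c * dFn g h := by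
  simp only [← dFisher_logSm g hg, map_smul, smul_eq_mul]

lemma integrable_dFn {g : Sm} (hg : ∀ σ, 0 < g σ) (h : Sm) :
    Integrable (fun σ => ∑ i, (2 * L i g σ * L i h σ / g σ - L i g σ ^ 2 * h σ / g σ ^ 2))
      surf := by
  refine integrable_continuous (continuous_finsetSum _ fun i _ => ?_)
  have h1 := Sm.continuous g
  have h2 := Sm.continuous (L i g)
  have h3 := Sm.continuous h
  have h4 := Sm.continuous (L i h)
  exact (((continuous_const.mul h2).mul h4).div h1 fun σ => (hg σ).ne').sub
    (((h2.pow 2).mul h3).div (h1.pow 2) fun σ => pow_ne_zero 2 (hg σ).ne')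

/-- The tangent inequality for the Fisher information at nonnegative functions. -/
lemma dFn_le_fisherFn {g k : Sm} (hg : ∀ σ, 0 ≤ g σ) (hk : ∀ σ, 0 < k σ) :
    dFn k g ≤ fisherFn g := by
  refine integral_mono (integrable_dFn hk g) (integrable_fisher hg) fun σ => ?_
  refine Finset.sum_le_sum fun i _ => ?_
  have hk' := hk σ
  rcases (hg σ).eq_or_lt with h | h
  · simp [← h, L_eq_zero_of_eq_zero hg h.symm i]
  · have e : L i g σ ^ 2 / g σ - (2 * L i k σ * L i g σ / k σ - L i k σ ^ 2 * g σ / k σ ^ 2)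
        = g σ * (L i g σ / g σ - L i k σ / k σ) ^ 2 := by
      field_simp; ring
    have : 0 ≤ g σ * (L i g σ / g σ - L i k σ / k σ) ^ 2 := by positivity
    linarith

lemma dFn_self {k : Sm} (hk : ∀ σ, 0 < k σ) : dFn k k = fisherFn k := by
  rw [dFn, fisherFn]
  congr 1
  ext σ
  refine Finset.sum_congr rfl fun i _ => ?_
  have := (hk σ).ne'
  field_simp
  ring

/-! ### The sign of the fractional Laplacian at zeros -/

lemma comp_zero_pos {g : Sm} (hg : ∀ σ, 0 ≤ g σ) (hg0 : g ≠ 0) :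
    ∃ c : ℝ, 0 < c ∧ ∀ σ, comp 0 g σ = c := by
  obtain ⟨c, hc⟩ := sphPoly_zero_eq (eigenFns_le_sphPoly 0 (comp_mem 0 g))
  refine ⟨c, ?_, fun σ => by rw [hc]; simp⟩
  have h1 : (1 : Sm) ∈ eigenFns 0 := mem_eigenFns.2 (by simp [Lap_one, eigenvalue])
  have h2 := integ_mul_comp h1 g
  rw [hc, mul_smul_comm, one_mul, one_mul, map_smul, integ_one, smul_eq_mul] at h2
  have h3 : 0 < integ g := by
    refine (Sm.continuous g).integral_pos_of_hasCompactSupport_nonneg_nonzero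
      (HasCompactSupport.of_compactSpace _) hg (x := ?_) ?_
    · exact (Function.ne_iff.1 fun h : g.1 = 0 => hg0 (Subtype.ext h)).choose
    · exact (Function.ne_iff.1 fun h : g.1 = 0 => hg0 (Subtype.ext h)).choose_spec
  rw [← h2] at h3
  exact pos_of_mul_pos_left h3 area_pos.le

lemma integrable_tsum_of_summable {α : Type*} [MeasurableSpace α] {μ : Measure α} {F : ℕ → α → ℝ}
    (hF : ∀ n, Integrable (F n) μ) (hs : Summable fun n => ∫ a, ‖F n a‖ ∂μ) :
    Integrable (fun a => ∑' n, F n a) μ := by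
  refine ⟨(AEMeasurable.tsum fun n => (hF n).aemeasurable).aestronglyMeasurable, ?_⟩
  calc ∫⁻ a, ‖∑' n, F n a‖ₑ ∂μ ≤ ∫⁻ a, ∑' n, ‖F n a‖ₑ ∂μ :=
        lintegral_mono fun a => enorm_tsum_le_tsum_enorm
    _ = ∑' n, ENNReal.ofReal (∫ a, ‖F n a‖ ∂μ) := by
        rw [lintegral_tsum fun n => (hF n).aestronglyMeasurable.enorm]
        exact tsum_congr fun n => (ofReal_integral_norm_eq_lintegral_enorm (hF n)).symm
    _ < ⊤ := hs.tsum_ofReal_lt_top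

/-- Where g vanishes, c_s (-Δ)^s g = -∫ e^{tΔ}g t^{-1-s} dt. The flow is nonnegative and tends to
the positive mean of g, so large times alone make the integral positive; no strong maximum principle
is needed. -/
lemma fracLap_neg_of_zero {s : ℝ} (hs₀ : 0 < s) (hs₁ : s < 1) {g : Sm} (hg : ∀ σ, 0 ≤ g σ)
    (hg0 : g ≠ 0) {σ : S2} (hσ : g σ = 0) : fracLap hs₀.le hs₁.le g σ < 0 := by
  set F : ℕ → ℝ → ℝ := fun n t =>
    (1 - Real.exp (-(t * eigenvalue n))) * t ^ (-1 - s) * comp n g σ with hF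
  have hFi : ∀ n, Integrable (F n) (volume.restrict (Set.Ioi 0)) := fun n =>
    (integrableOn_frac hs₀ hs₁ (eigenvalue_nonneg n)).mul_const _
  have hFint : ∀ n, ∫ t in Set.Ioi (0 : ℝ), F n t
      = fracConst s * (eigenvalue n ^ s * comp n g σ) := fun n => by
    rw [integral_mul_const, integral_frac hs₀ (eigenvalue_nonneg n)]; ring
  have hFnorm : ∀ n, ∫ t in Set.Ioi (0 : ℝ), ‖F n t‖
      = fracConst s * |eigenvalue n ^ s * comp n g σ| := fun n => by
    have : ∀ t ∈ Set.Ioi (0 : ℝ), ‖F n t‖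
        = (1 - Real.exp (-(t * eigenvalue n))) * t ^ (-1 - s) * |comp n g σ| := fun t ht => by
      rw [Set.mem_Ioi] at ht
      have h2 : 0 ≤ 1 - Real.exp (-(t * eigenvalue n)) := by
        have := Real.exp_le_one_iff.2 (neg_nonpos.2 (mul_nonneg ht.le (eigenvalue_nonneg n)))
        linarith
      rw [hF, Real.norm_eq_abs, abs_mul,
        abs_of_nonneg (mul_nonneg h2 (Real.rpow_nonneg ht.le _))]
    rw [setIntegral_congr_fun measurableSet_Ioi this, integral_mul_const,
      integral_frac hs₀ (eigenvalue_nonneg n), abs_mul,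
      abs_of_nonneg (Real.rpow_nonneg (eigenvalue_nonneg n) s)]
    ring
  have hsum := hasSum_mult (tame_eigenvalue_rpow hs₀.le hs₁.le) g σ
  have hS := hasSum_integral_of_summable_integral_norm hFi
    (by simp only [hFnorm]; exact hsum.summable.abs.mul_left _)
  simp only [hFint] at hS
  have hval := (hsum.mul_left (fracConst s)).unique hS
  obtain ⟨c, hc, hcσ⟩ := comp_zero_pos hg hg0
  have hone : HasSum (fun n => comp n g σ) 0 := by
    have := hasSum_mult tame_one g σ
    rw [mult_one, hσ] at this
    simpa using this
  have hexp : ∀ t : ℝ, 0 ≤ t → Tame fun n => Real.exp (-(t * eigenvalue n)) := fun t ht =>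
    ⟨1, 0, fun n => by
      rw [abs_of_pos (Real.exp_pos _)]
      simpa using mul_nonneg ht (eigenvalue_nonneg n)⟩
  set e : ℝ → ℝ := fun t => multFn (fun n => Real.exp (-(t * eigenvalue n))) g σ with he
  have hes : ∀ t : ℝ, 0 ≤ t →
      HasSum (fun n => Real.exp (-(t * eigenvalue n)) * comp n g σ) (e t) :=
    fun t ht => (hexp t ht).hasSum g σ
  have htsum : ∀ t : ℝ, 0 ≤ t → ∑' n, F n t = -(e t * t ^ (-1 - s)) := fun t ht => by
    have := (hone.sub (hes t ht)).mul_right (t ^ (-1 - s))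
    have e1 : (fun n => F n t)
        = fun n => (comp n g σ - Real.exp (-(t * eigenvalue n)) * comp n g σ) * t ^ (-1 - s) := by
      ext n; simp only [hF]; ring
    rw [e1, this.tsum_eq]
    ring
  have hG : Tendsto (fun N => toC (partSum (fun _ => 1) g N)) atTop (𝓝 (toC g)) := by
    have := tendsto_partSum tame_one g
    rwa [mult_one] at this
  -- `le_heat` concerns finite sums; the partial sums of g are eventually at least -δ.
  have he0 : ∀ t : ℝ, 0 ≤ t → 0 ≤ e t := by
    intro t ht
    refine le_of_forall_pos_le_add fun δ hδ => ?_
    have h1 : -δ ≤ e t := by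
      refine ge_of_tendsto (hes t ht).tendsto_sum_nat ?_
      filter_upwards [eventually_sub_lt hG hδ] with N hN
      rw [← heat_apply (fun n => comp n g) N t σ]
      refine le_heat (fun n => comp_mem n g) (fun τ => ?_) ht σ
      have := hN τ
      simp only [partSum, one_smul] at this
      linarith [hg τ]
    linarith
  obtain ⟨T, hT0, hT⟩ : ∃ T : ℝ, 0 < T ∧ ∀ t, T < t → c / 2 ≤ e t := by
    have habs : Summable fun n => |comp n g σ| := hone.summable.abs
    set B := ∑' n, |comp n g σ| with hB
    -- Every mode n ≥ 1 has eigenvalue at least 1, hence decays at least like e^{-t}.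
    have hlow : ∀ t : ℝ, 0 ≤ t → c - Real.exp (-t) * B ≤ e t := by
      intro t ht
      have h1 : HasSum (fun n => (if n = 0 then c else 0) - Real.exp (-t) * |comp n g σ|)
          (c - Real.exp (-t) * B) :=
        (hasSum_ite_eq 0 c).sub (habs.hasSum.mul_left _)
      refine hasSum_le (fun n => ?_) h1 (hes t ht)
      rcases Nat.eq_zero_or_pos n with rfl | hn
      · simp only [if_true, hcσ]
        have : eigenvalue 0 = 0 := by simp [eigenvalue]
        rw [this, mul_zero, neg_zero, Real.exp_zero, one_mul]
        have := mul_nonneg (Real.exp_pos (-t)).le (abs_nonneg c)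
        linarith
      · simp only [hn.ne', if_false, zero_sub]
        have h1 : (1 : ℝ) ≤ eigenvalue n := by
          have : (1 : ℝ) ≤ n := by exact_mod_cast hn
          unfold eigenvalue; nlinarith
        have h2 : Real.exp (-(t * eigenvalue n)) ≤ Real.exp (-t) :=
          Real.exp_le_exp.2 (by nlinarith)
        have h3 : -(Real.exp (-(t * eigenvalue n)) * |comp n g σ|)
            ≤ Real.exp (-(t * eigenvalue n)) * comp n g σ := by
          have := neg_abs_le (comp n g σ)
          nlinarith [Real.exp_pos (-(t * eigenvalue n))]
        nlinarith [abs_nonneg (comp n g σ)]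
    have hlim : Tendsto (fun t : ℝ => Real.exp (-t) * B) atTop (𝓝 0) := by
      simpa using Real.tendsto_exp_neg_atTop_nhds_zero.mul_const B
    obtain ⟨T, hT⟩ := eventually_atTop.1 (hlim.eventually_le_const (half_pos hc))
    refine ⟨max T 1, by positivity, fun t ht => ?_⟩
    have h1 := hT t ((le_max_left _ _).trans ht.le)
    have h2 := hlow t (by linarith [le_max_right T 1])
    linarith
  -- The parameters put the cutoff at time T and make the prefactor c / 2.
  have htail := integral_tail hs₀ (x := 1 / T) (c := T * (c / 2)) (by positivity)
  have hint : IntegrableOn (fun t : ℝ => ∑' n, F n t) (Set.Ioi 0) :=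
    integrable_tsum_of_summable hFi (by simp only [hFnorm]; exact hsum.summable.abs.mul_left _)
  have hle : ∫ t in Set.Ioi (0 : ℝ), ∑' n, F n t
      ≤ ∫ t in Set.Ioi (0 : ℝ), -(1 / T * (T * (c / 2))
        * (Set.Ioi (1 / (1 / T))).indicator (fun t => t ^ (-1 - s)) t) := by
    refine setIntegral_mono_on hint htail.1.neg measurableSet_Ioi fun t ht => ?_
    rw [Set.mem_Ioi] at ht
    rw [htsum t ht.le, neg_le_neg_iff, one_div_one_div]
    have hr := Real.rpow_nonneg ht.le (-1 - s)
    by_cases h : T < t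
    · rw [Set.indicator_of_mem (Set.mem_Ioi.2 h)]
      have : 1 / T * (T * (c / 2)) = c / 2 := by field_simp
      rw [this]
      exact mul_le_mul_of_nonneg_right (hT t h) hr
    · rw [Set.indicator_of_notMem (by simpa using h), mul_zero]
      exact mul_nonneg (he0 t ht.le) hr
  rw [integral_neg, htail.2, ← hval] at hle
  have hneg : 0 < (1 / T) ^ (1 + s) * (T * (c / 2)) / s := by positivity
  have hA := fracConst_pos hs₀ hs₁
  have hfin : fracConst s * fracLap hs₀.le hs₁.le g σ < 0 := by
    change fracConst s * mult (tame_eigenvalue_rpow hs₀.le hs₁.le) g σ < 0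
    linarith
  exact neg_of_mul_neg_right hfin hA.le

/-! ### The Gateaux derivative -/

lemma comp_add (n : ℕ) (f g : Sm) : comp n (f + g) = comp n f + comp n g :=
  comp_eq_of_integ (Submodule.add_mem _ (comp_mem n f) (comp_mem n g)) fun p hp => by
    rw [mul_add, mul_add, map_add, map_add, integ_mul_comp hp, integ_mul_comp hp]

lemma comp_smul (n : ℕ) (c : ℝ) (f : Sm) : comp n (c • f) = c • comp n f :=
  comp_eq_of_integ (Submodule.smul_mem _ _ (comp_mem n f)) fun p hp => by
    rw [mul_smul_comm, mul_smul_comm, map_smul, map_smul, integ_mul_comp hp]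

lemma mult_add_smul {m : ℕ → ℝ} (hm : Tame m) (f g : Sm) (c : ℝ) :
    mult hm (f + c • g) = mult hm f + c • mult hm g :=
  eq_of_comp_eq fun n => by
    simp only [comp_mult, comp_add, comp_smul, smul_add, smul_comm c]

/-- By compactness max(g, -h) ≥ m > 0. Where g ≥ m the perturbation is small; where -h ≥ m it adds
at least m |ε|. -/
lemma exists_lower_bound_add_smul {g h : Sm} (hg : ∀ σ, 0 ≤ g σ) (hh : ∀ σ, g σ = 0 → h σ < 0) :
    ∃ c ε₀ : ℝ, 0 < c ∧ 0 < ε₀ ∧ ∀ ε ∈ Set.Ioo (-ε₀) 0, ∀ σ, c * -ε ≤ g σ + ε * h σ := by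
  obtain ⟨m, hm, hmF⟩ := exists_pos_lower_bound
    ((Sm.continuous g).max (Sm.continuous h).neg) (fun σ => by
      rcases (hg σ).eq_or_lt with h0 | h0
      · exact lt_max_of_lt_right (neg_pos.2 (hh σ h0.symm))
      · exact lt_max_of_lt_left h0)
  refine ⟨m / 2, m / (2 * (‖toC h‖ + m)), half_pos hm, by positivity, fun ε hε σ => ?_⟩
  obtain ⟨h1, h2⟩ := hε
  have hn := norm_nonneg (toC h)
  have hd : 0 < 2 * (‖toC h‖ + m) := by positivity
  have h3 : -ε * (2 * (‖toC h‖ + m)) < m := by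
    rw [← lt_div_iff₀ hd]; linarith
  have h4 := abs_le.1 (abs_le_norm_toC h σ)
  rcases le_max_iff.1 (hmF σ) with h5 | h5
  · nlinarith
  · have h6 : m ≤ -h σ := h5
    nlinarith [hg σ]

lemma add_smul_eq_convex (g h : Sm) {ε δ : ℝ} (hδ : δ ≠ 0) :
    g + ε • h = (1 - ε / δ) • g + (ε / δ) • (g + δ • h) := by
  ext σ
  simp only [Sm.coe_add, Sm.coe_smul]
  field_simp
  ring

/-- Convexity on the segment from g to g + δh; monotone quotients have a limit in the extended
reals. -/
lemma slope_le_slope {g h : Sm} (hg : ∀ σ, 0 ≤ g σ) {ε δ : ℝ} (hδ : δ < ε) (hε : ε < 0)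
    (hk : ∀ σ, 0 < g σ + δ * h σ) :
    (fisherFn (g + δ • h) - fisherFn g) / δ ≤ (fisherFn (g + ε • h) - fisherFn g) / ε := by
  have hδ0 : δ < 0 := hδ.trans hε
  have h1 := fisherFn_convex hg (k := g + δ • h) hk (div_pos_of_neg_of_neg hε hδ0)
    ((div_lt_one_of_neg hδ0).2 hδ)
  rw [← add_smul_eq_convex g h hδ0.ne] at h1
  rw [le_div_iff_of_neg hε]
  calc fisherFn (g + ε • h) - fisherFn g
      ≤ (1 - ε / δ) * fisherFn g + ε / δ * fisherFn (g + δ • h) - fisherFn g := by linarith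
    _ = (fisherFn (g + δ • h) - fisherFn g) / δ * ε := by ring

/-- The tangent is taken at the positive function g + εh and evaluated at g, where `dFn` itself may
be meaningless. -/
lemma dFn_le_slope {g h : Sm} (hg : ∀ σ, 0 ≤ g σ) {ε : ℝ} (hε : ε < 0)
    (hk : ∀ σ, 0 < g σ + ε * h σ) :
    dFn (g + ε • h) h ≤ (fisherFn (g + ε • h) - fisherFn g) / ε := by
  have h1 := dFn_le_fisherFn hg (k := g + ε • h) hk
  have h2 : g = (g + ε • h) + (-ε) • h := by
    ext σ; simp only [Sm.coe_add, Sm.coe_smul]; ring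
  have h3 : dFn (g + ε • h) g = fisherFn (g + ε • h) + -ε * dFn (g + ε • h) h := by
    calc dFn (g + ε • h) g = dFn (g + ε • h) ((g + ε • h) + (-ε) • h) := by rw [← h2]
      _ = _ := by
        rw [dFn_add (g + ε • h) hk, dFn_smul (g + ε • h) hk, dFn_self (k := g + ε • h) hk]
  rw [le_div_iff_of_neg hε]
  linarith

/-- With κ = g + εh, both |∇κ|² ≤ C κ and |ε| ≤ κ / c hold uniformly in small ε < 0, so the factor ε
compensates the denominators and the integrand stays bounded. Dominated convergence does the rest.
-/
lemma tendsto_mul_dFn {g h : Sm} (hg : ∀ σ, 0 ≤ g σ) (hh : ∀ σ, g σ = 0 → h σ < 0) (k : Sm) :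
    Tendsto (fun ε : ℝ => ε * dFn (g + ε • h) k) (𝓝[<] 0) (𝓝 0) := by
  obtain ⟨c, ε₀, hc, hε₀, hlow⟩ := exists_lower_bound_add_smul hg hh
  set δ := -(min ε₀ 1) / 2 with hδ
  have hmin : 0 < min ε₀ 1 := lt_min hε₀ one_pos
  have hδ0 : δ < 0 := by rw [hδ]; linarith
  have hδ1 : -ε₀ < δ := by rw [hδ]; linarith [min_le_left ε₀ 1]
  have hδ2 : -1 < δ := by rw [hδ]; linarith [min_le_right ε₀ 1]
  have hk1 : ∀ σ, 0 ≤ (g + δ • h) σ := fun σ =>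
    (mul_nonneg hc.le (neg_nonneg.2 hδ0.le)).trans (hlow δ ⟨hδ1, hδ0⟩ σ)
  obtain ⟨C₁, hC₁, hC₁g⟩ := exists_L_sq_le hg
  obtain ⟨C₂, hC₂, hC₂g⟩ := exists_L_sq_le hk1
  -- g + εh lies between g and g + δh, so convexity of the square makes the constant independent of
  -- ε.
  have hL : ∀ ε ∈ Set.Ioo δ 0, ∀ i σ,
      L i (g + ε • h) σ ^ 2 ≤ (C₁ + C₂) * (g + ε • h) σ := by
    intro ε hε i σ
    have hθ0 : 0 < ε / δ := div_pos_of_neg_of_neg hε.2 hδ0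
    have hθ1 : ε / δ < 1 := (div_lt_one_of_neg hδ0).2 hε.1
    rw [add_smul_eq_convex g h hδ0.ne, map_add, Derivation.map_smul, Derivation.map_smul]
    generalize ε / δ = θ at *
    generalize g + δ • h = f at *
    simp only [Sm.coe_add, Sm.coe_smul]
    have h1 := hC₁g i σ
    have h2 := hC₂g i σ
    have h3 := hg σ
    have h4 := hk1 σ
    have h5 : ((1 - θ) * L i g σ + θ * L i f σ) ^ 2
        ≤ (1 - θ) * L i g σ ^ 2 + θ * L i f σ ^ 2 := by
      nlinarith [mul_nonneg (mul_nonneg hθ0.le (sub_nonneg.2 hθ1.le))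
        (sq_nonneg (L i g σ - L i f σ))]
    have h6 : (1 - θ) * L i g σ ^ 2 ≤ (1 - θ) * ((C₁ + C₂) * g σ) :=
      mul_le_mul_of_nonneg_left (by nlinarith) (by linarith)
    have h7 : θ * L i f σ ^ 2 ≤ θ * ((C₁ + C₂) * f σ) :=
      mul_le_mul_of_nonneg_left (by nlinarith) hθ0.le
    linarith
  have hev : ∀ᶠ ε : ℝ in 𝓝[<] 0, ε ∈ Set.Ioo δ 0 := Ioo_mem_nhdsLT hδ0
  set K := ‖toC g‖ + ‖toC h‖ with hK
  have hlim : Tendsto (fun ε : ℝ => ∫ σ, ε * (∑ i, (2 * L i (g + ε • h) σ * L i k σ / (g + ε • h) σ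
      - L i (g + ε • h) σ ^ 2 * k σ / (g + ε • h) σ ^ 2)) ∂surf) (𝓝[<] 0)
      (𝓝 (∫ _, 0 ∂surf)) := by
    refine tendsto_integral_filter_of_dominated_convergence
      (fun _ => ∑ i, (2 * (1 + (C₁ + C₂) * K) * ‖toC (L i k)‖ / c + (C₁ + C₂) * ‖toC k‖ / c))
      ?_ ?_ (integrable_const _) ?_
    · refine .of_forall fun ε => Measurable.aestronglyMeasurable ?_
      have h1 := (Sm.continuous (g + ε • h)).measurable
      have h2 := fun i => (Sm.continuous (L i (g + ε • h))).measurable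
      have h3 := (Sm.continuous k).measurable
      have h4 := fun i => (Sm.continuous (L i k)).measurable
      fun_prop
    · filter_upwards [hev] with ε hε
      refine .of_forall fun σ => ?_
      rw [Finset.mul_sum]
      refine (norm_sum_le _ _).trans (Finset.sum_le_sum fun i _ => ?_)
      have hA := hL ε hε i σ
      have hκ : c * -ε ≤ (g + ε • h) σ := hlow ε ⟨hδ1.trans hε.1, hε.2⟩ σ
      have hκ0 : 0 < (g + ε • h) σ := (mul_pos hc (neg_pos.2 hε.2)).trans_le hκ
      have hκK : (g + ε • h) σ ≤ K := by
        have h1 := (abs_le.1 (abs_le_norm_toC g σ)).2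
        have h2 := abs_le.1 (abs_le_norm_toC h σ)
        have h3 := norm_nonneg (toC h)
        have h4 := hε.1
        have h5 := hε.2
        simp only [Sm.coe_add, Sm.coe_smul]
        nlinarith
      have hB := abs_le_norm_toC (L i k) σ
      have hkσ := abs_le_norm_toC k σ
      generalize L i (g + ε • h) σ = A at *
      generalize (g + ε • h) σ = κ at *
      have hε' : |ε| ≤ κ / c := by
        rw [abs_of_neg hε.2, le_div_iff₀ hc]; linarith
      have hA1 : |A| ≤ 1 + (C₁ + C₂) * K := by
        have : (C₁ + C₂) * κ ≤ (C₁ + C₂) * K := by gcongr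
        nlinarith [sq_nonneg (|A| - 1), sq_abs A]
      rw [mul_sub]
      refine (norm_sub_le _ _).trans (add_le_add ?_ ?_)
      · simp only [Real.norm_eq_abs, abs_mul, abs_div, abs_of_pos hκ0, Nat.abs_ofNat]
        calc |ε| * (2 * |A| * |L i k σ| / κ)
            ≤ κ / c * (2 * (1 + (C₁ + C₂) * K) * ‖toC (L i k)‖ / κ) := by gcongr
          _ = _ := by field_simp
      · simp only [Real.norm_eq_abs, abs_mul, abs_div, abs_pow, abs_of_pos hκ0, sq_abs]
        calc |ε| * (A ^ 2 * |k σ| / κ ^ 2)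
            ≤ κ / c * ((C₁ + C₂) * κ * ‖toC k‖ / κ ^ 2) := by gcongr
          _ = _ := by field_simp
    · refine .of_forall fun σ => ?_
      rcases (hg σ).eq_or_lt with h0 | h0
      -- At a zero of g its gradient vanishes too, ε cancels from the quotients, and the integrand
      -- is ε times a constant.
      · have hLg := L_eq_zero_of_eq_zero hg h0.symm
        have hhσ := (hh σ h0.symm).ne
        have h1 : Tendsto (fun ε : ℝ => ε * ∑ i, (2 * L i h σ * L i k σ / h σ
            - L i h σ ^ 2 * k σ / h σ ^ 2)) (𝓝[<] 0) (𝓝 0) := by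
          have : Tendsto (fun ε : ℝ => ε) (𝓝[<] 0) (𝓝 0) := nhdsWithin_le_nhds
          have h2 := this.mul_const (∑ i, (2 * L i h σ * L i k σ / h σ
            - L i h σ ^ 2 * k σ / h σ ^ 2))
          rwa [zero_mul] at h2
        refine h1.congr' ?_
        filter_upwards [hev] with ε hε
        have hε0 := hε.2.ne
        congr 1
        refine Finset.sum_congr rfl fun i _ => ?_
        simp only [map_add, Derivation.map_smul, Sm.coe_add, Sm.coe_smul, hLg, ← h0, zero_add]
        field_simp
      · refine tendsto_nhdsWithin_of_tendsto_nhds ?_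
        have hc' : ContinuousAt (fun ε : ℝ => ε * ∑ i, (2 * L i (g + ε • h) σ * L i k σ
            / (g + ε • h) σ - L i (g + ε • h) σ ^ 2 * k σ / (g + ε • h) σ ^ 2)) 0 := by
          simp only [map_add, Derivation.map_smul, Sm.coe_add, Sm.coe_smul]
          have h2 : g σ + 0 * h σ ≠ 0 := by simpa using h0.ne'
          have h3 : (g σ + 0 * h σ) ^ 2 ≠ 0 := pow_ne_zero 2 h2
          fun_prop (disch := assumption)
        have := hc'.tendsto
        rwa [zero_mul] at this
  simp only [integral_zero, integral_const_mul] at hlim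
  exact hlim

/-- The partial sums of the Sobolev seminorm of the square root. -/
def sobSum (s : ℝ) (M : ℕ) (g : Sm) : ℝ :=
  ∑ n ∈ Finset.range M, eigenvalue n ^ (1 + s) * ‖harmonicPart n (toL2 (sqrtMap (toC g)))‖ ^ 2

lemma tendsto_sobSum (s : ℝ) (M : ℕ) (g h : Sm) :
    Tendsto (fun ε : ℝ => sobSum s M (g + ε • h)) (𝓝 0) (𝓝 (sobSum s M g)) := by
  have h1 : Tendsto (fun ε : ℝ => toC (g + ε • h)) (𝓝 0) (𝓝 (toC g)) := by
    have : Continuous fun ε : ℝ => toC g + ε • toC h := by fun_prop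
    simpa using this.tendsto 0
  refine tendsto_finsetSum _ fun n _ => ((Tendsto.pow (Tendsto.norm ?_) 2).const_mul _)
  exact (((eigenspace n).starProjection.continuous.comp
    (continuous_toL2.comp continuous_sqrtMap)).tendsto _).comp h1

lemma mul_sobolevSq_le {s K : ℝ} (hK : 0 < K) {g : Sm} {D : EReal}
    (h : ∀ M, ((sobSum s M g / K : ℝ) : EReal) ≤ D) :
    ((ENNReal.ofReal (1 / K) * sobolevSq (1 + s) (toL2 (sqrtMap (toC g))) : ENNReal) : EReal)
      ≤ D := by
  induction D with
  | bot => exact absurd (h 0) (by simp)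
  | top => exact le_top
  | coe d =>
    simp only [EReal.coe_le_coe_iff] at h
    -- The empty partial sum gives d ≥ 0, needed because `ENNReal.ofReal` truncates.
    have hd : 0 ≤ d := by simpa [sobSum] using h 0
    have h1 : sobolevSq (1 + s) (toL2 (sqrtMap (toC g))) ≤ ENNReal.ofReal (K * d) := by
      refine ENNReal.tsum_le_of_sum_range_le fun M => ?_
      rw [← ENNReal.ofReal_sum_of_nonneg fun n _ => mul_nonneg
        (Real.rpow_nonneg (eigenvalue_nonneg n) _) (sq_nonneg _)]
      refine ENNReal.ofReal_le_ofReal ?_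
      have := (div_le_iff₀ hK).1 (h M)
      rw [mul_comm]
      exact this
    have h2 : ENNReal.ofReal (1 / K) * sobolevSq (1 + s) (toL2 (sqrtMap (toC g)))
        ≤ ENNReal.ofReal d := by
      calc _ ≤ ENNReal.ofReal (1 / K) * ENNReal.ofReal (K * d) := by gcongr
        _ = ENNReal.ofReal d := by
          rw [← ENNReal.ofReal_mul (by positivity)]
          congr 1
          field_simp
    calc _ ≤ ((ENNReal.ofReal d : ENNReal) : EReal) := EReal.coe_ennreal_le_coe_ennreal_iff.2 h2
      _ = (d : EReal) := by rw [EReal.coe_ennreal_ofReal, max_eq_left hd]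

lemma continuousOn_fisher_deriv {X : Type*} [TopologicalSpace X] {a b c d : X → ℝ}
    (ha : Continuous a) (hb : Continuous b)
    (hc : Continuous c) (hd : Continuous d) {S : Set (ℝ × X)}
    (h0 : ∀ x ∈ S, c x.2 + x.1 * d x.2 ≠ 0) :
    ContinuousOn (fun x : ℝ × X => 2 * (a x.2 + x.1 * b x.2) * b x.2 / (c x.2 + x.1 * d x.2)
      - (a x.2 + x.1 * b x.2) ^ 2 * d x.2 / (c x.2 + x.1 * d x.2) ^ 2) S := by
  refine ContinuousOn.sub (ContinuousOn.div (by fun_prop) (by fun_prop) h0)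
    (ContinuousOn.div (by fun_prop) (by fun_prop) fun x hx => pow_ne_zero 2 (h0 x hx))

lemma hasDerivAt_fisherFn {g : Sm} (hg : ∀ σ, 0 < g σ) (h : Sm) :
    (∀ᶠ ε : ℝ in 𝓝 0, ∀ σ, 0 < g σ + ε * h σ) ∧
      HasDerivAt (fun ε : ℝ => fisherFn (g + ε • h)) (dFn g h) 0 := by
  obtain ⟨m, hm, hmg⟩ := exists_pos_lower_bound (Sm.continuous g) hg
  have hn := norm_nonneg (toC h)
  set U := Metric.ball (0 : ℝ) (m / (‖toC h‖ + 1)) with hU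
  have h0U : (0 : ℝ) ∈ U := Metric.mem_ball_self (by positivity)
  have hpos : ∀ ε ∈ U, ∀ σ, 0 < g σ + ε * h σ := by
    intro ε hε σ
    have h1 : |ε| < m / (‖toC h‖ + 1) := by simpa [hU] using hε
    rw [lt_div_iff₀ (by positivity)] at h1
    have h2 : |ε * h σ| ≤ |ε| * ‖toC h‖ := by
      rw [abs_mul]; gcongr; exact abs_le_norm_toC h σ
    nlinarith [neg_abs_le (ε * h σ), hmg σ, abs_nonneg ε]
  refine ⟨Filter.mem_of_superset (Metric.isOpen_ball.mem_nhds h0U) hpos, ?_⟩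
  have key := hasDerivAt_integral_sphere (U := U) Metric.isOpen_ball
    (Φ := fun ε σ => ∑ i, L i (g + ε • h) σ ^ 2 / (g + ε • h) σ)
    (Φ' := fun ε σ => ∑ i, (2 * L i (g + ε • h) σ * L i h σ / (g + ε • h) σ
      - L i (g + ε • h) σ ^ 2 * h σ / (g + ε • h) σ ^ 2)) ?_ ?_ ?_ h0U
  · have e0 : g + (0 : ℝ) • h = g := by simp
    simp only [e0] at key
    exact key
  · intro ε hε
    refine continuous_finsetSum _ fun i _ => ?_
    exact ((Sm.continuous (L i (g + ε • h))).pow 2).div (Sm.continuous (g + ε • h))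
      fun σ => (hpos ε hε σ).ne'
  · intro ε hε σ
    refine HasDerivAt.fun_sum fun i _ => ?_
    simp only [map_add, Derivation.map_smul, Sm.coe_add, Sm.coe_smul]
    have h1 : HasDerivAt (fun r : ℝ => L i g σ + r * L i h σ) (L i h σ) ε := by
      simpa using ((hasDerivAt_id ε).mul_const (L i h σ)).const_add (L i g σ)
    have h2 : HasDerivAt (fun r : ℝ => g σ + r * h σ) (h σ) ε := by
      simpa using ((hasDerivAt_id ε).mul_const (h σ)).const_add (g σ)
    have h3 := (hpos ε hε σ).ne'
    refine ((h1.pow 2).div h2 h3).congr_deriv ?_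
    simp only [Pi.pow_apply]
    field_simp
    ring
  · simp only [map_add, Derivation.map_smul, Sm.coe_add, Sm.coe_smul, Function.uncurry_def]
    refine continuousOn_finsetSum _ fun i _ => ?_
    exact continuousOn_fisher_deriv (Sm.continuous (L i g)) (Sm.continuous (L i h))
      (Sm.continuous g) (Sm.continuous h) fun x hx => (hpos x.1 hx.1 x.2).ne'

lemma fisher_add_mul (g h : Sm) (ε : ℝ) :
    fisher (fun σ => g σ + ε * h σ) = fisherFn (g + ε • h) := fisher_eq_fisherFn (g + ε • h)

lemma hasGateauxDeriv_of_pos {g : Sm} (hg : ∀ σ, 0 < g σ) (h : Sm) :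
    HasGateauxDeriv fisher g h (dFn g h : ℝ) := by
  obtain ⟨h1, h2⟩ := hasDerivAt_fisherFn hg h
  have hS : 𝓝[{ε : ℝ | ε ≠ 0 ∧ ∀ σ, 0 ≤ g σ + ε * h σ}] (0 : ℝ) = 𝓝[≠] 0 := by
    refine nhdsWithin_eq_nhdsWithin' h1 ?_
    ext ε
    simp only [Set.mem_inter_iff, Set.mem_ofPred_eq, Set.mem_compl_iff, Set.mem_singleton_iff]
    exact ⟨fun h => ⟨h.1.1, h.2⟩, fun h => ⟨⟨h.1, fun σ => (h.2 σ).le⟩, h.2⟩⟩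
  rw [HasGateauxDeriv, hS]
  refine ⟨inferInstance, ?_⟩
  refine (continuous_coe_real_ereal.tendsto _).comp ?_
  refine (hasDerivAt_iff_tendsto_slope.1 h2).congr fun ε => ?_
  rw [slope_def_field, fisher_add_mul, fisher_eq_fisherFn]
  simp

/-- The zero σ₀ rules out ε > 0, and all small ε < 0 are admissible, so the derivative is the left
limit of the monotone quotients. -/
lemma exists_hasGateauxDeriv_of_zero {g h : Sm} (hg : ∀ σ, 0 ≤ g σ)
    (hh : ∀ σ, g σ = 0 → h σ < 0) {σ₀ : S2} (h0 : g σ₀ = 0) :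
    ∃ D : EReal, HasGateauxDeriv fisher g h D ∧
      Tendsto (fun ε : ℝ => (((fisherFn (g + ε • h) - fisherFn g) / ε : ℝ) : EReal))
        (𝓝[<] 0) (𝓝 D) := by
  obtain ⟨c, ε₀, hc, hε₀, hlow⟩ := exists_lower_bound_add_smul hg hh
  have hpos : ∀ ε ∈ Set.Ioo (-ε₀) 0, ∀ σ, 0 < g σ + ε * h σ := fun ε hε σ =>
    (mul_pos hc (neg_pos.2 hε.2)).trans_le (hlow ε hε σ)
  have hS : 𝓝[{ε : ℝ | ε ≠ 0 ∧ ∀ σ, 0 ≤ g σ + ε * h σ}] (0 : ℝ) = 𝓝[<] 0 := by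
    refine nhdsWithin_eq_nhdsWithin' (Ioo_mem_nhds (neg_lt_zero.2 hε₀) hε₀) ?_
    ext ε
    constructor
    · rintro ⟨⟨h1, h2⟩, h3⟩
      refine ⟨lt_of_le_of_ne (not_lt.1 fun h4 => ?_) h1, h3⟩
      have := h2 σ₀
      rw [h0, zero_add] at this
      exact absurd this (not_le.2 (mul_neg_of_pos_of_neg h4 (hh σ₀ h0)))
    · rintro ⟨h1, h3⟩
      exact ⟨⟨h1.ne, fun σ => (hpos ε ⟨h3.1, h1⟩ σ).le⟩, h3⟩
  have hmono : MonotoneOn (fun ε : ℝ => (((fisherFn (g + ε • h) - fisherFn g) / ε : ℝ) : EReal))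
      (Set.Ioo (-ε₀) 0) := by
    intro δ hδ ε hε hle
    rcases hle.eq_or_lt with rfl | hlt
    · exact le_rfl
    · exact EReal.coe_le_coe_iff.2 (slope_le_slope hg hlt hε.2 (hpos δ hδ))
  have hlim := hmono.tendsto_nhdsWithin_Ioo_left (Set.nonempty_Ioo.2 (neg_lt_zero.2 hε₀))
    (OrderTop.bddAbove _)
  refine ⟨_, ⟨?_, ?_⟩, hlim⟩
  · rw [hS]; infer_instance
  · rw [hS]
    refine hlim.congr fun ε => ?_
    rw [fisher_add_mul, fisher_eq_fisherFn]

lemma exists_hasGateauxDeriv {s : ℝ} (hs₀ : 0 < s) (hs₁ : s < 1) {g : Sm} (hg : ∀ σ, 0 ≤ g σ) :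
    ∃ D : EReal, HasGateauxDeriv fisher g (fracLap hs₀.le hs₁.le g) D ∧
      ∀ M, ((sobSum s M g / (15 * s * fracConst s) : ℝ) : EReal) ≤ D := by
  have hK : 0 < 15 * s * fracConst s := by
    have := fracConst_pos hs₀ hs₁
    positivity
  set h := fracLap hs₀.le hs₁.le g with hh
  by_cases hpos : ∀ σ, 0 < g σ
  · refine ⟨_, hasGateauxDeriv_of_pos hpos h, fun M => EReal.coe_le_coe_iff.2 ?_⟩
    rw [div_le_iff₀' hK]
    exact sobolev_le_dFn hs₀ hs₁ hpos M
  obtain ⟨σ₀, h0⟩ : ∃ σ₀, g σ₀ = 0 := by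
    obtain ⟨σ₀, h0⟩ := not_forall.1 hpos
    exact ⟨σ₀, le_antisymm (not_lt.1 h0) (hg σ₀)⟩
  -- For g = 0 the direction is 0 as well: every ε ≠ 0 is admissible and the quotient is 0.
  by_cases hg0 : g = 0
  · have hh0 : h = 0 := by
      rw [hh, hg0]
      refine eq_of_comp_eq fun n => ?_
      have : comp n (0 : Sm) = 0 := by simpa using comp_smul n 0 (0 : Sm)
      rw [fracLap, comp_mult, this, smul_zero]
    refine ⟨0, ?_, fun M => ?_⟩
    · have hS : {ε : ℝ | ε ≠ 0 ∧ ∀ σ, 0 ≤ g σ + ε * h σ} = {0}ᶜ := by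
        ext ε; simp [hg0, hh0]
      rw [HasGateauxDeriv, hS]
      refine ⟨inferInstance, ?_⟩
      simp only [fisher_add_mul, fisher_eq_fisherFn, hh0, smul_zero, add_zero, sub_self, zero_div]
      exact tendsto_const_nhds
    · have h1 : sqrtMap (toC g) = 0 := by
        ext σ; simp [sqrtMap, hg0]
      have h2 : sobSum s M g = 0 := by
        refine Finset.sum_eq_zero fun n _ => ?_
        simp [h1, toL2, harmonicPart]
      simp [h2]
  have hneg : ∀ σ, g σ = 0 → h σ < 0 := fun σ hσ => fracLap_neg_of_zero hs₀ hs₁ hg hg0 hσ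
  obtain ⟨D, hD, hlim⟩ := exists_hasGateauxDeriv_of_zero hg hneg h0
  refine ⟨D, hD, fun M => ?_⟩
  obtain ⟨c, ε₀, hc, hε₀, hlow⟩ := exists_lower_bound_add_smul hg hneg
  set k := fracLap hs₀.le hs₁.le h with hk
  -- The inequality is applied at g + εh, whose fractional Laplacian is h + εk. The term with k is
  -- the error that vanishes by `tendsto_mul_dFn`.
  have hleft : Tendsto (fun ε : ℝ => sobSum s M (g + ε • h) / (15 * s * fracConst s)
      - ε * dFn (g + ε • h) k) (𝓝[<] 0) (𝓝 (sobSum s M g / (15 * s * fracConst s))) := by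
    have h1 := ((tendsto_sobSum s M g h).mono_left
      (nhdsWithin_le_nhds (s := Set.Iio 0))).div_const (15 * s * fracConst s)
    simpa using h1.sub (tendsto_mul_dFn hg hneg k)
  refine le_of_tendsto_of_tendsto ((continuous_coe_real_ereal.tendsto _).comp hleft) hlim ?_
  filter_upwards [Ioo_mem_nhdsLT (neg_lt_zero.2 hε₀)] with ε hε
  have hp : ∀ σ, 0 < (g + ε • h) σ := fun σ =>
    (mul_pos hc (neg_pos.2 hε.2)).trans_le (hlow ε hε σ)
  have h1 := sobolev_le_dFn hs₀ hs₁ hp M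
  have h2 : fracLap hs₀.le hs₁.le (g + ε • h) = h + ε • k := mult_add_smul _ g h ε
  rw [h2, dFn_add _ hp, dFn_smul _ hp, ← div_le_iff₀' hK] at h1
  have h3 := dFn_le_slope hg hε.2 hp
  refine EReal.coe_le_coe_iff.2 ?_
  change sobSum s M (g + ε • h) / (15 * s * fracConst s) ≤ _ at h1
  linarith

lemma isFracLaplacian_fracLap {s : ℝ} (hs₀ : 0 ≤ s) (hs₁ : s ≤ 1) (g : Sm) :
    IsFracLaplacian s (toC g) (toC (fracLap hs₀ hs₁ g)) := by
  refine ⟨(fracLap hs₀ hs₁ g).2, ?_⟩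
  have := hasSum_sL2_mult (tame_eigenvalue_rpow hs₀ hs₁) g
  simp only [comp, sL2_harm] at this
  exact this

end

end SphereFisher

/-! ### The theorem -/

theorem mainTheorem3 (s : ℝ) (hs₀ : 0 < s) (hs₁ : s < 1) :
    ∃ C : ℝ, 0 < C ∧ ∀ g : C(SphereFisher.S2, ℝ),
      SphereFisher.Smooth g → (∀ σ, 0 ≤ g σ) →
        ∃ h : C(SphereFisher.S2, ℝ), SphereFisher.IsFracLaplacian s g h ∧
          ∃ D : EReal, SphereFisher.HasGateauxDeriv SphereFisher.fisher g h D ∧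
            ((ENNReal.ofReal C *
              SphereFisher.sobolevSq (1 + s) (SphereFisher.toL2 (SphereFisher.sqrtMap g)) : ENNReal)
                : EReal) ≤ D := by
  have hK : 0 < 15 * s * SphereFisher.fracConst s := by
    have := SphereFisher.fracConst_pos hs₀ hs₁
    positivity
  refine ⟨1 / (15 * s * SphereFisher.fracConst s), by positivity, fun g hg hg0 => ?_⟩
  obtain ⟨f, rfl⟩ : ∃ f : SphereFisher.Sm, SphereFisher.toC f = g :=
    ⟨⟨g, hg⟩, ContinuousMap.ext fun _ => rfl⟩
  obtain ⟨D, hD, hM⟩ := SphereFisher.exists_hasGateauxDeriv hs₀ hs₁ (g := f) hg0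
  refine ⟨SphereFisher.toC (SphereFisher.fracLap hs₀.le hs₁.le f), ?_, D, ?_, ?_⟩
  · exact SphereFisher.isFracLaplacian_fracLap hs₀.le hs₁.le f
  · exact hD
  · exact SphereFisher.mul_sobolevSq_le hK hM
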